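/- **Setting.** A simplicial complex $\Delta$ on a finite vertex set $V$ contains all singletons $\{v\}$, $v\in V$. A *$(d-1)$-sphere* is a $\mathbb Z/2\mathbb Z$-homology $(d-1)$-sphere: a pure $(d-1)$-dimensional simplicial complex in which the link of every face $\sigma$ (including $\emptyset$) has the $\mathbb Z/2\mathbb Z$-homology of a sphere of dimension $d-1-|\sigma|$. A *missing face* is a non-face all of whose proper subsets are faces, and $S(i,d-1)$ is the class of $(d-1)$-spheres all of whose missing faces have dimension at most $i$. A sphere is *polytopal* if it is the boundary complex of a simplicial $d$-polytope $P\subset\mathbb R^d$. An embedding $p:V\to\mathbb R^d$ is *generic* if all the coordinates $p(v)_j$ are algebraically independent over $\mathbb Q$; it is *natural* if $\Delta$ is the boundary complex of a simplicial $d$-polytope $P\subset\mathbb R^d$ with $p(v)$ the vertex of $P$ corresponding to $v$. Let $I_\Delta\subset\mathbb R[x_v:v\in V]$ be the Stanley–Reisner ideal, $\theta_j=\sum_v p(v)_jx_v$ for $1\le j\le d$, $c=\sum_v x_v$, and $$A(\Delta)=A(\Delta,p)=\mathbb R[x_v:v\in V]/(I_\Delta+(\theta_1,\dots,\theta_d,c)).$$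 A standard graded Artinian ring $N=\mathbb R\oplus N_1\oplus\dots\oplus N_s$ with $N_s\ne0$ is *level* if its socle $\{y\in N: x_vy=0\text{ for all }v\}$ is concentrated in degree $s$. An *affine $k$-stress* on $(\Delta,p)$ is a homogeneous polynomial $\lambda\in\mathbb R[x_v:v\in V]$ of degree $k$, all of whose monomials are supported on faces of $\Delta$, with $\sum_v p(v)_j\,\partial\lambda/\partial x_v=0$ for all $j$ and $\sum_v\partial\lambda/\partial x_v=0$; these form a space $\mathcal S^a_k(\Delta,p)$. For a polynomial $\mu$, let $\partial_\mu$ be the differential operator obtained from $\mu$ by replacing every $x_v$ by $\partial/\partial x_v$. Let $\sigma^i$ denote the $i$-simplex, $\partial\sigma^i$ its boundary complex, and $*$ the join. The *affine stress reconstruction conjecture* of Novik and Zheng for a pair $(d,u)$ with $u\le d/2$ says: for every $\Delta\in S(d-u,d-1)$, every generic or natural embedding $p$ of $\Delta$ in $\mathbb R^d$, and all $1\le j<i\le u$, the space $\mathcal S^a_j(\Delta,p)$ is the linear span of all $\partial_\mu\omega$ with $\omega\in\mathcal S^a_i(\Delta,p)$ and $\mu$ homogeneous of degree $i-j$. **Statement.**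 1. For every $u\ge3$ there is a polytopal sphere $\Delta\in S(u,2u-1)$ such that, for every generic and for every natural embedding $p$ of $\Delta$ in $\mathbb R^{2u}$, the ring $A(\Delta,p)$ is Artinian but not level. 2. Consequently the affine stress reconstruction conjecture fails for $d=2u$, for every $u\ge3$. 3. Explicitly, for all integers $k\ge1$ and $u\ge3k$, the complex $\Delta=\partial\sigma^{u-k}*\partial\sigma^{u-k}*\partial\sigma^{2k}$ is a polytopal sphere in $S(u,2u-1)$, and for every generic and every natural embedding $p$ of $\Delta$ in $\mathbb R^{2u}$ the ring $A(\Delta,p)$ is Artinian and not level, and the conclusion of the conjecture (with $d=2u$) fails for $(\Delta,p)$. -/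

import Mathlib

/-!
# Simplicial spheres, Stanley–Reisner rings, level rings and affine stresses

Simplicial complexes are Mathlib's `AbstractSimplicialComplex V` on a finite vertex type `V`
(every singleton is a face).  Mathlib's complexes do not list the empty face; `AllFaces` adds it.
-/

noncomputable section

namespace SphereStress

open MvPolynomial

/-! ### Simplicial complexes -/

/-- All faces of a complex, including the empty one. -/
def AllFaces {V : Type*} (Δ : PreAbstractSimplicialComplex V) : Set (Finset V) :=
  insert ∅ Δ.faces

/-- A missing face: not a face, although all its proper subsets are faces. -/
def IsMissingFace {V : Type*} (Δ : PreAbstractSimplicialComplex V) (τ : Finset V) : Prop :=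
  τ ∉ AllFaces Δ ∧ ∀ σ : Finset V, σ ⊂ τ → σ ∈ AllFaces Δ

/-- The link of `σ`: its faces are the faces `τ` disjoint from `σ` such that `τ ∪ σ` is a face.
(Its vertex set may be smaller than `V`.) -/
def link {V : Type*} [DecidableEq V] (Δ : PreAbstractSimplicialComplex V) (σ : Finset V) :
    PreAbstractSimplicialComplex V where
  faces := {τ | τ.Nonempty ∧ Disjoint τ σ ∧ τ ∪ σ ∈ Δ.faces}
  isRelLowerSet_faces := by
    rintro τ ⟨hne, hd, hf⟩
    refine ⟨hne, fun ρ hρ hρne => ⟨hρne, Finset.disjoint_of_subset_left hρ hd, ?_⟩⟩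
    exact (Δ.isRelLowerSet_faces hf).2 (Finset.union_subset_union_left hρ)
      (hρne.mono Finset.subset_union_left)

/-- The boundary complex `∂σ^i` of the `i`-simplex with vertex set `Fin (i + 1)`: all nonempty
subsets except the whole vertex set. -/
def boundarySimplex (i : ℕ) (hi : 1 ≤ i) : AbstractSimplicialComplex (Fin (i + 1)) where
  faces := {s | s.Nonempty ∧ s ≠ Finset.univ}
  isRelLowerSet_faces := by
    rintro s ⟨hne, hs⟩
    refine ⟨hne, fun t ht htne => ⟨htne, fun h => hs ?_⟩⟩
    exact Finset.univ_subset_iff.mp (h ▸ ht)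
  singleton_mem := by
    refine fun v => ⟨Finset.singleton_nonempty v, fun h => ?_⟩
    have := congrArg Finset.card h
    simp at this
    omega

/-- The join of two complexes, on the disjoint union of their vertex sets. -/
def join {α β : Type*} (Δ : AbstractSimplicialComplex α) (Γ : AbstractSimplicialComplex β) :
    AbstractSimplicialComplex (α ⊕ β) where
  faces := {s | s.Nonempty ∧ s.toLeft ∈ AllFaces Δ.toPreAbstractSimplicialComplex ∧
    s.toRight ∈ AllFaces Γ.toPreAbstractSimplicialComplex}
  isRelLowerSet_faces := by
    rintro s ⟨hne, hl, hr⟩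
    refine ⟨hne, fun t ht htne => ⟨htne, ?_, ?_⟩⟩
    · rcases t.toLeft.eq_empty_or_nonempty with h | h
      · exact Or.inl h
      · have hsub := Finset.toLeft_subset_toLeft ht
        rcases hl with hl | hl
        · rw [hl] at hsub
          exact Or.inl (Finset.subset_empty.mp hsub)
        · exact Or.inr ((Δ.isRelLowerSet_faces hl).2 hsub h)
    · rcases t.toRight.eq_empty_or_nonempty with h | h
      · exact Or.inl h
      · have hsub := Finset.toRight_subset_toRight ht
        rcases hr with hr | hr
        · rw [hr] at hsub
          exact Or.inl (Finset.subset_empty.mp hsub)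
        · exact Or.inr ((Γ.isRelLowerSet_faces hr).2 hsub h)
  singleton_mem := by
    rintro (a | b)
    · refine ⟨Finset.singleton_nonempty _, Or.inr ?_, Or.inl ?_⟩
      · have : ({Sum.inl a} : Finset (α ⊕ β)).toLeft = {a} := by ext x; simp
        rw [this]
        exact Δ.singleton_mem a
      · ext x; simp
    · refine ⟨Finset.singleton_nonempty _, Or.inl ?_, Or.inr ?_⟩
      · ext x; simp
      · have : ({Sum.inr b} : Finset (α ⊕ β)).toRight = {b} := by ext x; simp
        rw [this]
        exact Γ.singleton_mem b

/-- The complex `∂σ^{u-k} * ∂σ^{u-k} * ∂σ^{2k}`. -/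
def tripleJoin (u k : ℕ) (hk : 1 ≤ k) (hu : 3 * k ≤ u) :
    AbstractSimplicialComplex (Fin (u - k + 1) ⊕ Fin (u - k + 1) ⊕ Fin (2 * k + 1)) :=
  join (boundarySimplex (u - k) (by omega))
    (join (boundarySimplex (u - k) (by omega)) (boundarySimplex (2 * k) (by omega)))

/-! ### Homology spheres over `ℤ/2ℤ` -/

section Homology

variable {V : Type*} [Fintype V] [DecidableEq V]

/-- Simplicial chains with coefficients in `ℤ/2ℤ` spanned by the faces with exactly `n` vertices,
that is, the augmented chain group in dimension `n - 1`. -/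
def chains (Δ : PreAbstractSimplicialComplex V) (n : ℕ) :
    Submodule (ZMod 2) (Finset V → ZMod 2) where
  carrier := {c | ∀ s, c s ≠ 0 → s ∈ AllFaces Δ ∧ s.card = n}
  add_mem' := by
    intro a b ha hb s hs
    by_cases h : a s = 0
    · exact hb s fun h' => hs (by simp [h, h'])
    · exact ha s h
  zero_mem' := by
    intro s hs
    exact absurd rfl hs
  smul_mem' := by
    intro r a ha s hs
    exact ha s fun h => hs (by simp [h])

/-- The boundary map: the coefficient of `t` in `∂c` is the sum of the coefficients in `c` of the
sets `t ∪ {v}` with `v ∉ t`. -/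
def boundaryMap (V : Type*) [Fintype V] [DecidableEq V] :
    (Finset V → ZMod 2) →ₗ[ZMod 2] (Finset V → ZMod 2) where
  toFun c t := ∑ v ∈ tᶜ, c (insert v t)
  map_add' a b := by
    funext t
    simp [Finset.sum_add_distrib]
  map_smul' r a := by
    funext t
    simp [Finset.mul_sum]

/-- Cycles of dimension `n - 1`. -/
def cycles (Δ : PreAbstractSimplicialComplex V) (n : ℕ) :
    Submodule (ZMod 2) (Finset V → ZMod 2) :=
  chains Δ n ⊓ LinearMap.ker (boundaryMap V)

/-- Boundaries of dimension `n - 1`. -/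
def boundaries (Δ : PreAbstractSimplicialComplex V) (n : ℕ) :
    Submodule (ZMod 2) (Finset V → ZMod 2) :=
  (chains Δ (n + 1)).map (boundaryMap V)

/-- The dimension of the reduced simplicial homology group `H̃_{n-1}(Δ; ℤ/2ℤ)`. -/
def bettiNumber (Δ : PreAbstractSimplicialComplex V) (n : ℕ) : ℕ :=
  Module.finrank (ZMod 2) (↥(cycles Δ n) ⧸ (boundaries Δ n).submoduleOf (cycles Δ n))

/-- `Δ` is a `ℤ/2ℤ`-homology `(d-1)`-sphere: it is pure of dimension `d - 1`, and the link of each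
face `σ` (the empty one included) has the reduced homology of a sphere of dimension
`d - 1 - |σ|`. -/
structure IsHomologySphere (d : ℕ) (Δ : AbstractSimplicialComplex V) : Prop where
  card_le : ∀ σ ∈ AllFaces Δ.toPreAbstractSimplicialComplex, σ.card ≤ d
  pure : ∀ σ ∈ AllFaces Δ.toPreAbstractSimplicialComplex,
    ∃ τ ∈ AllFaces Δ.toPreAbstractSimplicialComplex, σ ⊆ τ ∧ τ.card = d
  homology_link : ∀ σ ∈ AllFaces Δ.toPreAbstractSimplicialComplex, ∀ n : ℕ,
    bettiNumber (link Δ.toPreAbstractSimplicialComplex σ) n = if n + σ.card = d then 1 else 0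

/-- The class `S(i, d-1)`: `ℤ/2ℤ`-homology `(d-1)`-spheres all of whose missing faces have
dimension at most `i`. -/
def SphereClass (i d : ℕ) (Δ : AbstractSimplicialComplex V) : Prop :=
  IsHomologySphere d Δ ∧
    ∀ τ : Finset V, IsMissingFace Δ.toPreAbstractSimplicialComplex τ → τ.card ≤ i + 1

end Homology

/-! ### Embeddings -/

section Embeddings

variable {V : Type*} {d : ℕ}

/-- A generic embedding: all the coordinates are algebraically independent over `ℚ`. -/
def IsGenericEmbedding (p : V → Fin d → ℝ) : Prop :=
  AlgebraicIndependent ℚ fun vj : V × Fin d => p vj.1 vj.2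

/-- A natural embedding of `Δ`: the points `p v` are the distinct vertices of a full-dimensional
simplicial polytope `P = conv (p V)` in `ℝ^d`, and the faces of `Δ` are exactly the vertex sets of
the proper faces of `P`. -/
structure IsNaturalEmbedding (Δ : AbstractSimplicialComplex V) (p : V → Fin d → ℝ) : Prop where
  convexIndependent : ConvexIndependent ℝ p
  affineSpan_eq_top : affineSpan ℝ (Set.range p) = ⊤
  mem_faces_iff : ∀ s : Finset V, s.Nonempty →
    (s ∈ Δ.faces ↔
      IsExposed ℝ (convexHull ℝ (Set.range p)) (convexHull ℝ (p '' (s : Set V))) ∧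
      convexHull ℝ (p '' (s : Set V)) ≠ convexHull ℝ (Set.range p))
  affineIndependent : ∀ s ∈ Δ.faces, AffineIndependent ℝ fun v : s => p v

/-- `Δ` is the boundary complex of a simplicial `d`-polytope. -/
def IsPolytopal (d : ℕ) (Δ : AbstractSimplicialComplex V) : Prop :=
  ∃ p : V → Fin d → ℝ, IsNaturalEmbedding Δ p

end Embeddings

/-! ### The ring `A(Δ)` and level rings -/

section Rings

variable {V : Type*} [Fintype V] {d : ℕ}

/-- The Stanley–Reisner ideal, generated by the monomials of the missing faces. -/
def stanleyReisnerIdeal (Δ : AbstractSimplicialComplex V) : Ideal (MvPolynomial V ℝ) :=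
  Ideal.span {f | ∃ τ : Finset V, IsMissingFace Δ.toPreAbstractSimplicialComplex τ ∧
    f = ∏ v ∈ τ, X v}

/-- The linear form `θ_j = ∑ v, p(v)_j x_v`. -/
def theta (p : V → Fin d → ℝ) (j : Fin d) : MvPolynomial V ℝ :=
  ∑ v, C (p v j) * X v

/-- The ideal `I_Δ + (θ_1, …, θ_d, c)`, with `c = ∑ v, x_v`. -/
def artinianIdeal (Δ : AbstractSimplicialComplex V) (p : V → Fin d → ℝ) :
    Ideal (MvPolynomial V ℝ) :=
  stanleyReisnerIdeal Δ ⊔ Ideal.span (Set.range (theta p)) ⊔ Ideal.span {∑ v, (X v : MvPolynomial V ℝ)}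

/-- The ring `A(Δ) = ℝ[Δ]/(θ_1, …, θ_d, c) = ℝ[x_v : v ∈ V]/(I_Δ + (θ_1, …, θ_d, c))`. -/
abbrev ringA (Δ : AbstractSimplicialComplex V) (p : V → Fin d → ℝ) : Type _ :=
  MvPolynomial V ℝ ⧸ artinianIdeal Δ p

/-- The degree `i` component of the graded ring `ℝ[x_v : v ∈ V]/I`, for a homogeneous ideal `I`. -/
def gradedPiece (I : Ideal (MvPolynomial V ℝ)) (i : ℕ) : Submodule ℝ (MvPolynomial V ℝ ⧸ I) :=
  (homogeneousSubmodule V ℝ i).map (Ideal.Quotient.mkₐ ℝ I).toLinearMap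

/-- The socle of `ℝ[x_v : v ∈ V]/I`: the elements killed by every variable. -/
def socle (I : Ideal (MvPolynomial V ℝ)) : Submodule ℝ (MvPolynomial V ℝ ⧸ I) :=
  ⨅ v : V, LinearMap.ker (LinearMap.mulLeft ℝ (Ideal.Quotient.mk I (X v)))

/-- The entry `r_i` of the socle vector: the dimension of the degree `i` part of the socle. -/
def socleNumber (I : Ideal (MvPolynomial V ℝ)) (i : ℕ) : ℕ :=
  Module.finrank ℝ ↥(socle I ⊓ gradedPiece I i)

/-- The standard graded Artinian ring `ℝ[x_v : v ∈ V]/I` is level: for some `s` (the socle degree)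
its components of degree greater than `s` vanish, and its socle vector is `(0, …, 0, a)` with
`a ≥ 1` in position `s`. -/
def IsLevel (I : Ideal (MvPolynomial V ℝ)) : Prop :=
  ∃ s : ℕ, (∀ i, s < i → gradedPiece I i = ⊥) ∧ (∀ i, i < s → socleNumber I i = 0) ∧
    1 ≤ socleNumber I s

end Rings

/-! ### Affine stresses -/

section Stresses

variable {V : Type*}

theorem commute_pderiv (v w : V) :
    Commute ((pderiv v : Derivation ℝ (MvPolynomial V ℝ) (MvPolynomial V ℝ)) :
        Module.End ℝ (MvPolynomial V ℝ))
      ((pderiv w : Derivation ℝ (MvPolynomial V ℝ) (MvPolynomial V ℝ)) :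
        Module.End ℝ (MvPolynomial V ℝ)) := by
  classical
  have h : ⁅(pderiv v : Derivation ℝ (MvPolynomial V ℝ) (MvPolynomial V ℝ)),
      (pderiv w : Derivation ℝ (MvPolynomial V ℝ) (MvPolynomial V ℝ))⁆ = 0 := by
    apply MvPolynomial.derivation_ext
    intro i
    simp only [Derivation.commutator_apply, pderiv_X, Derivation.zero_apply]
    by_cases h1 : i = w <;> by_cases h2 : i = v <;> simp [Pi.single_apply, h1, h2] <;> aesop
  refine LinearMap.ext fun f => ?_
  have := congrArg (fun D => D f) h
  simpa [Derivation.commutator_apply, sub_eq_zero] using this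

/-- The operator `∂_m = ∏ v, (∂/∂x_v)^(m v)` of a monomial with exponent vector `m`. -/
def monomialDiff (m : V →₀ ℕ) : Module.End ℝ (MvPolynomial V ℝ) :=
  m.support.noncommProd
    (fun v => ((pderiv v : Derivation ℝ (MvPolynomial V ℝ) (MvPolynomial V ℝ)) :
      Module.End ℝ (MvPolynomial V ℝ)) ^ m v)
    (fun v _ w _ _ => (commute_pderiv v w).pow_pow (m v) (m w))

/-- The differential operator `∂_μ` of a polynomial `μ`, in which each variable `x_v` is replaced
by `∂/∂x_v`. -/
def polyDiff (μ : MvPolynomial V ℝ) : Module.End ℝ (MvPolynomial V ℝ) :=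
  ∑ m ∈ μ.support, coeff m μ • monomialDiff m

/-- The space of affine `k`-stresses on `(Δ, p)`: homogeneous polynomials of degree `k` all of whose
terms are supported on faces of `Δ`, and which are killed by `∂_{θ_1}, …, ∂_{θ_d}` and `∂_c`. -/
def affineStresses [Fintype V] {d : ℕ} (Δ : AbstractSimplicialComplex V) (p : V → Fin d → ℝ)
    (k : ℕ) : Submodule ℝ (MvPolynomial V ℝ) where
  carrier := {f | f.IsHomogeneous k ∧
    (∀ m ∈ f.support, m.support ∈ AllFaces Δ.toPreAbstractSimplicialComplex) ∧
    (∀ j : Fin d, ∑ v, p v j • pderiv v f = 0) ∧ ∑ v, pderiv v f = 0}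
  add_mem' := by
    classical
    rintro f g ⟨hf1, hf2, hf3, hf4⟩ ⟨hg1, hg2, hg3, hg4⟩
    refine ⟨hf1.add hg1, fun m hm => ?_, fun j => ?_, ?_⟩
    · rcases Finset.mem_union.mp (support_add hm) with h | h
      · exact hf2 m h
      · exact hg2 m h
    · simp [smul_add, Finset.sum_add_distrib, hf3 j, hg3 j]
    · simp [Finset.sum_add_distrib, hf4, hg4]
  zero_mem' := ⟨isHomogeneous_zero _ _ _, by simp, by simp, by simp⟩
  smul_mem' := by
    rintro a f ⟨hf1, hf2, hf3, hf4⟩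
    refine ⟨(homogeneousSubmodule V ℝ k).smul_mem a hf1, fun m hm => hf2 m (support_smul hm),
      fun j => ?_, ?_⟩
    · have : ∑ v, p v j • pderiv v (a • f) = a • ∑ v, p v j • pderiv v f := by
        simp [Finset.smul_sum, smul_comm a]
      rw [this, hf3 j, smul_zero]
    · have : ∑ v, pderiv v (a • f) = a • ∑ v, pderiv v f := by
        simp [Finset.smul_sum]
      rw [this, hf4, smul_zero]

/-- The reconstruction property of `(Δ, p)` up to degree `u`: for all `1 ≤ j < i ≤ u`, the affine
`j`-stresses are spanned by the derivatives `∂_μ ω` of the affine `i`-stresses `ω`, where `μ` runs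
over the homogeneous polynomials of degree `i - j`. -/
def StressReconstruction [Fintype V] {d : ℕ} (Δ : AbstractSimplicialComplex V)
    (p : V → Fin d → ℝ) (u : ℕ) : Prop :=
  ∀ i j : ℕ, 1 ≤ j → j < i → i ≤ u →
    affineStresses Δ p j =
      Submodule.span ℝ {f | ∃ ω ∈ affineStresses Δ p i, ∃ μ : MvPolynomial V ℝ,
        μ.IsHomogeneous (i - j) ∧ f = polyDiff μ ω}

/-- The affine stress reconstruction conjecture for given `d` and `u ≤ d/2`: every `(d-1)`-sphere
in `S(d-u, d-1)` has the reconstruction property up to degree `u`, for each generic and each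
natural embedding in `ℝ^d`. -/
def ReconstructionConjecture (d u : ℕ) : Prop :=
  ∀ (V : Type) [Fintype V] [DecidableEq V] (Δ : AbstractSimplicialComplex V),
    SphereClass (d - u) d Δ →
      ∀ p : V → Fin d → ℝ, IsGenericEmbedding p ∨ IsNaturalEmbedding Δ p →
        StressReconstruction Δ p u

end Stresses

end SphereStress

end

/-!
The complex `Δ = ∂σ^{u-k} * ∂σ^{u-k} * ∂σ^{2k}` is encoded by the colouring of its vertices by the
three factors of the join: a set is a face if and only if it misses a vertex of each colour
(`IsColorComplex`). With this description, deleting a vertex that shares its colour with another one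
leaves a cone, which gives the homology of `Δ` and of its links by induction
(`IsColorComplex.isHomologySphere`), and the free sum of three simplices is a simplicial polytope
with boundary complex `Δ` (`IsColorComplex.isPolytopal`). The missing faces are the colour classes.

There are `2u + 3` vertices in `ℝ^{2u}`, so the affine dependencies of an embedding form a plane.
A basis of this plane is an affine Gale transform: it attaches a vector of `ℝ²`, that is, a binary
linear form, to each vertex, and the quotient by `θ_1, …, θ_d, c` replaces `x_v` by the form of `v`
(`IsGalePair.exists_section`). Hence `A(Δ, p)` is the quotient of the ring of binary forms by the
products `f`, `g`, `h` of the forms of the three colours, which have degrees `u - k + 1`,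
`u - k + 1` and `2k + 1`. Binary forms are handled as univariate polynomials of bounded degree.

* Counting dimensions, the quotient is nonzero in degree `u` (`exists_notMem_relSpace`), and there
  is a nonzero syzygy of `f`, `g`, `h` in degree `u + 1` (`exists_syzygy`).
* If `f`, `g` and `h` are minimal generators, then a syzygy of least degree `n ≤ u + 1` has no
  nonzero constant coefficients, and yields a socle element in degree `n - 2 ≤ u - 1`
  (`exists_socle_form`). So the ring is not level.
* A socle element of degree `j` pairs to zero with every derivative of an affine `(j + 1)`-stress,
  but not with every affine `j`-stress, as the affine stresses form the Macaulay inverse system of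
  the ideal. So reconstruction fails (`not_stressReconstruction_of_socle`).

It remains to show that `f`, `g` and `h` are minimal generators. As the degree of `h` is at most
that of `f` and `g`, this means that no nontrivial real combination of `f` and `g` is a multiple of
`h`. For a natural embedding the facets of `Δ` give
positive relations between Gale vectors of three different colours. These imply that `f / g` is
strictly monotone on an interval containing the roots of `h`, of which there are at least two
(`IsNaturalEmbedding.exists_galePair`). For a generic embedding the condition follows from the
nonvanishing of finitely many polynomials with rational coefficients, which is checked at one
special configuration (`IsGenericEmbedding.exists_galePair`). The same two lemmas provide a Gale
transform in which the vectors of the first two colours are pairwise independent, which makes the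
ring Artinian (`IsColorComplex.finite_ringA`).
-/

namespace SphereStress

/-! ### Complexes given by a colouring -/

/-- `Δ` is the complex on the coloured vertex set `V` whose faces are the sets that miss at least
one vertex of each colour: the join of the boundaries of the simplices spanned by the colour
classes. -/
def IsColorComplex {V ι : Type*} (κ : V → ι) (Δ : AbstractSimplicialComplex V) : Prop :=
  ∀ s : Finset V, s ∈ AllFaces Δ.toPreAbstractSimplicialComplex ↔ ∀ i, ∃ v, v ∉ s ∧ κ v = i

theorem mem_faces_iff_mem_allFaces {V : Type*} (Δ : PreAbstractSimplicialComplex V) {s : Finset V}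
    (hs : s.Nonempty) : s ∈ Δ.faces ↔ s ∈ AllFaces Δ := by
  simp [AllFaces, hs.ne_empty]

theorem mem_allFaces_of_subset {V : Type*} {Δ : PreAbstractSimplicialComplex V} {s t : Finset V}
    (hs : s ∈ AllFaces Δ) (h : t ⊆ s) : t ∈ AllFaces Δ := by
  rcases t.eq_empty_or_nonempty with rfl | ht
  · exact Or.inl rfl
  · have hs' := (mem_faces_iff_mem_allFaces Δ (ht.mono h)).2 hs
    exact Or.inr ((Δ.isRelLowerSet_faces hs').2 h ht)

theorem mem_allFaces_link {V : Type*} [DecidableEq V] {Δ : PreAbstractSimplicialComplex V}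
    {σ t : Finset V} (hσ : σ ∈ AllFaces Δ) :
    t ∈ AllFaces (link Δ σ) ↔ Disjoint t σ ∧ t ∪ σ ∈ AllFaces Δ := by
  rcases t.eq_empty_or_nonempty with rfl | ht
  · simp only [Finset.disjoint_empty_left, Finset.empty_union, hσ, and_self, iff_true]
    exact Or.inl rfl
  · rw [← mem_faces_iff_mem_allFaces _ ht,
      ← mem_faces_iff_mem_allFaces _ (ht.mono Finset.subset_union_left)]
    simp [link, ht]

section Homology

variable {V : Type*} [DecidableEq V]

/-- The cone operator `c ↦ w * c` on chains; faces that already contain `w` are discarded. -/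
def coneMap (w : V) : (Finset V → ZMod 2) →ₗ[ZMod 2] (Finset V → ZMod 2) where
  toFun c t := if w ∈ t then c (t.erase w) else 0
  map_add' a b := by
    funext t
    by_cases h : w ∈ t <;> simp [h]
  map_smul' r a := by
    funext t
    by_cases h : w ∈ t <;> simp [h]

/-- The operator sending a chain `v * a + b`, with `a` and `b` supported on sets avoiding `v`,
to `a`. -/
def linkMap (v : V) : (Finset V → ZMod 2) →ₗ[ZMod 2] (Finset V → ZMod 2) where
  toFun c t := if v ∈ t then 0 else c (insert v t)
  map_add' a b := by
    funext t
    by_cases h : v ∈ t <;> simp [h]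
  map_smul' r a := by
    funext t
    by_cases h : v ∈ t <;> simp [h]

theorem coneMap_apply (w : V) (c : Finset V → ZMod 2) (t : Finset V) :
    coneMap w c t = if w ∈ t then c (t.erase w) else 0 := rfl

theorem linkMap_apply (v : V) (c : Finset V → ZMod 2) (t : Finset V) :
    linkMap v c t = if v ∈ t then 0 else c (insert v t) := rfl

theorem linkMap_coneMap_self (v : V) (c : Finset V → ZMod 2) (hc : ∀ t, v ∈ t → c t = 0) :
    linkMap v (coneMap v c) = c := by
  funext t
  by_cases h : v ∈ t
  · simp [linkMap_apply, h, hc t h]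
  · simp [linkMap_apply, coneMap_apply, h]

theorem linkMap_coneMap_of_ne {v w : V} (hvw : v ≠ w) (c : Finset V → ZMod 2)
    (hc : ∀ t, v ∈ t → c t = 0) : linkMap v (coneMap w c) = 0 := by
  funext t
  by_cases h : v ∈ t
  · simp [linkMap_apply, h]
  · have : c ((insert v t).erase w) = 0 := hc _ (by simp [hvw])
    simp [linkMap_apply, coneMap_apply, h, this]

theorem coneMap_mem_chains {Δ Γ : PreAbstractSimplicialComplex V} {w : V} {n : ℕ}
    {c : Finset V → ZMod 2} (hc : c ∈ chains Γ n)
    (h : ∀ s ∈ AllFaces Γ, c s ≠ 0 → w ∉ s → insert w s ∈ AllFaces Δ) :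
    coneMap w c ∈ chains Δ (n + 1) := by
  intro t ht
  rw [coneMap_apply] at ht
  by_cases hw : w ∈ t
  · rw [if_pos hw] at ht
    obtain ⟨h1, h2⟩ := hc _ ht
    have h3 := h _ h1 ht (Finset.notMem_erase w t)
    rw [Finset.insert_erase hw] at h3
    refine ⟨h3, ?_⟩
    rw [← Finset.card_erase_add_one hw, h2]
  · exact absurd (if_neg hw) ht

theorem linkMap_mem_chains {Δ : PreAbstractSimplicialComplex V} {v : V} {n : ℕ}
    (hv : {v} ∈ AllFaces Δ) {c : Finset V → ZMod 2} (hc : c ∈ chains Δ (n + 1)) :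
    linkMap v c ∈ chains (link Δ {v}) n := by
  intro t ht
  rw [linkMap_apply] at ht
  by_cases h : v ∈ t
  · exact absurd (if_pos h) ht
  · rw [if_neg h] at ht
    obtain ⟨h1, h2⟩ := hc _ ht
    refine ⟨(mem_allFaces_link hv).2 ⟨by simpa using h, ?_⟩, ?_⟩
    · rwa [Finset.union_comm, ← Finset.insert_eq]
    · rw [Finset.card_insert_of_notMem h] at h2
      omega

theorem eq_zero_of_mem_chains_link {Δ : PreAbstractSimplicialComplex V} {v : V} {n : ℕ}
    (hv : {v} ∈ AllFaces Δ) {c : Finset V → ZMod 2} (hc : c ∈ chains (link Δ {v}) n) :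
    ∀ t, v ∈ t → c t = 0 := by
  intro t ht
  by_contra h
  have := ((mem_allFaces_link hv).1 (hc t h).1).1
  simp [ht] at this

variable [Fintype V]

theorem boundaryMap_apply (c : Finset V → ZMod 2) (t : Finset V) :
    boundaryMap V c t = ∑ v ∈ tᶜ, c (insert v t) := rfl

/-- The cone operator is a contracting homotopy of the full simplex. -/
theorem boundaryMap_coneMap (w : V) (c : Finset V → ZMod 2) :
    boundaryMap V (coneMap w c) = c + coneMap w (boundaryMap V c) := by
  funext t
  simp only [Pi.add_apply, boundaryMap_apply, coneMap_apply]
  by_cases hw : w ∈ t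
  · rw [if_pos hw]
    have h1 : (t.erase w)ᶜ = insert w tᶜ := by
      ext x
      simp only [Finset.mem_compl, Finset.mem_erase, Finset.mem_insert]
      tauto
    rw [h1, Finset.sum_insert (by simpa using hw), Finset.insert_erase hw, ← add_assoc,
      CharTwo.add_self_eq_zero, zero_add]
    refine Finset.sum_congr rfl fun x hx => ?_
    have hxw : x ≠ w := by
      rintro rfl
      exact (Finset.mem_compl.mp hx) hw
    rw [if_pos (Finset.mem_insert_of_mem hw), Finset.erase_insert_of_ne hxw]
  · rw [if_neg hw, add_zero, Finset.sum_eq_single w]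
    · simp [Finset.erase_insert hw]
    · intro x _ hxw
      rw [if_neg]
      simp [hw, Ne.symm hxw]
    · intro h
      exact absurd (Finset.mem_compl.mpr hw) h

theorem boundaryMap_linkMap (v : V) (c : Finset V → ZMod 2) :
    boundaryMap V (linkMap v c) = linkMap v (boundaryMap V c) := by
  funext t
  simp only [boundaryMap_apply, linkMap_apply]
  by_cases hv : v ∈ t
  · rw [if_pos hv]
    exact Finset.sum_eq_zero fun x _ => if_pos (Finset.mem_insert_of_mem hv)
  · rw [if_neg hv]
    have h1 : tᶜ = insert v (insert v t)ᶜ := by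
      ext x
      simp only [Finset.mem_compl, Finset.mem_insert]
      by_cases hx : x = v
      · subst hx; simpa using hv
      · simp [hx]
    rw [h1, Finset.sum_insert (by simp), if_pos (Finset.mem_insert_self v t), zero_add]
    refine Finset.sum_congr rfl fun x hx => ?_
    have hxv : v ≠ x := by
      rintro rfl
      simp at hx
    rw [if_neg (by simp [hxv, hv]), Finset.insert_comm]

theorem bettiNumber_eq_of_surjective {Δ : PreAbstractSimplicialComplex V} {n : ℕ}
    {M : Type*} [AddCommGroup M] [Module (ZMod 2) M] (φ : ↥(cycles Δ n) →ₗ[ZMod 2] M)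
    (hs : Function.Surjective φ) (hk : ∀ z, φ z = 0 ↔ (z : Finset V → ZMod 2) ∈ boundaries Δ n) :
    bettiNumber Δ n = Module.finrank (ZMod 2) M := by
  have h : (boundaries Δ n).submoduleOf (cycles Δ n) = LinearMap.ker φ := by
    ext z
    rw [LinearMap.mem_ker, hk]
    rfl
  exact ((Submodule.quotEquivOfEq _ _ h).trans
    (LinearMap.quotKerEquivOfSurjective φ hs)).finrank_eq

theorem bettiNumber_zero_of_cone {Δ : PreAbstractSimplicialComplex V} {v w : V}
    (hcone : ∀ s ∈ AllFaces Δ, v ∉ s → insert w s ∈ AllFaces Δ) : bettiNumber Δ 0 = 0 := by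
  have := bettiNumber_eq_of_surjective (Δ := Δ) (n := 0) (M := PUnit) 0
    (fun _ => ⟨0, Subsingleton.elim _ _⟩) (fun z => by
      simp only [LinearMap.zero_apply, true_iff]
      obtain ⟨z, hz, hz'⟩ := z
      refine ⟨coneMap w z, coneMap_mem_chains hz fun s hs hne _ => hcone s hs ?_, ?_⟩
      · have := (hz s hne).2
        simp [Finset.card_eq_zero.mp this]
      · rw [boundaryMap_coneMap, LinearMap.mem_ker.mp hz', map_zero, add_zero])
  rw [this]
  exact Module.finrank_zero_of_subsingleton

/-- If the faces avoiding `v` form a cone with apex `w`, then the complex has the homology of the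
suspension of the link of `v`. -/
theorem bettiNumber_succ_of_cone {Δ : PreAbstractSimplicialComplex V} {v w : V} (hvw : v ≠ w)
    (hv : {v} ∈ AllFaces Δ) (hcone : ∀ s ∈ AllFaces Δ, v ∉ s → insert w s ∈ AllFaces Δ) (n : ℕ) :
    bettiNumber Δ (n + 1) = bettiNumber (link Δ {v}) n := by
  have hmem : ∀ z : ↥(cycles Δ (n + 1)), linkMap v z.1 ∈ cycles (link Δ {v}) n := fun z =>
    ⟨linkMap_mem_chains hv z.2.1, by
      rw [SetLike.mem_coe, LinearMap.mem_ker, boundaryMap_linkMap, LinearMap.mem_ker.mp z.2.2,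
        map_zero]⟩
  let φ₀ : ↥(cycles Δ (n + 1)) →ₗ[ZMod 2] ↥(cycles (link Δ {v}) n) :=
    ((linkMap v).domRestrict (cycles Δ (n + 1))).codRestrict _ hmem
  refine bettiNumber_eq_of_surjective
    (((boundaries (link Δ {v}) n).submoduleOf (cycles (link Δ {v}) n)).mkQ ∘ₗ φ₀) ?_ ?_
  · intro q
    obtain ⟨⟨a, ha, ha'⟩, rfl⟩ := Submodule.mkQ_surjective _ q
    have ha0 := eq_zero_of_mem_chains_link hv ha
    have hz : coneMap v a + coneMap w a ∈ cycles Δ (n + 1) := by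
      refine ⟨add_mem (coneMap_mem_chains ha fun s hs _ _ => ?_)
        (coneMap_mem_chains ha fun s hs _ _ => ?_), ?_⟩
      · have := ((mem_allFaces_link hv).1 hs).2
        rwa [Finset.union_comm, ← Finset.insert_eq] at this
      · obtain ⟨h1, h2⟩ := (mem_allFaces_link hv).1 hs
        exact hcone s (mem_allFaces_of_subset h2 Finset.subset_union_left) (by simpa using h1)
      · rw [SetLike.mem_coe, LinearMap.mem_ker, map_add, boundaryMap_coneMap, boundaryMap_coneMap,
          LinearMap.mem_ker.mp ha', map_zero, map_zero, add_zero, CharTwo.add_self_eq_zero]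
    refine ⟨⟨_, hz⟩, ?_⟩
    rw [LinearMap.comp_apply]
    congr 1
    apply Subtype.ext
    change linkMap v (coneMap v a + coneMap w a) = a
    rw [map_add, linkMap_coneMap_self v a ha0, linkMap_coneMap_of_ne hvw a ha0, add_zero]
  · rintro ⟨z, hz, hz'⟩
    rw [LinearMap.comp_apply, Submodule.mkQ_apply, Submodule.Quotient.mk_eq_zero]
    change linkMap v z ∈ boundaries (link Δ {v}) n ↔ z ∈ boundaries Δ (n + 1)
    rw [SetLike.mem_coe, LinearMap.mem_ker] at hz'
    constructor
    · rintro ⟨x, hx, hxz⟩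
      have hx0 := eq_zero_of_mem_chains_link hv hx
      have hcx : coneMap v x ∈ chains Δ (n + 1 + 1) :=
        coneMap_mem_chains hx fun s hs _ _ => by
          have := ((mem_allFaces_link hv).1 hs).2
          rwa [Finset.union_comm, ← Finset.insert_eq] at this
      -- `z + ∂(v * x)` is a cycle on the faces avoiding `v`, and these form a cone
      set z' := z + boundaryMap V (coneMap v x) with hz'def
      have hz'e : z' = z + x + coneMap v (linkMap v z) := by
        rw [hz'def, boundaryMap_coneMap, hxz, add_assoc]
      have hcyc : boundaryMap V z' = 0 := by
        rw [hz'e, map_add, map_add, hz', boundaryMap_coneMap, boundaryMap_linkMap, hz', map_zero,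
          map_zero, hxz, zero_add, add_zero, CharTwo.add_self_eq_zero]
      have hch : z' ∈ chains Δ (n + 1) := by
        rw [hz'e]
        refine add_mem (add_mem hz ?_) ?_
        · intro s hs
          obtain ⟨h1, h2⟩ := hx s hs
          exact ⟨mem_allFaces_of_subset ((mem_allFaces_link hv).1 h1).2
            Finset.subset_union_left, h2⟩
        · exact coneMap_mem_chains (linkMap_mem_chains hv hz) fun s hs _ _ => by
            have := ((mem_allFaces_link hv).1 hs).2
            rwa [Finset.union_comm, ← Finset.insert_eq] at this
      have hlk : linkMap v z' = 0 := by
        rw [hz'def, map_add, ← boundaryMap_linkMap, linkMap_coneMap_self v x hx0, hxz,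
          CharTwo.add_self_eq_zero]
      have havoid : ∀ s, z' s ≠ 0 → v ∉ s := by
        intro s hs hvs
        have := congrFun hlk (s.erase v)
        rw [linkMap_apply, if_neg (Finset.notMem_erase v s), Finset.insert_erase hvs] at this
        exact hs this
      refine ⟨coneMap w z' + coneMap v x, add_mem (coneMap_mem_chains hch fun s hs hne _ =>
        hcone s hs (havoid s hne)) hcx, ?_⟩
      rw [map_add, boundaryMap_coneMap w z', hcyc, map_zero, add_zero, hz'def, add_assoc,
        CharTwo.add_self_eq_zero, add_zero]
    · rintro ⟨y, hy, rfl⟩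
      exact ⟨linkMap v y, linkMap_mem_chains hv hy, boundaryMap_linkMap v y⟩

theorem bettiNumber_of_allFaces_eq_singleton {Δ : PreAbstractSimplicialComplex V}
    (h : ∀ s, s ∈ AllFaces Δ ↔ s = ∅) (n : ℕ) : bettiNumber Δ n = if n = 0 then 1 else 0 := by
  have hch : ∀ m, m ≠ 0 → ∀ c ∈ chains Δ m, c = 0 := by
    intro m hm c hc
    funext s
    by_contra hs
    obtain ⟨h1, h2⟩ := hc s hs
    rw [(h s).1 h1] at h2
    exact hm h2.symm
  split_ifs with hn
  · subst hn
    rw [bettiNumber_eq_of_surjective (M := ZMod 2)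
      ((LinearMap.proj (∅ : Finset V)).domRestrict (cycles Δ 0))]
    · exact Module.finrank_self _
    · intro r
      refine ⟨⟨Pi.single ∅ r, ?_, ?_⟩, ?_⟩
      · intro s hs
        have : s = ∅ := by
          by_contra hne
          exact hs (Pi.single_eq_of_ne (M := fun _ => ZMod 2) hne r)
        subst this
        exact ⟨Or.inl rfl, rfl⟩
      · rw [SetLike.mem_coe, LinearMap.mem_ker]
        funext t
        rw [boundaryMap_apply]
        exact Finset.sum_eq_zero fun x _ => Pi.single_eq_of_ne (M := fun _ => ZMod 2)
          (Finset.insert_ne_empty x t) r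
      · simp
    · rintro ⟨z, hz, hz'⟩
      change z ∅ = 0 ↔ z ∈ boundaries Δ 0
      constructor
      · intro h0
        have : z = 0 := by
          funext s
          by_contra hs
          have := (h s).1 (hz s hs).1
          subst this
          exact hs h0
        rw [this]
        exact zero_mem _
      · rintro ⟨y, hy, rfl⟩
        rw [hch 1 one_ne_zero y hy]
        simp
  · have := bettiNumber_eq_of_surjective (Δ := Δ) (n := n) (M := PUnit) 0
      (fun _ => ⟨0, Subsingleton.elim _ _⟩) (fun z => by
        rw [hch n hn z.1 z.2.1]
        simp)
    rw [this]
    exact Module.finrank_zero_of_subsingleton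

/-- The sets `s ⊆ S` such that `S \ s` meets every colour form a homology sphere of dimension
`|S| - |ι| - 1`. -/
theorem bettiNumber_of_coloring {ι : Type*} [Fintype ι] (κ : V → ι) (S : Finset V)
    (Δ : PreAbstractSimplicialComplex V) (hS : ∀ i, ∃ v ∈ S, κ v = i)
    (hΔ : ∀ s, s ∈ AllFaces Δ ↔ s ⊆ S ∧ ∀ i, ∃ v ∈ S, v ∉ s ∧ κ v = i) (n : ℕ) :
    bettiNumber Δ n = if n + Fintype.card ι = S.card then 1 else 0 := by
  classical
  induction hm : S.card generalizing S Δ n with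
  | zero =>
    rw [Finset.card_eq_zero] at hm
    subst hm
    have : IsEmpty ι := ⟨fun i => by simpa using hS i⟩
    rw [bettiNumber_of_allFaces_eq_singleton (by simp [hΔ])]
    simp
  | succ m ih =>
    by_cases hinj : Set.InjOn κ S
    · have hcard : S.card = Fintype.card ι := by
        rw [← Finset.card_image_of_injOn hinj, ← Finset.card_univ]
        congr 1
        ext i
        simpa using hS i
      rw [bettiNumber_of_allFaces_eq_singleton]
      · have : n + Fintype.card ι = m + 1 ↔ n = 0 := by omega
        simp [this]
      · intro s
        rw [hΔ]
        constructor
        · rintro ⟨h1, h2⟩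
          by_contra hne
          obtain ⟨x, hx⟩ := Finset.nonempty_iff_ne_empty.mpr hne
          obtain ⟨v, hvS, hvs, hvx⟩ := h2 (κ x)
          exact hvs (hinj hvS (h1 hx) hvx ▸ hx)
        · rintro rfl
          simpa using hS
    · simp only [Set.InjOn, not_forall] at hinj
      obtain ⟨v, hvS, w, hwS, hκ, hvw⟩ := hinj
      rw [Finset.mem_coe] at hvS hwS
      have hv : {v} ∈ AllFaces Δ := by
        rw [hΔ]
        refine ⟨by simpa using hvS, fun i => ?_⟩
        obtain ⟨x, hxS, hx⟩ := hS i
        by_cases hxv : x = v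
        · exact ⟨w, hwS, by simpa using Ne.symm hvw, by rw [← hx, hxv, hκ]⟩
        · exact ⟨x, hxS, by simpa using hxv, hx⟩
      have hcone : ∀ s ∈ AllFaces Δ, v ∉ s → insert w s ∈ AllFaces Δ := by
        intro s hs hvs
        rw [hΔ] at hs ⊢
        refine ⟨Finset.insert_subset hwS hs.1, fun i => ?_⟩
        obtain ⟨x, hxS, hxs, hx⟩ := hs.2 i
        by_cases hxw : x = w
        · exact ⟨v, hvS, by simp [hvw, hvs], by rw [← hx, hxw, hκ]⟩
        · exact ⟨x, hxS, by simp [hxw, hxs], hx⟩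
      have hcard : Fintype.card ι ≤ m := by
        have h1 : (S.erase v).image κ = Finset.univ := by
          ext i
          simp only [Finset.mem_image, Finset.mem_erase, Finset.mem_univ, iff_true]
          obtain ⟨x, hxS, hx⟩ := hS i
          by_cases hxv : x = v
          · exact ⟨w, ⟨Ne.symm hvw, hwS⟩, by rw [← hx, hxv, hκ]⟩
          · exact ⟨x, ⟨hxv, hxS⟩, hx⟩
        have h2 := Finset.card_image_le (s := S.erase v) (f := κ)
        rw [h1, Finset.card_univ, Finset.card_erase_of_mem hvS, hm] at h2
        exact h2
      cases n with
      | zero =>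
        rw [bettiNumber_zero_of_cone hcone, if_neg (by omega)]
      | succ n =>
        rw [bettiNumber_succ_of_cone hvw hv hcone, ih (S.erase v)]
        · congr 1
          apply propext
          omega
        · intro i
          obtain ⟨x, hxS, hx⟩ := hS i
          by_cases hxv : x = v
          · exact ⟨w, by simp [Ne.symm hvw, hwS], by rw [← hx, hxv, hκ]⟩
          · exact ⟨x, by simp [hxv, hxS], hx⟩
        · intro s
          rw [mem_allFaces_link hv, hΔ]
          simp only [Finset.disjoint_singleton_right, Finset.union_subset_iff,
            Finset.singleton_subset_iff, Finset.mem_union, Finset.mem_singleton, not_or,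
            Finset.mem_erase, Finset.subset_erase]
          constructor
          · rintro ⟨h1, ⟨h2, -⟩, h3⟩
            refine ⟨⟨h2, h1⟩, fun i => ?_⟩
            obtain ⟨x, hxS, ⟨hxs, hxv⟩, hx⟩ := h3 i
            exact ⟨x, ⟨hxv, hxS⟩, hxs, hx⟩
          · rintro ⟨⟨h1, h2⟩, h3⟩
            refine ⟨h2, ⟨h1, hvS⟩, fun i => ?_⟩
            obtain ⟨x, ⟨hxv, hxS⟩, hxs, hx⟩ := h3 i
            exact ⟨x, hxS, ⟨hxs, hxv⟩, hx⟩
        · rw [Finset.card_erase_of_mem hvS, hm, Nat.add_sub_cancel]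

theorem IsColorComplex.isHomologySphere {ι : Type*} [Fintype ι] {κ : V → ι}
    {Δ : AbstractSimplicialComplex V} (hΔ : IsColorComplex κ Δ) {d : ℕ}
    (hd : Fintype.card V = d + Fintype.card ι) : IsHomologySphere d Δ := by
  classical
  have hmiss : ∀ σ ∈ AllFaces Δ.toPreAbstractSimplicialComplex,
      ∃ T : Finset V, Disjoint σ T ∧ T.card = Fintype.card ι ∧
        ∀ i, ∃ v ∈ T, κ v = i := by
    intro σ hσ
    choose r hr1 hr2 using (hΔ σ).1 hσ
    refine ⟨Finset.univ.image r, ?_, ?_, fun i => ⟨r i, by simp, hr2 i⟩⟩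
    · rw [Finset.disjoint_right]
      intro v hv
      obtain ⟨i, -, rfl⟩ := Finset.mem_image.mp hv
      exact hr1 i
    · rw [Finset.card_image_of_injective _ fun i j hij => by rw [← hr2 i, hij, hr2],
        Finset.card_univ]
  refine ⟨fun σ hσ => ?_, fun σ hσ => ?_, fun σ hσ n => ?_⟩
  · obtain ⟨T, h1, h2, -⟩ := hmiss σ hσ
    have := Finset.card_le_univ (σ ∪ T)
    rw [Finset.card_union_of_disjoint h1] at this
    omega
  · obtain ⟨T, h1, h2, h3⟩ := hmiss σ hσ
    refine ⟨Tᶜ, (hΔ _).2 fun i => ?_, ?_, ?_⟩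
    · obtain ⟨v, hv, hvi⟩ := h3 i
      exact ⟨v, by simpa using hv, hvi⟩
    · intro x hx
      exact Finset.mem_compl.mpr (Finset.disjoint_left.mp h1 hx)
    · rw [Finset.card_compl]
      omega
  · have hσ' := (hΔ σ).1 hσ
    rw [bettiNumber_of_coloring κ σᶜ]
    · congr 1
      have := Finset.card_le_univ σ
      rw [Finset.card_compl]
      apply propext
      omega
    · intro i
      obtain ⟨v, h1, h2⟩ := hσ' i
      exact ⟨v, by simpa using h1, h2⟩
    · intro s
      rw [mem_allFaces_link hσ, hΔ, ← Finset.subset_compl_iff_disjoint_right]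
      simp only [Finset.mem_union, not_or, Finset.mem_compl]
      refine and_congr_right fun _ => forall_congr' fun i => exists_congr fun v => ?_
      tauto

end Homology

/-- The missing faces are the colour classes. -/
theorem IsColorComplex.isMissingFace_iff {V ι : Type*} [Fintype V] [DecidableEq V] [DecidableEq ι]
    {κ : V → ι} {Δ : AbstractSimplicialComplex V} (hΔ : IsColorComplex κ Δ) {τ : Finset V} :
    IsMissingFace Δ.toPreAbstractSimplicialComplex τ ↔
      ∃ i, τ = Finset.univ.filter fun v => κ v = i := by
  constructor
  · rintro ⟨h1, h2⟩
    rw [hΔ] at h1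
    push Not at h1
    obtain ⟨i, hi⟩ := h1
    have hsub : (Finset.univ.filter fun v => κ v = i) ⊆ τ := by
      intro v hv
      by_contra h
      exact hi v h (by simpa using hv)
    refine ⟨i, ?_⟩
    by_contra hne
    have := (hΔ _).1 (h2 _ (lt_of_le_of_ne hsub (Ne.symm hne))) i
    obtain ⟨v, hv, hvi⟩ := this
    simp [hvi] at hv
  · rintro ⟨i, rfl⟩
    refine ⟨fun h => ?_, fun σ hσ => ?_⟩
    · obtain ⟨v, hv, hvi⟩ := (hΔ _).1 h i
      simp [hvi] at hv
    · rw [hΔ]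
      intro j
      by_cases hij : j = i
      · obtain ⟨v, hv, hv'⟩ := Finset.exists_of_ssubset hσ
        exact ⟨v, hv', by rw [hij]; simpa using hv⟩
      · have hempty := (hΔ ∅).1 (Or.inl rfl) j
        obtain ⟨v, -, hv⟩ := hempty
        refine ⟨v, fun h => hij ?_, hv⟩
        have := hσ.1 h
        rw [← hv]
        simpa using this

/-! ### Point configurations with prescribed linear dependencies -/

theorem exists_weights_of_mem_convexHull_range {V E : Type*} [Fintype V] [AddCommGroup E]
    [Module ℝ E] (p : V → E) {x : E} (hx : x ∈ convexHull ℝ (Set.range p)) :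
    ∃ w : V → ℝ, (∀ v, 0 ≤ w v) ∧ ∑ v, w v = 1 ∧ ∑ v, w v • p v = x := by
  classical
  let C : Set E := {x | ∃ w : V → ℝ, (∀ v, 0 ≤ w v) ∧ ∑ v, w v = 1 ∧ ∑ v, w v • p v = x}
  have hC : Convex ℝ C := by
    rintro _ ⟨w, h1, h2, rfl⟩ _ ⟨w', h1', h2', rfl⟩ a b ha hb hab
    refine ⟨fun v => a * w v + b * w' v, fun v => ?_, ?_, ?_⟩
    · have := h1 v
      have := h1' v
      positivity
    · rw [Finset.sum_add_distrib, ← Finset.mul_sum, ← Finset.mul_sum, h2, h2', mul_one, mul_one,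
        hab]
    · simp only [add_smul, mul_smul, Finset.sum_add_distrib, Finset.smul_sum]
  refine convexHull_min ?_ hC hx
  rintro _ ⟨v, rfl⟩
  refine ⟨Pi.single v 1, fun x => ?_, by simp, by simp [Pi.single_apply]⟩
  by_cases h : x = v <;> simp [h]

/-- A functional that is `1` on the points of `s` and smaller on the other points exposes the
convex hull of the points of `s`. -/
theorem convexHull_image_eq_exposed {V E : Type*} [Fintype V] [AddCommGroup E] [Module ℝ E]
    (p : V → E) (s : Set V) (hs : s.Nonempty) (l : E →ₗ[ℝ] ℝ) (h1 : ∀ v ∈ s, l (p v) = 1)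
    (h2 : ∀ v ∉ s, l (p v) < 1) :
    (∀ x ∈ convexHull ℝ (p '' s), l x = 1) ∧
    convexHull ℝ (p '' s) = {x ∈ convexHull ℝ (Set.range p) |
      ∀ y ∈ convexHull ℝ (Set.range p), l y ≤ l x} := by
  have hon : ∀ x ∈ convexHull ℝ (p '' s), l x = 1 := by
    intro x hx
    refine convexHull_min (t := {x | l x = 1}) ?_ ?_ hx
    · rintro _ ⟨v, hv, rfl⟩
      exact h1 v hv
    · exact convex_hyperplane l.isLinear 1
  have hle : ∀ y ∈ convexHull ℝ (Set.range p), l y ≤ 1 := by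
    intro x hx
    refine convexHull_min (t := {x | l x ≤ 1}) ?_ ?_ hx
    · rintro _ ⟨v, rfl⟩
      by_cases hv : v ∈ s
      · exact (h1 v hv).le
      · exact (h2 v hv).le
    · exact convex_halfSpace_le l.isLinear 1
  refine ⟨hon, Set.Subset.antisymm ?_ ?_⟩
  · intro x hx
    refine ⟨convexHull_mono (Set.image_subset_range p s) hx, fun y hy => ?_⟩
    rw [hon x hx]
    exact hle y hy
  · classical
    rintro x ⟨hx, hmax⟩
    obtain ⟨v₀, hv₀⟩ := hs
    have hx1 : l x = 1 := by
      refine le_antisymm (hle x hx) ?_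
      rw [← h1 v₀ hv₀]
      exact hmax _ (subset_convexHull ℝ _ ⟨v₀, rfl⟩)
    obtain ⟨w, hw0, hw1, rfl⟩ := exists_weights_of_mem_convexHull_range p hx
    have hw : ∀ v ∉ s, w v = 0 := by
      have hsum : ∑ v, w v * (1 - l (p v)) = 0 := by
        simp only [mul_sub, mul_one, Finset.sum_sub_distrib, hw1]
        simp only [map_sum, map_smul, smul_eq_mul] at hx1
        rw [hx1, sub_self]
      have hnn : ∀ v ∈ Finset.univ, 0 ≤ w v * (1 - l (p v)) := by
        intro v _
        refine mul_nonneg (hw0 v) ?_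
        have := hle _ (subset_convexHull ℝ _ ⟨v, rfl⟩)
        linarith
      intro v hv
      have := (Finset.sum_eq_zero_iff_of_nonneg hnn).1 hsum v (Finset.mem_univ v)
      rcases mul_eq_zero.1 this with h | h
      · exact h
      · have := h2 v hv
        linarith
    have hsub : ∀ f : V → E, ∑ v, w v • f v = ∑ v with v ∈ s, w v • f v := by
      intro f
      rw [Finset.sum_filter]
      refine Finset.sum_congr rfl fun v _ => ?_
      split_ifs with h
      · rfl
      · rw [hw v h, zero_smul]
    rw [hsub]
    refine (convex_convexHull ℝ _).sum_mem (fun v _ => hw0 v) ?_ fun v hv =>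
      subset_convexHull ℝ _ ⟨v, by simpa using hv, rfl⟩
    rw [← hw1, Finset.sum_filter]
    refine Finset.sum_congr rfl fun v _ => ?_
    split_ifs with h
    · rfl
    · rw [hw v h]

/-- Each subspace `L` of `ℝ^V` of codimension `d` is the space of linear dependencies of a
configuration of vectors in `ℝ^d`; a function on `V` orthogonal to `L` is the restriction of a
linear functional to the configuration. -/
theorem exists_config {V : Type*} [Fintype V] {d : ℕ} (L : Submodule ℝ (V → ℝ))
    (hL : Module.finrank ℝ L + d = Fintype.card V) :
    ∃ p : V → Fin d → ℝ, (∀ y : V → ℝ, ∑ v, y v • p v = 0 ↔ y ∈ L) ∧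
      (∀ φ : V → ℝ, (∀ y ∈ L, ∑ v, y v * φ v = 0) →
        ∃ l : (Fin d → ℝ) →ₗ[ℝ] ℝ, ∀ v, l (p v) = φ v) ∧
      Submodule.span ℝ (Set.range p) = ⊤ := by
  classical
  have hfr : Module.finrank ℝ ((V → ℝ) ⧸ L) = Module.finrank ℝ (Fin d → ℝ) := by
    have := Submodule.finrank_quotient_add_finrank L
    rw [Module.finrank_fintype_fun_eq_card] at this
    rw [Module.finrank_fintype_fun_eq_card, Fintype.card_fin]
    omega
  let e := LinearEquiv.ofFinrankEq _ _ hfr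
  let q : (V → ℝ) →ₗ[ℝ] (Fin d → ℝ) := e.toLinearMap ∘ₗ L.mkQ
  have hq : ∀ y : V → ℝ, ∑ v, y v • q (Pi.single v 1) = q y := by
    intro y
    conv_rhs => rw [pi_eq_sum_univ' y]
    rw [map_sum]
    refine Finset.sum_congr rfl fun v _ => ?_
    rw [map_smul]
  refine ⟨fun v => q (Pi.single v 1), fun y => ?_, fun φ hφ => ?_, ?_⟩
  · rw [hq]
    simp [q]
  · let φ' : (V → ℝ) →ₗ[ℝ] ℝ := ∑ v, φ v • LinearMap.proj v
    have hφ' : ∀ y, φ' y = ∑ v, y v * φ v := by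
      intro y
      simp [φ', mul_comm]
    refine ⟨L.liftQ φ' (fun y hy => ?_) ∘ₗ e.symm.toLinearMap, fun v => ?_⟩
    · rw [LinearMap.mem_ker, hφ']
      exact hφ y hy
    · simp [q, hφ', Pi.single_apply]
  · rw [eq_top_iff]
    rintro x -
    obtain ⟨y, rfl⟩ : ∃ y, q y = x := (e.surjective.comp L.mkQ_surjective) x
    rw [← hq]
    exact Submodule.sum_mem _ fun v _ => Submodule.smul_mem _ _ (Submodule.subset_span ⟨v, rfl⟩)

/-! ### The free sum of simplices -/

section Polytopal

variable {V ι : Type*} [Fintype V] [DecidableEq V] [DecidableEq ι]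

/-- Values, with mean zero on each colour class, of a functional that exposes the face `s`. -/
noncomputable def exposingValues (κ : V → ι) (s : Finset V) (v : V) : ℝ :=
  if v ∈ s then 1 else
    -(((Finset.univ.filter fun w => κ w = κ v).filter (· ∈ s)).card : ℝ) /
      ((Finset.univ.filter fun w => κ w = κ v).filter (· ∉ s)).card

theorem exposingValues_of_mem {κ : V → ι} {s : Finset V} {v : V} (hv : v ∈ s) :
    exposingValues κ s v = 1 := if_pos hv

theorem exposingValues_lt_one {κ : V → ι} {s : Finset V} {v : V} (hv : v ∉ s) :
    exposingValues κ s v < 1 := by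
  rw [exposingValues, if_neg hv]
  refine lt_of_le_of_lt ?_ zero_lt_one
  exact div_nonpos_of_nonpos_of_nonneg (neg_nonpos.mpr (Nat.cast_nonneg _)) (Nat.cast_nonneg _)

theorem sum_exposingValues [Fintype ι] {κ : V → ι} {s : Finset V} (hs : ∀ i, ∃ v, v ∉ s ∧ κ v = i)
    (x : ι → ℝ) : ∑ v, x (κ v) * exposingValues κ s v = 0 := by
  rw [← Finset.sum_fiberwise Finset.univ κ]
  refine Finset.sum_eq_zero fun i _ => ?_
  have h1 : ∑ v with κ v = i, x (κ v) * exposingValues κ s v =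
      x i * ∑ v with κ v = i, exposingValues κ s v := by
    rw [Finset.mul_sum]
    refine Finset.sum_congr rfl fun v hv => ?_
    rw [(Finset.mem_filter.mp hv).2]
  have h2 : ∑ v with κ v = i, exposingValues κ s v = 0 := by
    have : ∀ v ∈ Finset.univ.filter (fun v => κ v = i), exposingValues κ s v =
        if v ∈ s then 1 else -(((Finset.univ.filter fun w => κ w = i).filter (· ∈ s)).card : ℝ) /
          ((Finset.univ.filter fun w => κ w = i).filter (· ∉ s)).card := by
      intro v hv
      rw [exposingValues, (Finset.mem_filter.mp hv).2]
    rw [Finset.sum_congr rfl this, Finset.sum_ite, Finset.sum_const, Finset.sum_const]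
    have hpos : (((Finset.univ.filter fun w => κ w = i).filter (· ∉ s)).card : ℝ) ≠ 0 := by
      obtain ⟨v, hv, hvi⟩ := hs i
      rw [Nat.cast_ne_zero, Finset.card_ne_zero]
      exact ⟨v, by simp [hv, hvi]⟩
    rw [nsmul_eq_mul, nsmul_eq_mul]
    field_simp
    ring
  rw [h1, h2, mul_zero]

/-- The free sum of simplices spanned by the colour classes: a configuration whose linear
dependencies are the functions constant on the colour classes. Its boundary complex is `Δ`. -/
theorem IsColorComplex.isPolytopal [Fintype ι] {κ : V → ι} {Δ : AbstractSimplicialComplex V}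
    (hΔ : IsColorComplex κ Δ) [Nonempty ι] {d : ℕ} (hd : Fintype.card V = d + Fintype.card ι) :
    IsPolytopal d Δ := by
  have hsurj : Function.Surjective κ := fun i => by
    obtain ⟨v, -, hv⟩ := (hΔ ∅).1 (Or.inl rfl) i
    exact ⟨v, hv⟩
  let L : Submodule ℝ (V → ℝ) := LinearMap.range (LinearMap.funLeft ℝ ℝ κ)
  have hL : Module.finrank ℝ L + d = Fintype.card V := by
    rw [LinearMap.finrank_range_of_inj (LinearMap.funLeft_injective_of_surjective _ _ _ hsurj),
      Module.finrank_fintype_fun_eq_card, hd, add_comm]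
  obtain ⟨p, hp, hφ, hspan⟩ := exists_config L hL
  have hdep : ∀ x : ι → ℝ, ∑ v, x (κ v) • p v = 0 := fun x => (hp _).2 ⟨x, rfl⟩
  have hface : ∀ s : Finset V, (∀ i, ∃ v, v ∉ s ∧ κ v = i) →
      ∃ l : (Fin d → ℝ) →ₗ[ℝ] ℝ, (∀ v ∈ s, l (p v) = 1) ∧ ∀ v ∉ s, l (p v) < 1 := by
    intro s hs
    obtain ⟨l, hl⟩ := hφ (exposingValues κ s) (by
      rintro _ ⟨x, rfl⟩
      exact sum_exposingValues hs x)
    refine ⟨l, fun v hv => ?_, fun v hv => ?_⟩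
    · rw [hl, exposingValues_of_mem hv]
    · rw [hl]
      exact exposingValues_lt_one hv
  -- the origin is the barycentre of each colour class
  have hzero : ∀ i, (0 : Fin d → ℝ) ∈ convexHull ℝ (p '' {v | κ v = i}) := by
    intro i
    have hcard : (0 : ℝ) < (Finset.univ.filter fun v => κ v = i).card := by
      obtain ⟨v, hv⟩ := hsurj i
      rw [Nat.cast_pos, Finset.card_pos]
      exact ⟨v, by simpa using hv⟩
    have h1 : ∑ v with κ v = i,
        ((Finset.univ.filter fun v => κ v = i).card : ℝ)⁻¹ • p v = 0 := by
      rw [← Finset.smul_sum]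
      have := hdep (Pi.single i 1)
      simp only [Pi.single_apply, ite_smul, one_smul, zero_smul] at this
      rw [Finset.sum_filter, this, smul_zero]
    rw [← h1]
    refine (convex_convexHull ℝ _).sum_mem (fun v _ => by positivity) ?_ fun v hv =>
      subset_convexHull ℝ _ ⟨v, by simpa using hv, rfl⟩
    rw [Finset.sum_const, nsmul_eq_mul, mul_inv_cancel₀ hcard.ne']
  have hzero' : (0 : Fin d → ℝ) ∈ convexHull ℝ (Set.range p) := by
    obtain ⟨i⟩ := ‹Nonempty ι›
    exact convexHull_mono (Set.image_subset_range _ _) (hzero i)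
  refine ⟨p, ⟨?_, ?_, ?_, ?_⟩⟩
  · intro s v hv
    by_contra hvs
    have hvΔ : {v} ∈ AllFaces Δ.toPreAbstractSimplicialComplex := Or.inr (Δ.singleton_mem v)
    obtain ⟨l, h1, h2⟩ := hface _ ((hΔ _).1 hvΔ)
    have hlt : l (p v) < 1 := by
      refine convexHull_min (t := {x | l x < 1}) ?_ (convex_halfSpace_lt l.isLinear 1) hv
      rintro _ ⟨w, hw, rfl⟩
      refine h2 w ?_
      rw [Finset.mem_singleton]
      rintro rfl
      exact hvs hw
    rw [h1 v (Finset.mem_singleton_self v)] at hlt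
    exact lt_irrefl _ hlt
  · have h0 : (0 : Fin d → ℝ) ∈ affineSpan ℝ (Set.range p) :=
      convexHull_subset_affineSpan _ hzero'
    rw [eq_top_iff]
    rintro x -
    have hx : x ∈ Submodule.span ℝ (Set.range p) := by
      rw [hspan]
      trivial
    refine Submodule.span_induction (p := fun x _ => x ∈ affineSpan ℝ (Set.range p))
      (fun y hy => subset_affineSpan ℝ _ hy) h0 ?_ ?_ hx
    · intro y z _ _ hy hz
      have := AffineSubspace.smul_vsub_vadd_mem (affineSpan ℝ (Set.range p)) 1 hy h0 hz
      simpa using this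
    · intro a y _ hy
      have := AffineSubspace.smul_vsub_vadd_mem (affineSpan ℝ (Set.range p)) a hy h0 h0
      simpa using this
  · intro s hs
    rw [mem_faces_iff_mem_allFaces _ hs, hΔ]
    constructor
    · intro h
      obtain ⟨l, h1, h2⟩ := hface s h
      obtain ⟨h3, h4⟩ := convexHull_image_eq_exposed p s hs l h1 h2
      refine ⟨fun _ => ⟨LinearMap.toContinuousLinearMap l, h4⟩, fun heq => ?_⟩
      have := h3 0 (heq ▸ hzero')
      simp at this
    · rintro ⟨hexp, hne⟩
      by_contra hcon
      push Not at hcon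
      obtain ⟨i, hi⟩ := hcon
      obtain ⟨w, hw⟩ := hs
      obtain ⟨l, hl⟩ := hexp ⟨p w, subset_convexHull ℝ _ ⟨w, hw, rfl⟩⟩
      have h0 : (0 : Fin d → ℝ) ∈ convexHull ℝ (p '' (s : Set V)) := by
        refine convexHull_mono (Set.image_mono fun v hv => ?_) (hzero i)
        by_contra hvs
        exact hi v hvs hv
      rw [hl] at h0
      have hle : ∀ v, l (p v) ≤ 0 := fun v => by
        have := h0.2 _ (subset_convexHull ℝ _ ⟨v, rfl⟩)
        simpa using this
      have hsum : ∑ v, l (p v) = 0 := by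
        have := congrArg l (hdep 1)
        simpa using this
      have hl0 : ∀ v, l (p v) = 0 := fun v =>
        (Finset.sum_eq_zero_iff_of_nonpos fun v _ => hle v).1 hsum v (Finset.mem_univ v)
      have hlP : ∀ y ∈ convexHull ℝ (Set.range p), l y = 0 := by
        intro y hy
        refine convexHull_min (t := {x | l x = 0}) ?_ ?_ hy
        · rintro _ ⟨v, rfl⟩
          exact hl0 v
        · exact convex_hyperplane l.isLinear 0
      apply hne
      rw [hl]
      refine Set.Subset.antisymm (fun x hx => hx.1) fun x hx => ⟨hx, fun y hy => ?_⟩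
      rw [hlP x hx, hlP y hy]
  · intro s hs
    apply LinearIndependent.affineIndependent
    rw [Fintype.linearIndependent_iff]
    intro g hg
    have hsum : ∑ v, (if h : v ∈ s then g ⟨v, h⟩ else 0) • p v = 0 := by
      rw [← hg, ← Finset.sum_subset (Finset.subset_univ s), ← Finset.sum_coe_sort]
      · refine Finset.sum_congr rfl fun v _ => ?_
        rw [dif_pos v.2]
      · intro v _ hv
        rw [dif_neg hv, zero_smul]
    obtain ⟨x, hx⟩ := (hp _).1 hsum
    have hx0 : x = 0 := by
      funext i
      obtain ⟨v, hv, hvi⟩ := (hΔ s).1 (Or.inr hs) i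
      have := congrFun hx v
      rw [dif_neg hv] at this
      rw [← hvi]
      exact this
    rintro ⟨v, hv⟩
    have := congrFun hx v
    rw [dif_pos hv, hx0] at this
    rw [← this]
    rfl

end Polytopal

end SphereStress

namespace SphereStress

open Polynomial

/-! ### Syzygies of three binary forms -/

/-- The combinations `P f + Q g + R h` with `deg P, deg Q ≤ n - α` and `deg R ≤ n - γ`. If the
dehomogenised binary forms `f`, `g`, `h` have degrees `α`, `α`, `γ`, these are the
dehomogenisations of the forms of degree `n` in the ideal they generate. -/
def relSpace (f g h : ℝ[X]) (α γ n : ℕ) : Submodule ℝ ℝ[X] where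
  carrier := {q | ∃ P ∈ degreeLT ℝ (n + 1 - α), ∃ Q ∈ degreeLT ℝ (n + 1 - α),
    ∃ R ∈ degreeLT ℝ (n + 1 - γ), q = P * f + Q * g + R * h}
  add_mem' := by
    rintro _ _ ⟨P, hP, Q, hQ, R, hR, rfl⟩ ⟨P', hP', Q', hQ', R', hR', rfl⟩
    exact ⟨P + P', add_mem hP hP', Q + Q', add_mem hQ hQ', R + R', add_mem hR hR', by ring⟩
  zero_mem' := ⟨0, zero_mem _, 0, zero_mem _, 0, zero_mem _, by ring⟩
  smul_mem' := by
    rintro a _ ⟨P, hP, Q, hQ, R, hR, rfl⟩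
    exact ⟨a • P, Submodule.smul_mem _ a hP, a • Q, Submodule.smul_mem _ a hQ, a • R,
      Submodule.smul_mem _ a hR, by simp only [smul_eq_C_mul]; ring⟩

theorem mem_degreeLT_iff_coeff {P : ℝ[X]} {m : ℕ} :
    P ∈ degreeLT ℝ m ↔ ∀ i, m ≤ i → P.coeff i = 0 := by
  rw [mem_degreeLT, degree_lt_iff_coeff_zero]

theorem mul_mem_degreeLT {P f : ℝ[X]} {m a : ℕ} (hP : P ∈ degreeLT ℝ m)
    (hf : f.natDegree ≤ a) : P * f ∈ degreeLT ℝ (m + a) := by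
  rw [mem_degreeLT] at hP ⊢
  by_cases hP0 : P = 0
  · rw [hP0, zero_mul, degree_zero]
    exact WithBot.bot_lt_coe _
  · have h1 := (natDegree_lt_iff_degree_lt hP0).2 hP
    refine lt_of_le_of_lt degree_le_natDegree ?_
    rw [Nat.cast_lt]
    have := natDegree_mul_le (p := P) (q := f)
    omega

theorem mul_mem_degreeLT_of_sub {P f : ℝ[X]} {n a : ℕ} (hP : P ∈ degreeLT ℝ (n + 1 - a))
    (hf : f.natDegree ≤ a) : P * f ∈ degreeLT ℝ (n + 1) := by
  by_cases h : a ≤ n + 1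
  · have := mul_mem_degreeLT hP hf
    rwa [Nat.sub_add_cancel h] at this
  · have : P = 0 := by
      ext i
      exact mem_degreeLT_iff_coeff.1 hP i (by omega)
    rw [this, zero_mul]
    exact zero_mem _

theorem mem_degreeLT_of_X_mul_mem {P : ℝ[X]} {m : ℕ} (hP : X * P ∈ degreeLT ℝ (m + 1)) :
    P ∈ degreeLT ℝ m := by
  rw [mem_degreeLT_iff_coeff] at hP ⊢
  intro i hi
  have := hP (i + 1) (by omega)
  rwa [coeff_X_mul] at this

theorem divX_mem_degreeLT {P : ℝ[X]} {m : ℕ} (hP : P ∈ degreeLT ℝ (m + 1)) :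
    P.divX ∈ degreeLT ℝ m := by
  rw [mem_degreeLT_iff_coeff] at hP ⊢
  intro i hi
  rw [coeff_divX]
  exact hP (i + 1) (by omega)

theorem C_mem_degreeLT (r : ℝ) {m : ℕ} (hm : 1 ≤ m) : C r ∈ degreeLT ℝ m := by
  rw [mem_degreeLT_iff_coeff]
  intro i hi
  exact coeff_C_of_ne_zero (by omega)

theorem X_mul_mem_degreeLT {P : ℝ[X]} {m : ℕ} (hP : P ∈ degreeLT ℝ m) :
    X * P ∈ degreeLT ℝ (m + 1) := by
  rw [mul_comm]
  exact mul_mem_degreeLT hP natDegree_X_le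

theorem relSpace_mul_mem {f g h q : ℝ[X]} {α γ n : ℕ} (hq : q ∈ relSpace f g h α γ n) (a b : ℝ) :
    (C a + C b * X) * q ∈ relSpace f g h α γ (n + 1) := by
  have key : ∀ (e : ℕ) (P : ℝ[X]), P ∈ degreeLT ℝ (n + 1 - e) →
      (C a + C b * X) * P ∈ degreeLT ℝ (n + 1 + 1 - e) := by
    intro e P hP
    by_cases he : e ≤ n + 1
    · have h1 : n + 1 + 1 - e = n + 1 - e + 1 := by omega
      have h2 : (C a + C b * X) * P = a • P + b • (X * P) := by
        simp only [smul_eq_C_mul]; ring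
      rw [h1, h2]
      exact add_mem (Submodule.smul_mem _ _ (degreeLT_mono (Nat.le_succ _) hP))
        (Submodule.smul_mem _ _ (X_mul_mem_degreeLT hP))
    · have : P = 0 := by
        ext i
        exact mem_degreeLT_iff_coeff.1 hP i (by omega)
      rw [this, mul_zero]
      exact zero_mem _
  obtain ⟨P, hP, Q, hQ, R, hR, rfl⟩ := hq
  exact ⟨_, key α P hP, _, key α Q hQ, _, key γ R hR, by ring⟩

theorem finrank_degreeLT (n : ℕ) : Module.finrank ℝ (degreeLT ℝ n) = n := by
  rw [(degreeLTEquiv ℝ n).finrank_eq, Module.finrank_fin_fun]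

instance (n : ℕ) : FiniteDimensional ℝ (degreeLT ℝ n) :=
  Module.Finite.equiv (degreeLTEquiv ℝ n).symm

/-- The map `(P, Q, R) ↦ P f + Q g + R h` on polynomials of bounded degree. -/
noncomputable def combMap (f g h : ℝ[X]) (a c : ℕ) :
    (degreeLT ℝ a × degreeLT ℝ a × degreeLT ℝ c) →ₗ[ℝ] ℝ[X] :=
  LinearMap.coprod (LinearMap.mulRight ℝ f ∘ₗ (degreeLT ℝ a).subtype)
    (LinearMap.coprod (LinearMap.mulRight ℝ g ∘ₗ (degreeLT ℝ a).subtype)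
      (LinearMap.mulRight ℝ h ∘ₗ (degreeLT ℝ c).subtype))

theorem combMap_apply (f g h : ℝ[X]) (a c : ℕ) (x : degreeLT ℝ a × degreeLT ℝ a × degreeLT ℝ c) :
    combMap f g h a c x = x.1.1 * f + x.2.1.1 * g + x.2.2.1 * h := by
  simp [combMap, add_assoc]

theorem finrank_combMap_source (a c : ℕ) :
    Module.finrank ℝ (degreeLT ℝ a × degreeLT ℝ a × degreeLT ℝ c) = a + (a + c) := by
  simp [Module.finrank_prod, finrank_degreeLT]

/-- The degree `n` part of the quotient is nonzero if there are too few multiples of the forms. -/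
theorem exists_notMem_relSpace (f g h : ℝ[X]) {α γ n : ℕ}
    (hn : 2 * (n + 1 - α) + (n + 1 - γ) < n + 1) :
    ∃ q ∈ degreeLT ℝ (n + 1), q ∉ relSpace f g h α γ n := by
  by_contra hcon
  push Not at hcon
  have hle : degreeLT ℝ (n + 1) ≤ LinearMap.range (combMap f g h (n + 1 - α) (n + 1 - γ)) := by
    intro q hq
    obtain ⟨P, hP, Q, hQ, R, hR, rfl⟩ := hcon q hq
    exact ⟨(⟨P, hP⟩, ⟨Q, hQ⟩, ⟨R, hR⟩), combMap_apply _ _ _ _ _ _⟩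
  have h1 := Submodule.finrank_mono hle
  have h2 := LinearMap.finrank_range_le (combMap f g h (n + 1 - α) (n + 1 - γ))
  rw [finrank_combMap_source] at h2
  rw [finrank_degreeLT] at h1
  omega

/-- There is a nonzero syzygy in degree `n` if there are too many multiples of the forms. -/
theorem exists_syzygy {f g h : ℝ[X]} {α γ n : ℕ} (hf : f.natDegree ≤ α) (hg : g.natDegree ≤ α)
    (hh : h.natDegree ≤ γ) (hn : n + 1 < 2 * (n + 1 - α) + (n + 1 - γ)) :
    ∃ P ∈ degreeLT ℝ (n + 1 - α), ∃ Q ∈ degreeLT ℝ (n + 1 - α), ∃ R ∈ degreeLT ℝ (n + 1 - γ),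
      P * f + Q * g + R * h = 0 ∧ ¬ (P = 0 ∧ Q = 0 ∧ R = 0) := by
  have hmem : ∀ x, combMap f g h (n + 1 - α) (n + 1 - γ) x ∈ degreeLT ℝ (n + 1) := by
    intro x
    rw [combMap_apply]
    exact add_mem (add_mem (mul_mem_degreeLT_of_sub x.1.2 hf) (mul_mem_degreeLT_of_sub x.2.1.2 hg))
      (mul_mem_degreeLT_of_sub x.2.2.2 hh)
  have hker := LinearMap.ker_ne_bot_of_finrank_lt
    (f := (combMap f g h (n + 1 - α) (n + 1 - γ)).codRestrict _ hmem) (by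
      rw [finrank_combMap_source, finrank_degreeLT]
      omega)
  obtain ⟨x, hx, hx0⟩ := (Submodule.ne_bot_iff _).1 hker
  refine ⟨x.1.1, x.1.2, x.2.1.1, x.2.1.2, x.2.2.1, x.2.2.2, ?_, ?_⟩
  · rw [← combMap_apply]
    exact congrArg Subtype.val hx
  · rintro ⟨h1, h2, h3⟩
    exact hx0 (Prod.ext (Subtype.ext h1) (Prod.ext (Subtype.ext h2) (Subtype.ext h3)))

/-- A socle element of low degree. In a nonzero syzygy `P f + Q g + R h = 0` of least degree `n`
write `P = P₁ + X P₂` with `P₁` constant, and so on. Then `w = P₂ f + Q₂ g + R₂ h` and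
`-X w = P₁ f + Q₁ g + R₁ h` both lie in the ideal as forms of degree `n - 1`, while `w`, as a form
of degree `n - 2`, does not, since `n` is minimal. -/
theorem exists_socle_form {f g h : ℝ[X]} {α γ u : ℕ} (hf : f.natDegree ≤ α)
    (hg : g.natDegree ≤ α) (hh : h.natDegree ≤ γ) (hα : 1 ≤ α) (hγα : γ ≤ α)
    (hh0 : h ≠ 0)
    (hrel : ∀ (a b : ℝ) (R : ℝ[X]), C a * f + C b * g = R * h → a = 0 ∧ b = 0)
    (hu : u + 2 < 2 * (u + 2 - α) + (u + 2 - γ)) :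
    ∃ j, α ≤ j + 1 ∧ j + 1 ≤ u ∧ ∃ w ∈ degreeLT ℝ (j + 1), w ∉ relSpace f g h α γ j ∧
      w ∈ relSpace f g h α γ (j + 1) ∧ X * w ∈ relSpace f g h α γ (j + 1) := by
  classical
  have hex : ∃ n, ∃ P ∈ degreeLT ℝ (n + 1 - α), ∃ Q ∈ degreeLT ℝ (n + 1 - α),
      ∃ R ∈ degreeLT ℝ (n + 1 - γ), P * f + Q * g + R * h = 0 ∧ ¬ (P = 0 ∧ Q = 0 ∧ R = 0) :=
    ⟨u + 1, exists_syzygy hf hg hh hu⟩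
  obtain ⟨n, ⟨P, hP, Q, hQ, R, hR, hsyz, hne⟩, hmin, hnu⟩ : ∃ n,
      (∃ P ∈ degreeLT ℝ (n + 1 - α), ∃ Q ∈ degreeLT ℝ (n + 1 - α),
      ∃ R ∈ degreeLT ℝ (n + 1 - γ), P * f + Q * g + R * h = 0 ∧ ¬ (P = 0 ∧ Q = 0 ∧ R = 0)) ∧
      (∀ m < n, ∀ P ∈ degreeLT ℝ (m + 1 - α), ∀ Q ∈ degreeLT ℝ (m + 1 - α),
        ∀ R ∈ degreeLT ℝ (m + 1 - γ), P * f + Q * g + R * h = 0 → P = 0 ∧ Q = 0 ∧ R = 0) ∧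
      n ≤ u + 1 := by
    refine ⟨Nat.find hex, Nat.find_spec hex, ?_, Nat.find_min' hex (exists_syzygy hf hg hh hu)⟩
    intro m hm P hP Q hQ R hR hs
    by_contra hcon
    exact Nat.find_min hex hm ⟨P, hP, Q, hQ, R, hR, hs, hcon⟩
  -- the forms are minimal generators, so no coefficient of a syzygy is a nonzero constant
  have hαn : α + 1 ≤ n := by
    by_contra hlt
    have hconst : ∀ S ∈ degreeLT ℝ (n + 1 - α), S = C (S.coeff 0) := by
      intro S hS
      ext i
      rcases Nat.eq_zero_or_pos i with rfl | hi
      · simp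
      · rw [coeff_C_of_ne_zero hi.ne']
        exact mem_degreeLT_iff_coeff.1 hS i (by omega)
    have hPc := hconst P hP
    have hQc := hconst Q hQ
    obtain ⟨h1, h2⟩ := hrel (P.coeff 0) (Q.coeff 0) (-R) (by
      rw [← hPc, ← hQc]
      linear_combination hsyz)
    rw [h1, C_0] at hPc
    rw [h2, C_0] at hQc
    refine hne ⟨hPc, hQc, ?_⟩
    rw [hPc, hQc, zero_mul, zero_mul, zero_add, zero_add] at hsyz
    exact (mul_eq_zero.1 hsyz).resolve_right hh0
  obtain ⟨j, rfl⟩ : ∃ j, n = j + 2 := ⟨n - 2, by omega⟩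
  have e1 : j + 2 + 1 - α = (j + 2 - α) + 1 := by omega
  have e2 : j + 2 + 1 - γ = (j + 2 - γ) + 1 := by omega
  rw [e1] at hP hQ
  rw [e2] at hR
  have hPd := divX_mul_X_add P
  have hQd := divX_mul_X_add Q
  have hRd := divX_mul_X_add R
  set P₂ := P.divX with hP₂
  set Q₂ := Q.divX with hQ₂
  set R₂ := R.divX with hR₂
  set w := P₂ * f + Q₂ * g + R₂ * h with hw
  have hXw : X * w = -(C (P.coeff 0) * f + C (Q.coeff 0) * g + C (R.coeff 0) * h) := by
    rw [hw]
    linear_combination hsyz + f * hPd + g * hQd + h * hRd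
  have hXw' : X * w = C (-P.coeff 0) * f + C (-Q.coeff 0) * g + C (-R.coeff 0) * h := by
    rw [hXw]
    simp only [C_neg]
    ring
  refine ⟨j, by omega, by omega, w, ?_, ?_, ?_, ?_⟩
  · apply mem_degreeLT_of_X_mul_mem
    rw [hXw']
    refine add_mem (add_mem ?_ ?_) ?_
    · exact mul_mem_degreeLT_of_sub (C_mem_degreeLT _ (by omega)) hf
    · exact mul_mem_degreeLT_of_sub (C_mem_degreeLT _ (by omega)) hg
    · exact mul_mem_degreeLT_of_sub (C_mem_degreeLT _ (by omega)) hh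
  · rintro ⟨P₃, hP₃, Q₃, hQ₃, R₃, hR₃, hw₃⟩
    have hmono : ∀ (e : ℕ) (S : ℝ[X]), S ∈ degreeLT ℝ (j + 1 - e) →
        S ∈ degreeLT ℝ (j + 2 - e) := fun e S hS => degreeLT_mono (by omega) hS
    have hshift : ∀ (e : ℕ) (r : ℝ) (S : ℝ[X]), e + 1 ≤ j + 2 → S ∈ degreeLT ℝ (j + 1 - e) →
        C r + X * S ∈ degreeLT ℝ (j + 2 - e) := by
      intro e r S he hS
      refine add_mem (C_mem_degreeLT _ (by omega)) ?_
      have := X_mul_mem_degreeLT hS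
      rwa [show j + 1 - e + 1 = j + 2 - e by omega] at this
    obtain ⟨h1, h2, h3⟩ := hmin (j + 1) (by omega) (P₂ - P₃)
      (sub_mem (divX_mem_degreeLT hP) (hmono _ _ hP₃)) (Q₂ - Q₃)
      (sub_mem (divX_mem_degreeLT hQ) (hmono _ _ hQ₃)) (R₂ - R₃)
      (sub_mem (divX_mem_degreeLT hR) (hmono _ _ hR₃)) (by
        linear_combination (-1 : ℝ[X]) * hw + hw₃)
    obtain ⟨h4, h5, h6⟩ := hmin (j + 1) (by omega) (C (P.coeff 0) + X * P₃)
      (hshift _ _ _ (by omega) hP₃) (C (Q.coeff 0) + X * Q₃)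
      (hshift _ _ _ (by omega) hQ₃) (C (R.coeff 0) + X * R₃)
      (hshift _ _ _ (by omega) hR₃) (by
        linear_combination hXw - X * hw₃)
    refine hne ⟨?_, ?_, ?_⟩
    · rw [← hPd]
      linear_combination X * h1 + h4
    · rw [← hQd]
      linear_combination X * h2 + h5
    · rw [← hRd]
      linear_combination X * h3 + h6
  · exact ⟨P₂, divX_mem_degreeLT hP, Q₂, divX_mem_degreeLT hQ, R₂, divX_mem_degreeLT hR, rfl⟩
  · exact ⟨_, C_mem_degreeLT _ (by omega), _, C_mem_degreeLT _ (by omega), _,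
      C_mem_degreeLT _ (by omega), hXw'⟩

end SphereStress

namespace SphereStress

open MvPolynomial

/-! ### Gale transforms and the ring `A(Δ)` -/

section Gale

variable {V : Type*} [Fintype V] {d : ℕ}

/-- `y` is an affine dependency of the configuration `p`. -/
def IsAffineDependency (p : V → Fin d → ℝ) (y : V → ℝ) : Prop :=
  ∑ v, y v • p v = 0 ∧ ∑ v, y v = 0

/-- The functions `y₁`, `y₂` form a basis of the space of affine dependencies of `p`; the vectors
`(y₁ v, y₂ v)` are then the affine Gale transform of `p`. -/
structure IsGalePair (p : V → Fin d → ℝ) (y₁ y₂ : V → ℝ) : Prop where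
  left : IsAffineDependency p y₁
  right : IsAffineDependency p y₂
  exists_eq : ∀ y, IsAffineDependency p y → ∃ s t : ℝ, y = s • y₁ + t • y₂
  indep : ∀ s t : ℝ, s • y₁ + t • y₂ = 0 → s = 0 ∧ t = 0

omit [Fintype V] in
theorem exists_bracket_ne_zero {y₁ y₂ : V → ℝ}
    (h : ∀ s t : ℝ, s • y₁ + t • y₂ = 0 → s = 0 ∧ t = 0) :
    ∃ v w, y₁ v * y₂ w - y₁ w * y₂ v ≠ 0 := by
  by_contra hcon
  push Not at hcon
  have hy : ∃ v, y₁ v ≠ 0 := by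
    by_contra hz
    push Not at hz
    have := (h 1 0 (by funext v; simp [hz v])).1
    exact one_ne_zero this
  obtain ⟨v, hv⟩ := hy
  have := (h (y₂ v) (-y₁ v) (by
    funext w
    have := hcon v w
    simp only [Pi.add_apply, Pi.smul_apply, smul_eq_mul, Pi.zero_apply]
    linarith)).2
  exact hv (by linarith)

/-- A function orthogonal to all affine dependencies is the restriction of an affine function. -/
theorem exists_affine_of_orthogonal {p : V → Fin d → ℝ} {c : V → ℝ}
    (hc : ∀ y, IsAffineDependency p y → ∑ v, y v * c v = 0) :
    ∃ (q : Fin d → ℝ) (q₀ : ℝ), ∀ v, c v = ∑ j, q j * p v j + q₀ := by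
  classical
  let T : ((Fin d → ℝ) × ℝ) →ₗ[ℝ] (V → ℝ) :=
    { toFun := fun q v => ∑ j, q.1 j * p v j + q.2
      map_add' := by
        intro a b
        funext v
        simp only [Prod.fst_add, Prod.snd_add, Pi.add_apply, add_mul, Finset.sum_add_distrib]
        ring
      map_smul' := by
        intro r a
        funext v
        simp only [Prod.smul_fst, Prod.smul_snd, Pi.smul_apply, smul_eq_mul, RingHom.id_apply,
          mul_add, Finset.mul_sum, mul_assoc] }
  by_cases hcT : c ∈ LinearMap.range T
  · obtain ⟨q, rfl⟩ := hcT
    exact ⟨q.1, q.2, fun v => rfl⟩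
  · exfalso
    obtain ⟨f, hfc, hf⟩ := Submodule.exists_dual_map_eq_bot_of_notMem hcT inferInstance
    have hfy : ∀ x : V → ℝ, f x = ∑ v, f (Pi.single v 1) * x v := by
      intro x
      conv_lhs => rw [pi_eq_sum_univ' x]
      rw [map_sum]
      refine Finset.sum_congr rfl fun v _ => ?_
      rw [map_smul, smul_eq_mul, mul_comm]
    have hfT : ∀ q, f (T q) = 0 := by
      intro q
      have : f (T q) ∈ Submodule.map f (LinearMap.range T) := ⟨_, ⟨q, rfl⟩, rfl⟩
      rw [hf] at this
      simpa using this
    refine hfc ?_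
    rw [hfy]
    refine hc _ ⟨?_, ?_⟩
    · funext j
      have := hfT (Pi.single j 1, 0)
      rw [hfy] at this
      simpa [T, Pi.single_apply] using this
    · have := hfT (0, 1)
      rw [hfy] at this
      simpa [T] using this

/-- The dehomogenised linear form `y₁ v + y₂ v X` of the vertex `v`. -/
noncomputable def galeForm (y₁ y₂ : V → ℝ) (v : V) : Polynomial ℝ :=
  Polynomial.C (y₁ v) + Polynomial.C (y₂ v) * Polynomial.X

/-- The map `ℝ[x_v : v ∈ V] → ℝ[X]` sending `x_v` to the linear form of `v`. -/
noncomputable def galeHom (y₁ y₂ : V → ℝ) : MvPolynomial V ℝ →ₐ[ℝ] Polynomial ℝ :=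
  aeval (galeForm y₁ y₂)

/-- The homogeneous version of `galeHom`, with values in binary forms. -/
noncomputable def galeHom₂ (y₁ y₂ : V → ℝ) : MvPolynomial V ℝ →ₐ[ℝ] MvPolynomial (Fin 2) ℝ :=
  aeval fun v => C (y₁ v) * X 1 + C (y₂ v) * X 0

omit [Fintype V] in
theorem galeHom_X (y₁ y₂ : V → ℝ) (v : V) : galeHom y₁ y₂ (X v) = galeForm y₁ y₂ v :=
  aeval_X _ _

omit [Fintype V] in
theorem natDegree_galeForm_le (y₁ y₂ : V → ℝ) (v : V) : (galeForm y₁ y₂ v).natDegree ≤ 1 := by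
  unfold galeForm
  compute_degree

omit [Fintype V] in
theorem aeval_galeHom₂ (y₁ y₂ : V → ℝ) (F : MvPolynomial V ℝ) :
    aeval ![Polynomial.X, 1] (galeHom₂ y₁ y₂ F) = galeHom y₁ y₂ F := by
  have : (aeval ![(Polynomial.X : Polynomial ℝ), 1]).comp (galeHom₂ y₁ y₂) = galeHom y₁ y₂ := by
    apply MvPolynomial.algHom_ext
    intro v
    simp [galeHom₂, galeHom, galeForm, Polynomial.C_eq_algebraMap, MvPolynomial.algHom_C]
  exact DFunLike.congr_fun this F

omit [Fintype V] in
theorem isHomogeneous_galeHom₂ (y₁ y₂ : V → ℝ) {F : MvPolynomial V ℝ} {n : ℕ}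
    (hF : F.IsHomogeneous n) : (galeHom₂ y₁ y₂ F).IsHomogeneous n := by
  have := hF.aeval (fun v => C (y₁ v) * X 1 + C (y₂ v) * X 0 : V → MvPolynomial (Fin 2) ℝ)
    (n := 1) fun v => ((isHomogeneous_C_mul_X _ _).add (isHomogeneous_C_mul_X _ _))
  rwa [one_mul] at this

omit [Fintype V] in
theorem homogenize_galeHom (y₁ y₂ : V → ℝ) {F : MvPolynomial V ℝ} {n : ℕ}
    (hF : F.IsHomogeneous n) : (galeHom y₁ y₂ F).homogenize n = galeHom₂ y₁ y₂ F :=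
  Polynomial.homogenize_eq_of_isHomogeneous (isHomogeneous_galeHom₂ y₁ y₂ hF)
    (aeval_galeHom₂ y₁ y₂ F)

omit [Fintype V] in
theorem natDegree_galeHom_le (y₁ y₂ : V → ℝ) {F : MvPolynomial V ℝ} {n : ℕ}
    (hF : F.IsHomogeneous n) : (galeHom y₁ y₂ F).natDegree ≤ n := by
  rw [F.as_sum, map_sum]
  refine Polynomial.natDegree_sum_le_of_forall_le _ _ fun m hm => ?_
  rw [galeHom, aeval_monomial, ← Polynomial.C_eq_algebraMap]
  refine (Polynomial.natDegree_C_mul_le _ _).trans ?_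
  refine (Polynomial.natDegree_prod_le _ _).trans ?_
  have hmn : m.degree = n := by
    have := hF (mem_support_iff.mp hm)
    rw [Finsupp.degree_eq_weight_one]
    exact this
  rw [← hmn, Finsupp.degree]
  refine Finset.sum_le_sum fun v _ => ?_
  refine Polynomial.natDegree_pow_le.trans ?_
  have := Nat.mul_le_mul_left (m v) (natDegree_galeForm_le y₁ y₂ v)
  rwa [mul_one] at this

/-- The ideal generated by `θ_1, …, θ_d` and `c`. -/
noncomputable def linearIdeal (p : V → Fin d → ℝ) : Ideal (MvPolynomial V ℝ) :=
  Ideal.span (Set.range (theta p)) ⊔ Ideal.span {∑ v, (X v : MvPolynomial V ℝ)}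

theorem linearIdeal_le (Δ : AbstractSimplicialComplex V) (p : V → Fin d → ℝ) :
    linearIdeal p ≤ artinianIdeal Δ p := by
  rw [linearIdeal, artinianIdeal, sup_assoc]
  exact le_sup_right

theorem affineForm_mem_linearIdeal (p : V → Fin d → ℝ) (q : Fin d → ℝ) (q₀ : ℝ) :
    ∑ v, C (∑ j, q j * p v j + q₀) * X v ∈ linearIdeal p := by
  have : ∑ v, C (∑ j, q j * p v j + q₀) * (X v : MvPolynomial V ℝ) =
      ∑ j, C (q j) * theta p j + C q₀ * ∑ v, X v := by
    simp only [theta, Finset.mul_sum, C_add, map_sum, C_mul, add_mul, Finset.sum_add_distrib,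
      Finset.sum_mul]
    rw [Finset.sum_comm]
    simp only [mul_assoc]
  rw [this]
  refine Ideal.add_mem _ (Ideal.sum_mem _ fun j _ => ?_) ?_
  · exact Ideal.mul_mem_left _ _ (Ideal.mem_sup_left (Ideal.subset_span ⟨j, rfl⟩))
  · exact Ideal.mul_mem_left _ _ (Ideal.mem_sup_right (Ideal.subset_span rfl))

theorem galeHom_eq_zero_of_mem_linearIdeal {p : V → Fin d → ℝ} {y₁ y₂ : V → ℝ}
    (h₁ : IsAffineDependency p y₁) (h₂ : IsAffineDependency p y₂) {F : MvPolynomial V ℝ}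
    (hF : F ∈ linearIdeal p) : galeHom y₁ y₂ F = 0 := by
  have hle : linearIdeal p ≤ RingHom.ker (galeHom y₁ y₂) := by
    have hco : ∀ y, IsAffineDependency p y → ∀ j, ∑ v, p v j * y v = 0 := by
      intro y hy j
      have := congrFun hy.1 j
      simpa [mul_comm] using this
    refine sup_le (Ideal.span_le.2 ?_) (Ideal.span_le.2 ?_)
    · rintro _ ⟨j, rfl⟩
      rw [SetLike.mem_coe, RingHom.mem_ker, theta, map_sum]
      have : ∀ v, galeHom y₁ y₂ (C (p v j) * X v) = Polynomial.C (p v j * y₁ v) +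
          Polynomial.C (p v j * y₂ v) * Polynomial.X := by
        intro v
        rw [map_mul, galeHom_X, algHom_C, ← Polynomial.C_eq_algebraMap, galeForm,
          Polynomial.C_mul, Polynomial.C_mul]
        ring
      simp only [this, Finset.sum_add_distrib, ← Finset.sum_mul, ← map_sum]
      rw [hco y₁ h₁, hco y₂ h₂]
      simp
    · rintro _ rfl
      rw [SetLike.mem_coe, RingHom.mem_ker, map_sum]
      simp only [galeHom_X, galeForm, Finset.sum_add_distrib, ← Finset.sum_mul, ← map_sum]
      rw [h₁.2, h₂.2]
      simp
  exact hle hF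

/-- `galeHom` splits modulo the linear forms: a homogeneous polynomial of degree `n` is determined
by its image, up to `θ_1, …, θ_d, c`. -/
theorem IsGalePair.exists_section {p : V → Fin d → ℝ} {y₁ y₂ : V → ℝ} (hy : IsGalePair p y₁ y₂) :
    ∃ S : Fin 2 → MvPolynomial V ℝ, (∀ i, (S i).IsHomogeneous 1) ∧
      galeHom y₁ y₂ (S 0) = Polynomial.X ∧ galeHom y₁ y₂ (S 1) = 1 ∧
      ∀ F, F - aeval S (galeHom₂ y₁ y₂ F) ∈ linearIdeal p := by
  classical
  obtain ⟨v, w, hvw⟩ := exists_bracket_ne_zero hy.indep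
  set D := y₁ v * y₂ w - y₁ w * y₂ v with hD
  -- by Cramer's rule, the forms of `v` and `w` are combined into `X` and `1`
  let c : Fin 2 → V → ℝ := ![fun x => D⁻¹ * (y₁ v * (if x = w then 1 else 0) -
    y₁ w * (if x = v then 1 else 0)), fun x => D⁻¹ * (y₂ w * (if x = v then 1 else 0) -
    y₂ v * (if x = w then 1 else 0))]
  let S : Fin 2 → MvPolynomial V ℝ := fun i => ∑ x, C (c i x) * X x
  have hgS : ∀ i, galeHom y₁ y₂ (S i) = Polynomial.C (∑ x, c i x * y₁ x) +
      Polynomial.C (∑ x, c i x * y₂ x) * Polynomial.X := by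
    intro i
    simp only [S, map_sum, map_mul, galeHom_X, algHom_C, ← Polynomial.C_eq_algebraMap, galeForm,
      Finset.sum_mul, ← Finset.sum_add_distrib]
    refine Finset.sum_congr rfl fun x _ => ?_
    ring
  have hc : ∀ y : V → ℝ, ∑ x, c 0 x * y x = D⁻¹ * (y₁ v * y w - y₁ w * y v) ∧
      ∑ x, c 1 x * y x = D⁻¹ * (y₂ w * y v - y₂ v * y w) := by
    intro y
    constructor
    · simp [c, mul_assoc, ← Finset.mul_sum, sub_mul, Finset.sum_sub_distrib]
    · simp [c, mul_assoc, ← Finset.mul_sum, sub_mul, Finset.sum_sub_distrib]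
  have c01 : ∑ x, c 0 x * y₁ x = 0 := by rw [(hc y₁).1]; ring
  have c02 : ∑ x, c 0 x * y₂ x = 1 := by rw [(hc y₂).1, ← hD, inv_mul_cancel₀ hvw]
  have c11 : ∑ x, c 1 x * y₁ x = 1 := by
    rw [(hc y₁).2, show y₂ w * y₁ v - y₂ v * y₁ w = D by rw [hD]; ring, inv_mul_cancel₀ hvw]
  have c12 : ∑ x, c 1 x * y₂ x = 0 := by rw [(hc y₂).2]; ring
  refine ⟨S, fun i => ?_, ?_, ?_, fun F => ?_⟩
  · exact IsHomogeneous.sum _ _ _ fun x _ => isHomogeneous_C_mul_X _ _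
  · rw [hgS, c01, c02]
    simp
  · rw [hgS, c11, c12]
    simp
  · rw [← Ideal.Quotient.eq]
    have : (Ideal.Quotient.mkₐ ℝ (linearIdeal p)) =
        (Ideal.Quotient.mkₐ ℝ (linearIdeal p)).comp ((aeval S).comp (galeHom₂ y₁ y₂)) := by
      apply MvPolynomial.algHom_ext
      intro x
      rw [AlgHom.comp_apply, AlgHom.comp_apply, galeHom₂, aeval_X]
      simp only [map_add, map_mul, aeval_X, algHom_C]
      rw [← map_mul, ← map_mul, ← map_add]
      rw [Ideal.Quotient.mkₐ_eq_mk, Ideal.Quotient.eq]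
      obtain ⟨q, q₀, hq⟩ := exists_affine_of_orthogonal (p := p)
        (c := fun z => (if z = x then 1 else 0) - (y₁ x * c 1 z + y₂ x * c 0 z)) (by
          intro y hyd
          obtain ⟨s, t, rfl⟩ := hy.exists_eq y hyd
          have e1 : ∀ z, (s • y₁ + t • y₂) z * ((if z = x then 1 else 0) -
              (y₁ x * c 1 z + y₂ x * c 0 z)) =
              (if z = x then (s * y₁ x + t * y₂ x) else 0) - (s * y₁ x) * (c 1 z * y₁ z)
              - (s * y₂ x) * (c 0 z * y₁ z) - (t * y₁ x) * (c 1 z * y₂ z)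
              - (t * y₂ x) * (c 0 z * y₂ z) := by
            intro z
            simp only [Pi.add_apply, Pi.smul_apply, smul_eq_mul]
            split_ifs with h
            · subst h; ring
            · ring
          simp only [e1, Finset.sum_sub_distrib, ← Finset.mul_sum, c01, c02, c11, c12]
          simp)
      have hmem := affineForm_mem_linearIdeal p q q₀
      simp only [← hq] at hmem
      convert hmem using 1
      simp only [S, C_sub, C_add, C_mul, sub_mul, add_mul, Finset.sum_sub_distrib,
        Finset.sum_add_distrib, mul_assoc, ← Finset.mul_sum]
      congr 1
      simp
    exact DFunLike.congr_fun this F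

end Gale

section Ring

variable {V : Type*} [Fintype V] [DecidableEq V] {d : ℕ}

/-- The monomial of the colour class `i`. -/
noncomputable def colorMonomial (κ : V → Fin 3) (i : Fin 3) : MvPolynomial V ℝ :=
  ∏ v with κ v = i, X v

/-- The dehomogenised form of the colour class `i`: the product of the forms of its vertices. -/
noncomputable def colorForm (κ : V → Fin 3) (y₁ y₂ : V → ℝ) (i : Fin 3) : Polynomial ℝ :=
  ∏ v with κ v = i, galeForm y₁ y₂ v

/-- The number of vertices of colour `i`. -/
def colorCard (κ : V → Fin 3) (i : Fin 3) : ℕ := (Finset.univ.filter fun v => κ v = i).card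

omit [DecidableEq V] in
theorem galeHom_colorMonomial (κ : V → Fin 3) (y₁ y₂ : V → ℝ) (i : Fin 3) :
    galeHom y₁ y₂ (colorMonomial κ i) = colorForm κ y₁ y₂ i := by
  simp [colorMonomial, colorForm, galeHom_X]

omit [DecidableEq V] in
theorem isHomogeneous_colorMonomial (κ : V → Fin 3) (i : Fin 3) :
    (colorMonomial κ i).IsHomogeneous (colorCard κ i) := by
  have := IsHomogeneous.prod (Finset.univ.filter fun v => κ v = i)
    (fun v => (X v : MvPolynomial V ℝ)) (fun _ => 1) fun v _ => isHomogeneous_X ℝ v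
  simpa [colorMonomial, colorCard] using this

omit [DecidableEq V] in
theorem natDegree_colorForm_le (κ : V → Fin 3) (y₁ y₂ : V → ℝ) (i : Fin 3) :
    (colorForm κ y₁ y₂ i).natDegree ≤ colorCard κ i := by
  rw [← galeHom_colorMonomial]
  exact natDegree_galeHom_le _ _ (isHomogeneous_colorMonomial κ i)

theorem IsColorComplex.stanleyReisnerIdeal_eq {κ : V → Fin 3} {Δ : AbstractSimplicialComplex V}
    (hΔ : IsColorComplex κ Δ) :
    stanleyReisnerIdeal Δ = Ideal.span (Set.range (colorMonomial κ)) := by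
  rw [stanleyReisnerIdeal]
  congr 1
  ext f
  constructor
  · rintro ⟨τ, hτ, rfl⟩
    obtain ⟨i, rfl⟩ := hΔ.isMissingFace_iff.1 hτ
    exact ⟨i, rfl⟩
  · rintro ⟨i, rfl⟩
    exact ⟨_, hΔ.isMissingFace_iff.2 ⟨i, rfl⟩, rfl⟩

theorem IsColorComplex.colorMonomial_mem {κ : V → Fin 3} {Δ : AbstractSimplicialComplex V}
    (hΔ : IsColorComplex κ Δ) (p : V → Fin d → ℝ) (i : Fin 3) :
    colorMonomial κ i ∈ artinianIdeal Δ p := by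
  rw [artinianIdeal, hΔ.stanleyReisnerIdeal_eq]
  exact Ideal.mem_sup_left (Ideal.mem_sup_left (Ideal.subset_span ⟨i, rfl⟩))

/-- The part of degree `n` of the ideal generated by the forms of the three colours, the first two
of which have `α` vertices, and the last one `γ`. -/
noncomputable abbrev colorRelSpace (κ : V → Fin 3) (y₁ y₂ : V → ℝ) (α γ n : ℕ) :
    Submodule ℝ (Polynomial ℝ) :=
  relSpace (colorForm κ y₁ y₂ 0) (colorForm κ y₁ y₂ 1) (colorForm κ y₁ y₂ 2) α γ n

/-- Half of the identification of `A(Δ, p)` with the quotient of the binary forms by the forms of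
the three colours: the ideal contains the homogeneous polynomials mapped to forms in the ideal of
these three. -/
theorem IsColorComplex.mem_artinianIdeal_of_galeHom_mem {κ : V → Fin 3}
    {Δ : AbstractSimplicialComplex V} (hΔ : IsColorComplex κ Δ) {p : V → Fin d → ℝ}
    {y₁ y₂ : V → ℝ} (hy : IsGalePair p y₁ y₂) {α γ : ℕ} (h0 : colorCard κ 0 = α)
    (h1 : colorCard κ 1 = α) (h2 : colorCard κ 2 = γ) {n : ℕ} {F : MvPolynomial V ℝ}
    (hF : F.IsHomogeneous n) (hmem : galeHom y₁ y₂ F ∈ colorRelSpace κ y₁ y₂ α γ n) :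
    F ∈ artinianIdeal Δ p := by
  obtain ⟨S, -, -, -, hS⟩ := hy.exists_section
  have hS' : ∀ F, F - aeval S (galeHom₂ y₁ y₂ F) ∈ artinianIdeal Δ p := fun F =>
    linearIdeal_le Δ p (hS F)
  have key : ∀ (i : Fin 3) (P : Polynomial ℝ),
      P ∈ Polynomial.degreeLT ℝ (n + 1 - colorCard κ i) →
      aeval S ((P * colorForm κ y₁ y₂ i).homogenize n) ∈ artinianIdeal Δ p := by
    intro i P hP
    by_cases hn : colorCard κ i ≤ n
    · have hPd : P.natDegree ≤ n - colorCard κ i := by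
        by_cases hP0 : P = 0
        · simp [hP0]
        · rw [Polynomial.mem_degreeLT] at hP
          have := (Polynomial.natDegree_lt_iff_degree_lt hP0).2 hP
          omega
      have := Polynomial.homogenize_mul P (colorForm κ y₁ y₂ i) hPd
        (natDegree_colorForm_le κ y₁ y₂ i)
      rw [Nat.sub_add_cancel hn] at this
      rw [this, map_mul]
      refine Ideal.mul_mem_left _ _ ?_
      rw [← galeHom_colorMonomial, homogenize_galeHom _ _ (isHomogeneous_colorMonomial κ i)]
      exact (Submodule.sub_mem_iff_right _ (hΔ.colorMonomial_mem p i)).1 (hS' _)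
    · have : P = 0 := by
        ext k
        exact mem_degreeLT_iff_coeff.1 hP k (by omega)
      rw [this, zero_mul, Polynomial.homogenize_zero, map_zero]
      exact zero_mem _
  obtain ⟨P, hP, Q, hQ, R, hR, hsum⟩ := hmem
  rw [← h0] at hP
  rw [← h0, h0, ← h1] at hQ
  rw [← h2] at hR
  refine (Submodule.sub_mem_iff_left _ ?_).1 (hS' F)
  rw [← homogenize_galeHom y₁ y₂ hF, hsum, Polynomial.homogenize_add, Polynomial.homogenize_add,
    map_add, map_add]
  exact add_mem (add_mem (key 0 P hP) (key 1 Q hQ)) (key 2 R hR)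

omit [DecidableEq V] [Fintype V] in
theorem homogeneousComponent_succ_mul_X (F : MvPolynomial V ℝ) (v : V) (n : ℕ) :
    homogeneousComponent (n + 1) (F * X v) = homogeneousComponent n F * X v := by
  classical
  ext m
  rw [coeff_homogeneousComponent, coeff_mul_X', coeff_mul_X', coeff_homogeneousComponent]
  by_cases hv : v ∈ m.support
  · rw [if_pos hv, if_pos hv]
    have hle : Finsupp.single v 1 ≤ m := by
      rw [Finsupp.single_le_iff]
      exact Nat.one_le_iff_ne_zero.2 (Finsupp.mem_support_iff.1 hv)
    have hdeg : m.degree = (m - Finsupp.single v 1).degree + 1 := by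
      conv_lhs => rw [← tsub_add_cancel_of_le hle]
      rw [map_add, Finsupp.degree_single]
    rw [hdeg]
    simp
  · simp [hv]

omit [DecidableEq V] [Fintype V] in
theorem homogeneousComponent_zero_mul_X (F : MvPolynomial V ℝ) (v : V) :
    homogeneousComponent 0 (F * X v) = 0 := by
  classical
  rw [homogeneousComponent_zero, coeff_mul_X']
  simp

/-- The other half of the identification: `galeHom` maps the homogeneous components of the ideal
into the ideal of the forms of the three colours. -/
theorem IsColorComplex.galeHom_mem_of_mem_artinianIdeal {κ : V → Fin 3}
    {Δ : AbstractSimplicialComplex V} (hΔ : IsColorComplex κ Δ) {p : V → Fin d → ℝ}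
    {y₁ y₂ : V → ℝ} (h₁ : IsAffineDependency p y₁) (h₂ : IsAffineDependency p y₂) {α γ : ℕ}
    (h0 : colorCard κ 0 = α) (h1 : colorCard κ 1 = α) (h2 : colorCard κ 2 = γ)
    {F : MvPolynomial V ℝ} (hF : F ∈ artinianIdeal Δ p) (n : ℕ) :
    galeHom y₁ y₂ (homogeneousComponent n F) ∈ colorRelSpace κ y₁ y₂ α γ n := by
  let N : Ideal (MvPolynomial V ℝ) :=
    { carrier := {F | ∀ n, galeHom y₁ y₂ (homogeneousComponent n F) ∈
        colorRelSpace κ y₁ y₂ α γ n}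
      add_mem' := fun {a b} ha hb n => by
        rw [map_add, map_add]
        exact add_mem (ha n) (hb n)
      zero_mem' := fun n => by
        rw [map_zero, map_zero]
        exact zero_mem _
      smul_mem' := fun G F hF => by
        rw [Set.mem_ofPred_eq, smul_eq_mul, mul_comm]
        induction G using MvPolynomial.induction_on with
        | C a =>
          intro n
          rw [mul_comm, homogeneousComponent_C_mul, ← smul_eq_C_mul, map_smul]
          exact Submodule.smul_mem _ _ (hF n)
        | add P Q hP hQ =>
          intro n
          rw [mul_add, map_add, map_add]
          exact add_mem (hP n) (hQ n)
        | mul_X P v hP =>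
          rw [← mul_assoc]
          rintro (_ | n)
          · rw [homogeneousComponent_zero_mul_X, map_zero]
            exact zero_mem _
          · rw [homogeneousComponent_succ_mul_X, map_mul, galeHom_X, mul_comm]
            exact relSpace_mul_mem (hP n) _ _ }
  have hle : artinianIdeal Δ p ≤ N := by
    rw [artinianIdeal, hΔ.stanleyReisnerIdeal_eq, sup_assoc]
    refine sup_le (Ideal.span_le.2 ?_) ?_
    · rintro _ ⟨i, rfl⟩ n
      rw [homogeneousComponent_of_mem (isHomogeneous_colorMonomial κ i)]
      split_ifs with hn
      · rw [galeHom_colorMonomial]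
        have hone : ∀ e, e = n → (1 : Polynomial ℝ) ∈ Polynomial.degreeLT ℝ (n + 1 - e) := by
          intro e he
          exact C_mem_degreeLT 1 (by omega)
        fin_cases i
        · exact ⟨1, hone _ (h0.symm.trans hn.symm), 0, zero_mem _, 0, zero_mem _, by simp⟩
        · exact ⟨0, zero_mem _, 1, hone _ (h1.symm.trans hn.symm), 0, zero_mem _, by simp⟩
        · exact ⟨0, zero_mem _, 0, zero_mem _, 1, hone _ (h2.symm.trans hn.symm), by simp⟩
      · rw [map_zero]
        exact zero_mem _
    · have hlin : ∀ F ∈ linearIdeal p, F.IsHomogeneous 1 → F ∈ N := by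
        intro F hF hF1 n
        rw [homogeneousComponent_of_mem hF1]
        split_ifs
        · rw [galeHom_eq_zero_of_mem_linearIdeal h₁ h₂ hF]
          exact zero_mem _
        · rw [map_zero]
          exact zero_mem _
      refine sup_le (Ideal.span_le.2 ?_) (Ideal.span_le.2 ?_)
      · rintro _ ⟨j, rfl⟩
        exact hlin _ (Ideal.mem_sup_left (Ideal.subset_span ⟨j, rfl⟩))
          (IsHomogeneous.sum _ _ _ fun v _ => isHomogeneous_C_mul_X _ _)
      · rintro _ rfl
        exact hlin _ (Ideal.mem_sup_right (Ideal.subset_span rfl))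
          (IsHomogeneous.sum _ _ _ fun v _ => isHomogeneous_X _ _)
  exact hle hF n

omit [DecidableEq V] in
/-- Lifting a polynomial of degree at most `n` to a form of degree `n` on the vertex variables. -/
theorem IsGalePair.exists_lift {p : V → Fin d → ℝ} {y₁ y₂ : V → ℝ} (hy : IsGalePair p y₁ y₂)
    {n : ℕ} {q : Polynomial ℝ} (hq : q ∈ Polynomial.degreeLT ℝ (n + 1)) :
    ∃ F : MvPolynomial V ℝ, F.IsHomogeneous n ∧ galeHom y₁ y₂ F = q := by
  obtain ⟨S, hS1, hS0, hS1', -⟩ := hy.exists_section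
  have hdeg : q.natDegree ≤ n := by
    by_cases hq0 : q = 0
    · simp [hq0]
    · rw [Polynomial.mem_degreeLT] at hq
      have := (Polynomial.natDegree_lt_iff_degree_lt hq0).2 hq
      omega
  refine ⟨aeval S (q.homogenize n), ?_, ?_⟩
  · have := (Polynomial.isHomogeneous_homogenize (n := n) q).aeval S hS1
    rwa [one_mul] at this
  · have : (galeHom y₁ y₂).comp (aeval S) = aeval ![(Polynomial.X : Polynomial ℝ), 1] := by
      apply MvPolynomial.algHom_ext
      intro i
      fin_cases i
      · simpa using hS0
      · simpa using hS1'
    rw [← AlgHom.comp_apply, this, Polynomial.aeval_homogenize_X_one _ hdeg]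

end Ring

end SphereStress

namespace SphereStress

open MvPolynomial

/-! ### The pairing between polynomials and stresses -/

section Pairing

theorem monomial_indicator_eq_prod {V : Type*} (τ : Finset V) :
    ∏ v ∈ τ, (X v : MvPolynomial V ℝ) = monomial (∑ v ∈ τ, Finsupp.single v 1) 1 := by
  rw [monomial_sum_one]
  rfl

variable {V : Type*} [Fintype V] {d : ℕ}

/-- The product of the factorials of the exponents of a monomial. -/
def multiFactorial (m : V →₀ ℕ) : ℕ := ∏ v, (m v).factorial

theorem multiFactorial_ne_zero (m : V →₀ ℕ) : (multiFactorial m : ℝ) ≠ 0 := by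
  rw [Nat.cast_ne_zero, multiFactorial, Finset.prod_ne_zero_iff]
  exact fun v _ => Nat.factorial_ne_zero _

theorem multiFactorial_add_single (m : V →₀ ℕ) (v : V) :
    multiFactorial (m + Finsupp.single v 1) = (m v + 1) * multiFactorial m := by
  classical
  rw [multiFactorial, multiFactorial, ← Finset.mul_prod_erase _ _ (Finset.mem_univ v),
    ← Finset.mul_prod_erase Finset.univ (fun x => (m x).factorial) (Finset.mem_univ v), ← mul_assoc]
  congr 1
  · simp [Nat.factorial_succ]
  · refine Finset.prod_congr rfl fun x hx => ?_
    have : v ≠ x := fun h => (Finset.mem_erase.1 hx).1 h.symm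
    simp [this]

/-- The pairing `⟨ω, F⟩ = (∂_F ω)(0)`, in which monomials are orthogonal. -/
noncomputable def stressPairing : MvPolynomial V ℝ →ₗ[ℝ] MvPolynomial V ℝ →ₗ[ℝ] ℝ :=
  ((basisMonomials V ℝ).constr ℝ).toLinearMap ∘ₗ
    LinearMap.pi fun m => (multiFactorial m : ℝ) • lcoeff ℝ m

theorem stressPairing_monomial (ω : MvPolynomial V ℝ) (m : V →₀ ℕ) (a : ℝ) :
    stressPairing ω (monomial m a) = a * (multiFactorial m * coeff m ω) := by
  have : monomial m a = a • basisMonomials V ℝ m := by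
    rw [coe_basisMonomials, smul_monomial, smul_eq_mul, mul_one]
  rw [this, map_smul, stressPairing, LinearMap.comp_apply, LinearEquiv.coe_coe,
    Module.Basis.constr_basis]
  rfl

/-- Multiplication by `x_v` is adjoint to `∂/∂x_v`. -/
theorem stressPairing_mul_X (ω F : MvPolynomial V ℝ) (v : V) :
    stressPairing ω (F * X v) = stressPairing (pderiv v ω) F := by
  induction F using MvPolynomial.induction_on' with
  | monomial m a =>
    rw [X, monomial_mul, mul_one, stressPairing_monomial, stressPairing_monomial, coeff_pderiv,
      multiFactorial_add_single]
    push_cast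
    ring
  | add P Q hP hQ => rw [add_mul, map_add, map_add, hP, hQ]

theorem stressPairing_mul_linear (ω F : MvPolynomial V ℝ) (c : V → ℝ) :
    stressPairing ω ((∑ v, C (c v) * X v) * F) = stressPairing (∑ v, c v • pderiv v ω) F := by
  rw [Finset.sum_mul, map_sum, map_sum, LinearMap.sum_apply]
  refine Finset.sum_congr rfl fun v _ => ?_
  rw [map_smul, LinearMap.smul_apply, ← stressPairing_mul_X, mul_assoc, ← smul_eq_C_mul, map_smul,
    mul_comm]

/-- Affine stresses are orthogonal to the ideal. -/
theorem stressPairing_eq_zero_of_mem {Δ : AbstractSimplicialComplex V} {p : V → Fin d → ℝ} {k : ℕ}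
    {ω : MvPolynomial V ℝ} (hω : ω ∈ affineStresses Δ p k) {F : MvPolynomial V ℝ}
    (hF : F ∈ artinianIdeal Δ p) : stressPairing ω F = 0 := by
  classical
  obtain ⟨-, hsupp, hθ, hc⟩ := hω
  let N : Ideal (MvPolynomial V ℝ) :=
    { carrier := {F | ∀ G, stressPairing ω (F * G) = 0}
      add_mem' := fun {a b} ha hb G => by rw [add_mul, map_add, ha, hb, add_zero]
      zero_mem' := fun G => by rw [zero_mul, map_zero]
      smul_mem' := fun H F hF G => by
        rw [smul_eq_mul, mul_comm H, mul_assoc]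
        exact hF _ }
  have hle : artinianIdeal Δ p ≤ N := by
    rw [artinianIdeal]
    refine sup_le (sup_le (Ideal.span_le.2 ?_) (Ideal.span_le.2 ?_)) (Ideal.span_le.2 ?_)
    · rintro _ ⟨τ, hτ, rfl⟩ G
      rw [monomial_indicator_eq_prod]
      induction G using MvPolynomial.induction_on' with
      | monomial m a =>
        rw [monomial_mul, stressPairing_monomial]
        have : coeff (∑ v ∈ τ, Finsupp.single v 1 + m) ω = 0 := by
          by_contra hne
          refine hτ.1 (mem_allFaces_of_subset (hsupp _ (mem_support_iff.2 hne)) fun v hv => ?_)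
          rw [Finsupp.mem_support_iff, Finsupp.add_apply, Finsupp.finsetSum_apply]
          have : ∑ w ∈ τ, (Finsupp.single w 1 : V →₀ ℕ) v = 1 := by
            simp [Finsupp.single_apply, hv]
          omega
        rw [this, mul_zero, mul_zero]
      | add P Q hP hQ => rw [mul_add, map_add, hP, hQ, add_zero]
    · rintro _ ⟨j, rfl⟩ G
      rw [theta, stressPairing_mul_linear, hθ, map_zero, LinearMap.zero_apply]
    · rintro _ rfl G
      have := stressPairing_mul_linear ω G fun _ => (1 : ℝ)
      simp only [C_1, one_mul, one_smul] at this
      rw [this, hc, map_zero, LinearMap.zero_apply]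
  have := hle hF 1
  rwa [mul_one] at this

open Classical in
/-- The form of degree `j` that represents a linear functional on polynomials of degree `j` through
the pairing. -/
noncomputable def inverseForm (φ : MvPolynomial V ℝ →ₗ[ℝ] ℝ) (j : ℕ) : MvPolynomial V ℝ :=
  ∑ m ∈ Finset.univ.finsuppAntidiag j, monomial m (φ (monomial m 1) / multiFactorial m)

theorem coeff_inverseForm (φ : MvPolynomial V ℝ →ₗ[ℝ] ℝ) (j : ℕ) (m : V →₀ ℕ) :
    coeff m (inverseForm φ j) =
      if m.degree = j then φ (monomial m 1) / multiFactorial m else 0 := by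
  classical
  rw [inverseForm, coeff_sum]
  simp only [coeff_monomial]
  rw [Finset.sum_ite_eq']
  simp [Finsupp.degree_eq_sum]

theorem stressPairing_inverseForm (φ : MvPolynomial V ℝ →ₗ[ℝ] ℝ) {j : ℕ} {F : MvPolynomial V ℝ}
    (hF : F.IsHomogeneous j) : stressPairing (inverseForm φ j) F = φ F := by
  rw [F.as_sum, map_sum, map_sum]
  refine Finset.sum_congr rfl fun m hm => ?_
  have hdeg : m.degree = j := by
    rw [Finsupp.degree_eq_weight_one]
    exact hF (mem_support_iff.1 hm)
  rw [stressPairing_monomial, coeff_inverseForm, if_pos hdeg,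
    mul_div_cancel₀ _ (multiFactorial_ne_zero m)]
  have : monomial m (coeff m F) = coeff m F • monomial m (1 : ℝ) := by
    rw [smul_monomial, smul_eq_mul, mul_one]
  rw [this, map_smul, smul_eq_mul]

theorem sum_pderiv_inverseForm {φ : MvPolynomial V ℝ →ₗ[ℝ] ℝ} {c : V → ℝ}
    (hφ : ∀ G, φ ((∑ v, C (c v) * X v) * G) = 0) (j : ℕ) :
    ∑ v, c v • pderiv v (inverseForm φ j) = 0 := by
  ext n
  rw [coeff_sum, coeff_zero]
  simp only [coeff_smul, coeff_pderiv, coeff_inverseForm, map_add, Finsupp.degree_single]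
  split_ifs with hn
  · have h := hφ (monomial n 1)
    rw [Finset.sum_mul, map_sum] at h
    have h' : ∀ v, φ (C (c v) * X v * monomial n 1) =
        c v * φ (monomial (n + Finsupp.single v 1) 1) := by
      intro v
      rw [mul_assoc, ← smul_eq_C_mul, map_smul, smul_eq_mul, X, monomial_mul, mul_one, add_comm n]
    simp only [h'] at h
    have h'' : ∀ v, c v • (φ (monomial (n + Finsupp.single v 1) 1) /
        (multiFactorial (n + Finsupp.single v 1) : ℝ) * (n v + 1)) =
        c v * φ (monomial (n + Finsupp.single v 1) 1) * (multiFactorial n : ℝ)⁻¹ := by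
      intro v
      have h1 := multiFactorial_ne_zero n
      have h2 : (n v : ℝ) + 1 ≠ 0 := by positivity
      rw [multiFactorial_add_single, smul_eq_mul]
      push_cast
      field_simp
    simp only [h'']
    rw [← Finset.sum_mul, h, zero_mul]
  · simp

/-- Functionals vanishing on the ideal are represented by affine stresses. -/
theorem inverseForm_mem_affineStresses {Δ : AbstractSimplicialComplex V} {p : V → Fin d → ℝ}
    {φ : MvPolynomial V ℝ →ₗ[ℝ] ℝ} (hφ : ∀ F ∈ artinianIdeal Δ p, φ F = 0) (j : ℕ) :
    inverseForm φ j ∈ affineStresses Δ p j := by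
  classical
  refine ⟨fun m hm => ?_, fun m hm => ?_, fun i => ?_, ?_⟩
  · rw [coeff_inverseForm] at hm
    by_contra hne
    refine hm (if_neg fun h => hne ?_)
    rw [← h, Finsupp.degree_eq_weight_one]
    rfl
  · by_contra hface
    rw [mem_support_iff, coeff_inverseForm] at hm
    -- a minimal non-face inside the support of `m` is a missing face
    obtain ⟨τ, hτm, hτ⟩ := exists_minimal_le_of_wellFoundedLT
      (fun τ => τ ∉ AllFaces Δ.toPreAbstractSimplicialComplex) m.support hface
    have hmiss : IsMissingFace Δ.toPreAbstractSimplicialComplex τ := by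
      refine ⟨hτ.1, fun σ hσ => ?_⟩
      by_contra hcon
      exact hσ.2 (hτ.2 hcon hσ.1)
    have hle : ∑ v ∈ τ, Finsupp.single v 1 ≤ m := by
      intro v
      rw [Finsupp.finsetSum_apply]
      by_cases hv : v ∈ τ
      · have h1 : ∑ w ∈ τ, (Finsupp.single w 1 : V →₀ ℕ) v = 1 := by
          simp [Finsupp.single_apply, hv]
        have h2 := Finsupp.mem_support_iff.1 (hτm hv)
        omega
      · have h1 : ∑ w ∈ τ, (Finsupp.single w 1 : V →₀ ℕ) v = 0 := by
          simp [Finsupp.single_apply, hv]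
        omega
    have hmem : monomial m (1 : ℝ) ∈ artinianIdeal Δ p := by
      have : monomial m (1 : ℝ) =
          (∏ v ∈ τ, X v) * monomial (m - ∑ v ∈ τ, Finsupp.single v 1) 1 := by
        rw [monomial_indicator_eq_prod, monomial_mul, add_tsub_cancel_of_le hle, one_mul]
      rw [this]
      exact Ideal.mul_mem_right _ _ (Ideal.mem_sup_left (Ideal.mem_sup_left
        (Ideal.subset_span ⟨τ, hmiss, rfl⟩)))
    rw [hφ _ hmem] at hm
    simp at hm
  · exact sum_pderiv_inverseForm (fun G => hφ _ (Ideal.mul_mem_right _ _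
      (Ideal.mem_sup_left (Ideal.mem_sup_right (Ideal.subset_span ⟨i, rfl⟩))))) j
  · have := sum_pderiv_inverseForm (φ := φ) (c := fun _ => 1) (fun G => hφ _ (by
      simp only [C_1, one_mul]
      exact Ideal.mul_mem_right _ _ (Ideal.mem_sup_right (Ideal.subset_span rfl)))) j
    simpa only [one_smul] using this

end Pairing

/-! ### Socle elements and reconstruction -/

theorem monomialDiff_single {V : Type*} (v : V) :
    monomialDiff (Finsupp.single v 1) = ((pderiv v : Derivation ℝ (MvPolynomial V ℝ)
      (MvPolynomial V ℝ)) : Module.End ℝ (MvPolynomial V ℝ)) := by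
  unfold monomialDiff
  refine (Finset.noncommProd_congr (Finsupp.support_single v one_ne_zero)
    (fun _ _ => rfl) _).trans ?_
  rw [Finset.noncommProd_singleton, Finsupp.single_eq_same, pow_one]

section Socle

variable {V : Type*} [Fintype V] {d : ℕ}

theorem stressPairing_polyDiff {μ : MvPolynomial V ℝ} (hμ : μ.IsHomogeneous 1)
    (ω F : MvPolynomial V ℝ) (hF : ∀ v, stressPairing ω (F * X v) = 0) :
    stressPairing (polyDiff μ ω) F = 0 := by
  rw [polyDiff, LinearMap.sum_apply, map_sum, LinearMap.sum_apply]
  refine Finset.sum_eq_zero fun m hm => ?_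
  have hdeg : m.degree = 1 := by
    rw [Finsupp.degree_eq_weight_one]
    exact hμ (mem_support_iff.1 hm)
  obtain ⟨v, rfl⟩ : ∃ v, m = Finsupp.single v 1 := by
    have hm0 : m.support.Nonempty := by
      rw [Finsupp.support_nonempty_iff]
      rintro rfl
      simp at hdeg
    obtain ⟨v, hv⟩ := hm0
    have hle : Finsupp.single v 1 ≤ m := by
      rw [Finsupp.single_le_iff]
      exact Nat.one_le_iff_ne_zero.2 (Finsupp.mem_support_iff.1 hv)
    refine ⟨v, ?_⟩
    rw [← tsub_add_cancel_of_le hle, map_add, Finsupp.degree_single] at hdeg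
    have h0 : m - Finsupp.single v 1 = 0 := (Finsupp.degree_eq_zero_iff _).1 (by omega)
    rw [← tsub_add_cancel_of_le hle, h0, zero_add]
  rw [LinearMap.smul_apply, map_smul, LinearMap.smul_apply, monomialDiff_single]
  change _ • stressPairing (pderiv v ω) F = 0
  rw [← stressPairing_mul_X, hF, smul_zero]

/-- A socle element in degree `j` obstructs the reconstruction of `j`-stresses from
`(j + 1)`-stresses: it pairs to zero with all their derivatives, but not with all `j`-stresses. -/
theorem not_stressReconstruction_of_socle {Δ : AbstractSimplicialComplex V} {p : V → Fin d → ℝ}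
    {u j : ℕ} (hj : 1 ≤ j) (hju : j + 1 ≤ u) {W : MvPolynomial V ℝ} (hW : W.IsHomogeneous j)
    (hWI : W ∉ artinianIdeal Δ p) (hWX : ∀ v, W * X v ∈ artinianIdeal Δ p) :
    ¬ StressReconstruction Δ p u := by
  intro hrec
  have hspan := hrec (j + 1) j hj (Nat.lt_succ_self j) hju
  have hker : affineStresses Δ p j ≤ LinearMap.ker (stressPairing.flip W) := by
    rw [hspan, Submodule.span_le]
    rintro _ ⟨ω, hω, μ, hμ, rfl⟩
    rw [Nat.add_sub_cancel_left] at hμ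
    exact stressPairing_polyDiff hμ ω W fun v => stressPairing_eq_zero_of_mem hω (hWX v)
  obtain ⟨φ, hφW, hφ⟩ := Submodule.exists_dual_map_eq_bot_of_notMem
    (p := (artinianIdeal Δ p).restrictScalars ℝ) (x := W) hWI inferInstance
  have hφI : ∀ F ∈ artinianIdeal Δ p, φ F = 0 := by
    intro F hF
    have : φ F ∈ Submodule.map φ ((artinianIdeal Δ p).restrictScalars ℝ) := ⟨F, hF, rfl⟩
    rw [hφ] at this
    simpa using this
  have h0 := hker (inverseForm_mem_affineStresses hφI j)
  rw [LinearMap.mem_ker, LinearMap.flip_apply, stressPairing_inverseForm φ hW] at h0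
  exact hφW h0

end Socle

/-- A ring that is nonzero in degree `u` and has a nonzero socle element in degree `j < u` is not
level. -/
theorem not_isLevel_of_socle {V : Type*} (I : Ideal (MvPolynomial V ℝ))
    [Module.Finite ℝ (MvPolynomial V ℝ ⧸ I)] {u j : ℕ} (hju : j + 1 ≤ u) {W F : MvPolynomial V ℝ}
    (hW : W.IsHomogeneous j) (hWI : W ∉ I) (hWX : ∀ v, W * X v ∈ I) (hF : F.IsHomogeneous u)
    (hFI : F ∉ I) : ¬ IsLevel I := by
  rintro ⟨s, hs1, hs2, -⟩
  have hus : u ≤ s := by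
    by_contra hlt
    have hmem : Ideal.Quotient.mk I F ∈ gradedPiece I u := ⟨F, hF, rfl⟩
    rw [hs1 u (by omega), Submodule.mem_bot, Ideal.Quotient.eq_zero_iff_mem] at hmem
    exact hFI hmem
  have hsoc := hs2 j (by omega)
  rw [socleNumber, Submodule.finrank_eq_zero] at hsoc
  have hmem : Ideal.Quotient.mk I W ∈ socle I ⊓ gradedPiece I j := by
    refine ⟨?_, W, hW, rfl⟩
    rw [SetLike.mem_coe, socle, Submodule.mem_iInf]
    intro v
    rw [LinearMap.mem_ker, LinearMap.mulLeft_apply, ← map_mul, Ideal.Quotient.eq_zero_iff_mem,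
      mul_comm]
    exact hWX v
  rw [hsoc, Submodule.mem_bot, Ideal.Quotient.eq_zero_iff_mem] at hmem
  exact hWI hmem

section Main

variable {V : Type*} [Fintype V] [DecidableEq V] {d : ℕ} {κ : V → Fin 3}
  {Δ : AbstractSimplicialComplex V} {p : V → Fin d → ℝ} {y₁ y₂ : V → ℝ}

/-- The ring is Artinian as soon as the Gale vectors of the first two colours are pairwise
independent: a prime ideal that contains the ideal contains a vertex of each of these colours,
hence all vertices. -/
theorem IsColorComplex.finite_ringA (hΔ : IsColorComplex κ Δ) (hy : IsGalePair p y₁ y₂)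
    (hab : ∀ a b, κ a = 0 → κ b = 1 → y₁ a * y₂ b - y₁ b * y₂ a ≠ 0) :
    Module.Finite ℝ (ringA Δ p) := by
  obtain ⟨S, -, -, -, hS⟩ := hy.exists_section
  have hrad : ∀ v, (X v : MvPolynomial V ℝ) ∈ (artinianIdeal Δ p).radical := by
    intro v
    rw [Ideal.radical_eq_sInf, Ideal.mem_sInf]
    rintro P ⟨hIP, hP⟩
    have hcol : ∀ i, ∃ w, κ w = i ∧ X w ∈ P := by
      intro i
      have := hIP (hΔ.colorMonomial_mem p i)
      rw [colorMonomial, hP.prod_mem_iff] at this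
      obtain ⟨w, hw, hwP⟩ := this
      exact ⟨w, by simpa using hw, hwP⟩
    have hlin : ∀ w, (X w : MvPolynomial V ℝ) ∈ P ↔ C (y₁ w) * S 1 + C (y₂ w) * S 0 ∈ P := by
      intro w
      have hmem := hIP (linearIdeal_le Δ p (hS (X w)))
      have : aeval S (galeHom₂ y₁ y₂ (X w)) = C (y₁ w) * S 1 + C (y₂ w) * S 0 := by
        simp [galeHom₂, algHom_C]
      rw [this] at hmem
      constructor
      · intro h
        exact (Submodule.sub_mem_iff_right _ h).1 hmem
      · intro h
        exact (Submodule.sub_mem_iff_left _ h).1 hmem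
    obtain ⟨a, ha, haP⟩ := hcol 0
    obtain ⟨b, hb, hbP⟩ := hcol 1
    rw [hlin] at haP hbP
    set D := y₁ a * y₂ b - y₁ b * y₂ a with hD
    have hD0 : D ≠ 0 := hab a b ha hb
    have hDC : C D⁻¹ * C D = (1 : MvPolynomial V ℝ) := by
      rw [← C_mul, inv_mul_cancel₀ hD0, C_1]
    have hDe : (C D : MvPolynomial V ℝ) = C (y₁ a) * C (y₂ b) - C (y₁ b) * C (y₂ a) := by
      rw [hD, C_sub, C_mul, C_mul]
    have hS1 : S 1 ∈ P := by
      have : S 1 = C D⁻¹ * (C (y₂ b) * (C (y₁ a) * S 1 + C (y₂ a) * S 0) -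
          C (y₂ a) * (C (y₁ b) * S 1 + C (y₂ b) * S 0)) := by
        linear_combination (-S 1) * hDC + C D⁻¹ * S 1 * hDe
      rw [this]
      exact P.mul_mem_left _ (sub_mem (P.mul_mem_left _ haP) (P.mul_mem_left _ hbP))
    have hS0 : S 0 ∈ P := by
      have : S 0 = C D⁻¹ * (C (y₁ a) * (C (y₁ b) * S 1 + C (y₂ b) * S 0) -
          C (y₁ b) * (C (y₁ a) * S 1 + C (y₂ a) * S 0)) := by
        linear_combination (-S 0) * hDC + C D⁻¹ * S 0 * hDe
      rw [this]
      exact P.mul_mem_left _ (sub_mem (P.mul_mem_left _ hbP) (P.mul_mem_left _ haP))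
    rw [hlin]
    exact add_mem (P.mul_mem_left _ hS1) (P.mul_mem_left _ hS0)
  have hint : ∀ x ∈ Set.range (fun v => Ideal.Quotient.mk (artinianIdeal Δ p) (X v)),
      IsIntegral ℝ x := by
    rintro _ ⟨v, rfl⟩
    obtain ⟨n, hn⟩ := hrad v
    refine ⟨Polynomial.X ^ n, Polynomial.monic_X_pow n, ?_⟩
    rw [Polynomial.eval₂_X_pow, ← map_pow, Ideal.Quotient.eq_zero_iff_mem]
    exact hn
  have hfin := Algebra.finite_adjoin_of_finite_of_isIntegral (Set.finite_range _) hint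
  have htop : Algebra.adjoin ℝ (Set.range fun v => Ideal.Quotient.mk (artinianIdeal Δ p) (X v)) =
      ⊤ := by
    have h1 : (Set.range fun v => Ideal.Quotient.mk (artinianIdeal Δ p) (X v)) =
        Ideal.Quotient.mkₐ ℝ (artinianIdeal Δ p) '' Set.range X := by
      rw [← Set.range_comp]
      rfl
    rw [h1, ← AlgHom.map_adjoin, MvPolynomial.adjoin_range_X, Algebra.map_top,
      AlgHom.range_eq_top]
    exact Ideal.Quotient.mkₐ_surjective _ _
  rw [htop] at hfin
  exact Module.Finite.equiv Subalgebra.topEquiv.toLinearEquiv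

/-- The combinatorial count behind the failure of levelness: with colour classes of sizes `α`, `α`
and `γ`, there is a form outside the ideal in degree `u`, and a socle element in a positive degree
below `u`. -/
theorem IsColorComplex.not_level (hΔ : IsColorComplex κ Δ) (hy : IsGalePair p y₁ y₂) {α γ u : ℕ}
    (h0 : colorCard κ 0 = α) (h1 : colorCard κ 1 = α) (h2 : colorCard κ 2 = γ)
    (hα : 2 ≤ α) (hγα : γ ≤ α) (hu1 : 2 * (u + 1 - α) + (u + 1 - γ) < u + 1)
    (hu2 : u + 2 < 2 * (u + 2 - α) + (u + 2 - γ))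
    (hab : ∀ a b, κ a = 0 → κ b = 1 → y₁ a * y₂ b - y₁ b * y₂ a ≠ 0)
    (hne : colorForm κ y₁ y₂ 2 ≠ 0)
    (hrel : ∀ (a b : ℝ) (R : Polynomial ℝ), Polynomial.C a * colorForm κ y₁ y₂ 0 +
      Polynomial.C b * colorForm κ y₁ y₂ 1 = R * colorForm κ y₁ y₂ 2 → a = 0 ∧ b = 0) :
    Module.Finite ℝ (ringA Δ p) ∧ ¬ IsLevel (artinianIdeal Δ p) ∧ ¬ StressReconstruction Δ p u := by
  have hfin := hΔ.finite_ringA hy hab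
  have hdeg : ∀ (i : Fin 3) (e : ℕ), colorCard κ i = e →
      (colorForm κ y₁ y₂ i).natDegree ≤ e := by
    rintro i _ rfl
    exact natDegree_colorForm_le κ y₁ y₂ i
  obtain ⟨j, hj1, hj2, w, hw, hw1, hw2, hw3⟩ := exists_socle_form (hdeg 0 α h0) (hdeg 1 α h1)
    (hdeg 2 γ h2) (by omega) hγα hne hrel hu2
  obtain ⟨W, hW, hWw⟩ := hy.exists_lift hw
  have hWI : W ∉ artinianIdeal Δ p := by
    intro hmem
    have := hΔ.galeHom_mem_of_mem_artinianIdeal hy.left hy.right h0 h1 h2 hmem j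
    rw [homogeneousComponent_eq_self hW, hWw] at this
    exact hw1 this
  have hWX : ∀ v, W * X v ∈ artinianIdeal Δ p := by
    intro v
    refine hΔ.mem_artinianIdeal_of_galeHom_mem hy h0 h1 h2 (hW.mul (isHomogeneous_X ℝ v)) ?_
    rw [map_mul, hWw, galeHom_X, galeForm]
    have : w * (Polynomial.C (y₁ v) + Polynomial.C (y₂ v) * Polynomial.X) =
        y₁ v • w + y₂ v • (Polynomial.X * w) := by
      simp only [Polynomial.smul_eq_C_mul]
      ring
    rw [this]
    exact add_mem (Submodule.smul_mem _ _ hw2) (Submodule.smul_mem _ _ hw3)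
  obtain ⟨q, hq, hq'⟩ := exists_notMem_relSpace (colorForm κ y₁ y₂ 0) (colorForm κ y₁ y₂ 1)
    (colorForm κ y₁ y₂ 2) hu1
  obtain ⟨F, hF, hFq⟩ := hy.exists_lift hq
  have hFI : F ∉ artinianIdeal Δ p := by
    intro hmem
    have := hΔ.galeHom_mem_of_mem_artinianIdeal hy.left hy.right h0 h1 h2 hmem u
    rw [homogeneousComponent_eq_self hF, hFq] at this
    exact hq' this
  exact ⟨hfin, not_isLevel_of_socle _ hj2 hW hWI hWX hF hFI,
    not_stressReconstruction_of_socle (by omega) hj2 hW hWI hWX⟩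

end Main

end SphereStress

namespace SphereStress

/-! ### Natural embeddings -/

section Monotone

open Polynomial

variable {ι : Type*}

theorem eval_derivative_prod_linear (s : Finset ι) (a b : ι → ℝ) (x : ℝ)
    (h : ∀ i ∈ s, a i + b i * x ≠ 0) :
    (derivative (∏ i ∈ s, (C (a i) + C (b i) * X))).eval x =
      (∏ i ∈ s, (a i + b i * x)) * ∑ i ∈ s, b i / (a i + b i * x) := by
  classical
  induction s using Finset.induction_on with
  | empty => simp
  | insert i s hi ih =>
    rw [Finset.prod_insert hi, Finset.prod_insert hi, Finset.sum_insert hi, derivative_mul,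
      eval_add, eval_mul, eval_mul, ih fun j hj => h j (Finset.mem_insert_of_mem hj), eval_prod]
    have hi0 := h i (Finset.mem_insert_self i s)
    simp only [derivative_add, derivative_C, derivative_C_mul, derivative_X, mul_one, zero_add,
      eval_C, eval_add, eval_mul, eval_X]
    rw [mul_add, mul_right_comm (a i + b i * x), mul_div_cancel₀ _ hi0]
    ring

theorem eq_zero_of_two_equations {a b f₁ g₁ f₂ g₂ : ℝ} (h₁ : a * f₁ + b * g₁ = 0)
    (h₂ : a * f₂ + b * g₂ = 0) (hdet : f₁ * g₂ - f₂ * g₁ ≠ 0) : a = 0 ∧ b = 0 := by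
  constructor
  · have : a * (f₁ * g₂ - f₂ * g₁) = 0 := by linear_combination g₂ * h₁ - g₁ * h₂
    exact (mul_eq_zero.1 this).resolve_right hdet
  · have : b * (f₁ * g₂ - f₂ * g₁) = 0 := by linear_combination f₁ * h₂ - f₂ * h₁
    exact (mul_eq_zero.1 this).resolve_right hdet

variable [Fintype ι] [Nonempty ι]

theorem prod_mul_prod_ne_of_lt {a b a' b' : ι → ℝ} (hneg : ∀ i, a i * b' i - b i * a' i < 0)
    {x₁ x₂ : ℝ} (hx : x₁ < x₂) (h2 : ∀ i, 0 < a i + b i * x₂) (h1' : ∀ i, a' i + b' i * x₁ < 0) :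
    (∏ i, (a i + b i * x₁)) * (∏ i, (a' i + b' i * x₂)) -
      (∏ i, (a i + b i * x₂)) * (∏ i, (a' i + b' i * x₁)) ≠ 0 := by
  have hlt : ∏ i, ((a i + b i * x₂) * (-(a' i + b' i * x₁))) <
      ∏ i, ((a i + b i * x₁) * (-(a' i + b' i * x₂))) := by
    refine Finset.prod_lt_prod_of_nonempty (fun i _ => ?_) (fun i _ => ?_) Finset.univ_nonempty
    · exact mul_pos (h2 i) (neg_pos.2 (h1' i))
    · have := mul_neg_of_neg_of_pos (hneg i) (sub_pos.2 hx)
      nlinarith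
  rw [Finset.prod_mul_distrib, Finset.prod_mul_distrib, Finset.prod_neg, Finset.prod_neg] at hlt
  intro h
  have : (∏ i, (a i + b i * x₁)) * (∏ i, (a' i + b' i * x₂)) =
      (∏ i, (a i + b i * x₂)) * (∏ i, (a' i + b' i * x₁)) := by linarith
  refine hlt.ne ?_
  linear_combination -(-1) ^ (Finset.univ : Finset ι).card * this

/-- Let `f` and `g` be products of equally many linear forms, positive and negative respectively
at `x₁` and `x₂`. If `f / g` is strictly monotone between these points, as the sign condition on
the determinants says, then no nontrivial combination of `f` and `g` vanishes at both points (to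
second order, if they coincide). -/
theorem eq_zero_of_dvd_combination {a b a' b' : ι → ℝ}
    (hneg : ∀ i, a i * b' i - b i * a' i < 0) {x₁ x₂ : ℝ}
    (h1 : ∀ i, 0 < a i + b i * x₁) (h2 : ∀ i, 0 < a i + b i * x₂)
    (h1' : ∀ i, a' i + b' i * x₁ < 0) (h2' : ∀ i, a' i + b' i * x₂ < 0) {r s : ℝ}
    (hdvd : (X - C x₁) * (X - C x₂) ∣
      C r * (∏ i, (C (a i) + C (b i) * X)) + C s * (∏ i, (C (a' i) + C (b' i) * X))) :
    r = 0 ∧ s = 0 := by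
  obtain ⟨T, hT⟩ := hdvd
  have hev : ∀ x, (x - x₁) * (x - x₂) = 0 →
      r * (∏ i, (a i + b i * x)) + s * (∏ i, (a' i + b' i * x)) = 0 := by
    intro x hx
    have := congrArg (eval x) hT
    simp only [eval_add, eval_mul, eval_C, eval_prod, eval_X, eval_sub, hx, zero_mul] at this
    exact this
  have e1 := hev x₁ (by ring)
  have e2 := hev x₂ (by ring)
  rcases lt_trichotomy x₁ x₂ with hlt | rfl | hlt
  · exact eq_zero_of_two_equations e1 e2 (prod_mul_prod_ne_of_lt hneg hlt h2 h1')
  · have hd := congrArg (fun q => eval x₁ (derivative q)) hT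
    simp only [derivative_add, derivative_C, derivative_mul, eval_add, eval_mul, eval_C,
      derivative_X_sub_C, eval_one, eval_sub, eval_X, sub_self, mul_zero, zero_mul, add_zero,
      zero_add, one_mul, eval_derivative_prod_linear Finset.univ a b x₁ fun i _ => (h1 i).ne',
      eval_derivative_prod_linear Finset.univ a' b' x₁ fun i _ => (h1' i).ne] at hd
    refine eq_zero_of_two_equations e1 hd ?_
    have hlt : ∑ i, b i / (a i + b i * x₁) < ∑ i, b' i / (a' i + b' i * x₁) := by
      refine Finset.sum_lt_sum_of_nonempty Finset.univ_nonempty fun i _ => ?_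
      rw [← sub_neg, div_sub_div _ _ (h1 i).ne' (h1' i).ne]
      refine div_neg_of_pos_of_neg ?_ (mul_neg_of_pos_of_neg (h1 i) (h1' i))
      have := hneg i
      nlinarith
    have hf : (∏ i, (a i + b i * x₁)) ≠ 0 := Finset.prod_ne_zero_iff.2 fun i _ => (h1 i).ne'
    have hg : (∏ i, (a' i + b' i * x₁)) ≠ 0 := Finset.prod_ne_zero_iff.2 fun i _ => (h1' i).ne
    have : (∏ i, (a i + b i * x₁)) *
        ((∏ i, (a' i + b' i * x₁)) * ∑ i, b' i / (a' i + b' i * x₁)) -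
        (∏ i, (a i + b i * x₁)) * (∑ i, b i / (a i + b i * x₁)) * (∏ i, (a' i + b' i * x₁)) =
        (∏ i, (a i + b i * x₁)) * (∏ i, (a' i + b' i * x₁)) *
        (∑ i, b' i / (a' i + b' i * x₁) - ∑ i, b i / (a i + b i * x₁)) := by ring
    rw [this]
    exact mul_ne_zero (mul_ne_zero hf hg) (sub_pos.2 hlt).ne'
  · exact eq_zero_of_two_equations e2 e1 (prod_mul_prod_ne_of_lt hneg hlt h1 h2')

end Monotone

section Natural

variable {V : Type*} [Fintype V] {d : ℕ}

/-- The linear map whose kernel is the space of affine dependencies. -/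
noncomputable def dependencyMap (p : V → Fin d → ℝ) : (V → ℝ) →ₗ[ℝ] (Fin d → ℝ) × ℝ :=
  LinearMap.prod (∑ v, (LinearMap.proj v : (V → ℝ) →ₗ[ℝ] ℝ).smulRight (p v))
    (∑ v, LinearMap.proj v)

theorem dependencyMap_apply (p : V → Fin d → ℝ) (y : V → ℝ) :
    dependencyMap p y = (∑ v, y v • p v, ∑ v, y v) := by
  simp [dependencyMap]

theorem mem_ker_dependencyMap {p : V → Fin d → ℝ} {y : V → ℝ} :
    y ∈ LinearMap.ker (dependencyMap p) ↔ IsAffineDependency p y := by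
  rw [LinearMap.mem_ker, dependencyMap_apply, Prod.mk_eq_zero]
  rfl

theorem finrank_ker_dependencyMap {p : V → Fin d → ℝ} (hp : affineSpan ℝ (Set.range p) = ⊤) :
    Module.finrank ℝ (LinearMap.ker (dependencyMap p)) + (d + 1) = Fintype.card V := by
  have h1 : ∀ x, (x, (1 : ℝ)) ∈ LinearMap.range (dependencyMap p) := by
    intro x
    have hx : x ∈ affineSpan ℝ (Set.range p) := by
      rw [hp]
      trivial
    obtain ⟨w, hw, rfl⟩ := eq_affineCombination_of_mem_affineSpan_of_fintype hx
    refine ⟨w, ?_⟩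
    rw [dependencyMap_apply, hw, Finset.affineCombination_eq_linear_combination _ _ _ hw]
  have hsurj : LinearMap.range (dependencyMap p) = ⊤ := by
    rw [eq_top_iff]
    rintro ⟨x, r⟩ -
    have : ((x, r) : (Fin d → ℝ) × ℝ) = (x, 1) + (r - 1) • (0, 1) := by
      ext <;> simp
    rw [this]
    exact add_mem (h1 x) (Submodule.smul_mem _ _ (h1 0))
  have h2 := LinearMap.finrank_range_add_finrank_ker (dependencyMap p)
  rw [hsurj, finrank_top, Module.finrank_prod, Module.finrank_fintype_fun_eq_card,
    Module.finrank_fintype_fun_eq_card, Module.finrank_self, Fintype.card_fin] at h2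
  omega

/-- If the space of affine dependencies is a plane on which evaluation at `v` and `w` is injective,
it has a basis dual to these evaluations, up to a sign. -/
theorem exists_galePair {p : V → Fin d → ℝ} (hp : affineSpan ℝ (Set.range p) = ⊤)
    (hd : Fintype.card V = d + 3) (v w : V)
    (hinj : ∀ y, IsAffineDependency p y → y v = 0 → y w = 0 → y = 0) :
    ∃ y₁ y₂, IsGalePair p y₁ y₂ ∧ y₁ v = 1 ∧ y₁ w = 0 ∧ y₂ v = 0 ∧ y₂ w = -1 := by
  let E : ↥(LinearMap.ker (dependencyMap p)) →ₗ[ℝ] ℝ × ℝ :=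
    (LinearMap.prod (LinearMap.proj v : (V → ℝ) →ₗ[ℝ] ℝ) (LinearMap.proj w)).domRestrict _
  have hE : Function.Injective E := by
    rw [← LinearMap.ker_eq_bot, LinearMap.ker_eq_bot']
    rintro ⟨y, hy⟩ h
    have h1 : y v = 0 := congrArg Prod.fst h
    have h2 : y w = 0 := congrArg Prod.snd h
    exact Subtype.ext (hinj y (mem_ker_dependencyMap.1 hy) h1 h2)
  have hfr : Module.finrank ℝ ↥(LinearMap.ker (dependencyMap p)) = Module.finrank ℝ (ℝ × ℝ) := by
    have := finrank_ker_dependencyMap hp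
    rw [Module.finrank_prod, Module.finrank_self]
    omega
  have hsurj := (LinearMap.injective_iff_surjective_of_finrank_eq_finrank hfr).1 hE
  obtain ⟨⟨y₁, hy₁⟩, h1⟩ := hsurj (1, 0)
  obtain ⟨⟨y₂, hy₂⟩, h2⟩ := hsurj (0, -1)
  have h1v : y₁ v = 1 := congrArg Prod.fst h1
  have h1w : y₁ w = 0 := congrArg Prod.snd h1
  have h2v : y₂ v = 0 := congrArg Prod.fst h2
  have h2w : y₂ w = -1 := congrArg Prod.snd h2
  refine ⟨y₁, y₂, ⟨mem_ker_dependencyMap.1 hy₁, mem_ker_dependencyMap.1 hy₂, fun y hy => ?_,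
    fun s t h => ?_⟩, h1v, h1w, h2v, h2w⟩
  · refine ⟨y v, -y w, ?_⟩
    rw [← sub_eq_zero]
    apply hinj
    · rw [← mem_ker_dependencyMap] at hy ⊢
      exact sub_mem hy (add_mem (Submodule.smul_mem _ _ hy₁) (Submodule.smul_mem _ _ hy₂))
    · simp [h1v, h2v]
    · simp [h1w, h2w]
  · have hv := congrFun h v
    have hw := congrFun h w
    simp [h1v, h2v] at hv
    simp [h1w, h2w] at hw
    exact ⟨hv, hw⟩

variable [DecidableEq V] {κ : V → Fin 3} {Δ : AbstractSimplicialComplex V} {p : V → Fin d → ℝ}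

/-- The facet missing `a`, `b`, `c` is exposed by an affine functional, whose values at `a`, `b`,
`c` are the coefficients of a positive relation between the Gale vectors. -/
theorem IsNaturalEmbedding.exists_positive_relation (hΔ : IsColorComplex κ Δ)
    (hp : IsNaturalEmbedding Δ p) (hd : Fintype.card V = d + 3) (hd0 : 1 ≤ d) {a b c : V}
    (ha : κ a = 0) (hb : κ b = 1) (hc : κ c = 2) :
    (∃ r s t : ℝ, 0 < r ∧ 0 < s ∧ 0 < t ∧
      ∀ y, IsAffineDependency p y → r * y a + s * y b + t * y c = 0) ∧
    ∀ y, IsAffineDependency p y → y a = 0 → y b = 0 → y c = 0 → y = 0 := by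
  have hab : a ≠ b := fun h => by simp [h, hb] at ha
  have hac : a ≠ c := fun h => by simp [h, hc] at ha
  have hbc : b ≠ c := fun h => by simp [h, hc] at hb
  set s : Finset V := ({a, b, c} : Finset V)ᶜ with hs
  have hmem : ∀ v, v ∉ s ↔ v = a ∨ v = b ∨ v = c := by
    intro v
    rw [hs, Finset.mem_compl, not_not]
    simp
  have hcard : ({a, b, c} : Finset V).card = 3 := by
    rw [Finset.card_eq_three]
    exact ⟨a, b, c, hab, hac, hbc, rfl⟩
  have hne : s.Nonempty := by
    rw [← Finset.card_pos, hs, Finset.card_compl, hcard]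
    omega
  have hface : s ∈ Δ.faces := by
    rw [mem_faces_iff_mem_allFaces _ hne, hΔ]
    intro i
    fin_cases i
    · exact ⟨a, by simp [hmem], ha⟩
    · exact ⟨b, by simp [hmem], hb⟩
    · exact ⟨c, by simp [hmem], hc⟩
  obtain ⟨w, hw⟩ := hne
  have hsum : ∀ f : V → ℝ, (∀ v ∈ s, f v = 0) → ∑ v, f v = f a + f b + f c := by
    intro f hf
    rw [← Finset.sum_subset (Finset.subset_univ ({a, b, c} : Finset V)),
      Finset.sum_insert (by simp [hab, hac]), Finset.sum_insert (by simp [hbc]),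
      Finset.sum_singleton, add_assoc]
    intro v _ hv
    exact hf v (by simpa [hs] using hv)
  constructor
  · obtain ⟨hexp, -⟩ := (hp.mem_faces_iff s ⟨w, hw⟩).1 hface
    have hwC : p w ∈ convexHull ℝ (p '' (s : Set V)) := subset_convexHull ℝ _ ⟨w, hw, rfl⟩
    obtain ⟨l, hl⟩ := hexp ⟨p w, hwC⟩
    have hP : ∀ v, p v ∈ convexHull ℝ (Set.range p) := fun v => subset_convexHull ℝ _ ⟨v, rfl⟩
    have hle : ∀ v, l (p v) ≤ l (p w) := by
      intro v
      rw [hl] at hwC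
      exact hwC.2 _ (hP v)
    have heq : ∀ v ∈ s, l (p v) = l (p w) := by
      intro v hv
      refine le_antisymm (hle v) ?_
      have : p v ∈ convexHull ℝ (p '' (s : Set V)) := subset_convexHull ℝ _ ⟨v, hv, rfl⟩
      rw [hl] at this
      exact this.2 _ (hP w)
    have hlt : ∀ v ∉ s, 0 < l (p w) - l (p v) := by
      intro v hv
      rw [sub_pos]
      refine lt_of_le_of_ne (hle v) fun h => hv ?_
      have : p v ∈ convexHull ℝ (p '' (s : Set V)) := by
        rw [hl] at hwC ⊢
        exact ⟨hP v, fun y hy => by rw [h]; exact hwC.2 y hy⟩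
      exact hp.convexIndependent s v this
    refine ⟨_, _, _, hlt a (by simp [hmem]), hlt b (by simp [hmem]), hlt c (by simp [hmem]),
      fun y hy => ?_⟩
    rw [← hsum fun v => (l (p w) - l (p v)) * y v]
    · have h1 : ∑ v, l (p v) * y v = 0 := by
        have := congrArg l hy.1
        simp only [map_sum, map_smul, smul_eq_mul, map_zero] at this
        rw [← this]
        exact Finset.sum_congr rfl fun v _ => mul_comm _ _
      simp only [sub_mul, Finset.sum_sub_distrib, ← Finset.mul_sum, hy.2, h1, mul_zero, sub_zero]
    · intro v hv
      rw [heq v hv, sub_self, zero_mul]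
  · intro y hy hya hyb hyc
    have hoff : ∀ v ∉ s, y v = 0 := by
      intro v hv
      rcases (hmem v).1 hv with rfl | rfl | rfl <;> assumption
    have hind := affineIndependent_iff.1 (hp.affineIndependent s hface) Finset.univ (fun v => y v)
    have h1 : ∑ v : s, y v = 0 := by
      rw [Finset.sum_coe_sort s y, Finset.sum_subset (Finset.subset_univ s)]
      · exact hy.2
      · exact fun v _ hv => hoff v hv
    have h2 : ∑ v : s, y v • p v = 0 := by
      rw [Finset.sum_coe_sort s fun v => y v • p v, Finset.sum_subset (Finset.subset_univ s)]
      · exact hy.1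
      · intro v _ hv
        rw [hoff v hv, zero_smul]
    funext v
    by_cases hv : v ∈ s
    · exact hind h1 h2 ⟨v, hv⟩ (Finset.mem_univ _)
    · exact hoff v hv

/-- The Gale transform of a natural embedding has the properties needed for the failure of
levelness. By the positive relations, at every root of the form of colour `2` the linear forms of
colour `0` are positive and those of colour `1` are negative, and the determinants of vectors of
these two colours all have the same sign. Hence the quotient of the forms of colours `0` and `1` is
strictly monotone between two such roots. -/
theorem IsNaturalEmbedding.exists_galePair (hΔ : IsColorComplex κ Δ)
    (hp : IsNaturalEmbedding Δ p) (hd : Fintype.card V = d + 3) (hd0 : 1 ≤ d)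
    (h01 : colorCard κ 0 = colorCard κ 1) (h2 : 2 ≤ colorCard κ 2) :
    ∃ y₁ y₂, IsGalePair p y₁ y₂ ∧ (∀ a b, κ a = 0 → κ b = 1 → y₁ a * y₂ b - y₁ b * y₂ a ≠ 0) ∧
      colorForm κ y₁ y₂ 2 ≠ 0 ∧ ∀ (r s : ℝ) (R : Polynomial ℝ),
        Polynomial.C r * colorForm κ y₁ y₂ 0 + Polynomial.C s * colorForm κ y₁ y₂ 1 =
          R * colorForm κ y₁ y₂ 2 → r = 0 ∧ s = 0 := by
  obtain ⟨a₀, -, ha₀⟩ := (hΔ ∅).1 (Or.inl rfl) 0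
  obtain ⟨b₀, -, hb₀⟩ := (hΔ ∅).1 (Or.inl rfl) 1
  obtain ⟨c₀, -, hc₀⟩ := (hΔ ∅).1 (Or.inl rfl) 2
  have hpos : ∀ {a b c : V}, κ a = 0 → κ b = 1 → κ c = 2 → ∃ r s t : ℝ, 0 < r ∧ 0 < s ∧ 0 < t ∧
      ∀ y, IsAffineDependency p y → r * y a + s * y b + t * y c = 0 := fun ha hb hc =>
    (hp.exists_positive_relation hΔ hd hd0 ha hb hc).1
  have hsgn : ∀ {r s x y : ℝ}, 0 < r → 0 < s → r * x + s * y = 0 → (0 < x ↔ y < 0) := by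
    intro r s x y hr hs h
    constructor
    · intro hx
      have := mul_pos hr hx
      exact neg_of_mul_neg_right (by linarith : s * y < 0) hs.le
    · intro hy
      have := mul_neg_of_pos_of_neg hs hy
      exact pos_of_mul_pos_right (by linarith : 0 < r * x) hr.le
  -- a dependency vanishing at one of three vertices of different colours has opposite signs at
  -- the other two
  have hzero_a : ∀ {a b c : V}, κ a = 0 → κ b = 1 → κ c = 2 → ∀ y, IsAffineDependency p y →
      y a = 0 → (0 < y c ↔ y b < 0) := by
    intro a b c ha hb hc y hy h0
    obtain ⟨r, s, t, hr, hs, ht, h⟩ := hpos ha hb hc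
    exact hsgn ht hs (by linear_combination h y hy - r * h0)
  have hzero_b : ∀ {a b c : V}, κ a = 0 → κ b = 1 → κ c = 2 → ∀ y, IsAffineDependency p y →
      y b = 0 → (0 < y a ↔ y c < 0) := by
    intro a b c ha hb hc y hy h0
    obtain ⟨r, s, t, hr, hs, ht, h⟩ := hpos ha hb hc
    exact hsgn hr ht (by linear_combination h y hy - s * h0)
  have hzero_c : ∀ {a b c : V}, κ a = 0 → κ b = 1 → κ c = 2 → ∀ y, IsAffineDependency p y →
      y c = 0 → (0 < y a ↔ y b < 0) := by
    intro a b c ha hb hc y hy h0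
    obtain ⟨r, s, t, hr, hs, ht, h⟩ := hpos ha hb hc
    exact hsgn hr hs (by linear_combination h y hy - t * h0)
  have hinj : ∀ y, IsAffineDependency p y → y a₀ = 0 → y b₀ = 0 → y = 0 := by
    intro y hy ha hb
    obtain ⟨r, s, t, -, -, ht, h⟩ := hpos ha₀ hb₀ hc₀
    have := h y hy
    rw [ha, hb, mul_zero, mul_zero, zero_add, zero_add] at this
    exact (hp.exists_positive_relation hΔ hd hd0 ha₀ hb₀ hc₀).2 y hy ha hb
      ((mul_eq_zero.1 this).resolve_left ht.ne')
  obtain ⟨y₁, y₂, hy, h1a, h1b, h2a, h2b⟩ := SphereStress.exists_galePair hp.affineSpan_eq_top hd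
    a₀ b₀ hinj
  have hdep : ∀ r s : ℝ, IsAffineDependency p (r • y₁ + s • y₂) := by
    intro r s
    rw [← mem_ker_dependencyMap]
    exact add_mem (Submodule.smul_mem _ _ (mem_ker_dependencyMap.2 hy.left))
      (Submodule.smul_mem _ _ (mem_ker_dependencyMap.2 hy.right))
  have h2c : ∀ c, κ c = 2 → 0 < y₂ c := fun c hc =>
    (hzero_a ha₀ hb₀ hc y₂ hy.right h2a).2 (by rw [h2b]; exact neg_one_lt_zero)
  let x : V → ℝ := fun c => -y₁ c / y₂ c
  have hx : ∀ c, κ c = 2 → y₁ c + y₂ c * x c = 0 := by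
    intro c hc
    have := (h2c c hc).ne'
    simp only [x]
    field_simp
    ring
  have hxb : ∀ b c, κ b = 1 → κ c = 2 → y₁ b + y₂ b * x c < 0 := by
    intro b c hb hc
    have := (hzero_c ha₀ hb hc ((1 : ℝ) • y₁ + x c • y₂) (hdep _ _) (by
      simpa [mul_comm] using hx c hc)).1 (by simp [h1a, h2a])
    simpa [mul_comm] using this
  have hxa : ∀ a c, κ a = 0 → κ c = 2 → 0 < y₁ a + y₂ a * x c := by
    intro a c ha hc
    have := (hzero_c ha hb₀ hc ((1 : ℝ) • y₁ + x c • y₂) (hdep _ _) (by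
      simpa [mul_comm] using hx c hc)).2 (by simpa [mul_comm] using hxb b₀ c hb₀ hc)
    simpa [mul_comm] using this
  have hneg : ∀ a b, κ a = 0 → κ b = 1 → y₁ a * y₂ b - y₂ a * y₁ b < 0 := by
    intro a b ha hb
    have := (hzero_a ha hb hc₀ ((-y₂ a) • y₁ + y₁ a • y₂) (hdep _ _) (by
      simp; ring)).1 (by
        have h := mul_pos (h2c c₀ hc₀) (hxa a c₀ ha hc₀)
        have h' := hx c₀ hc₀
        simp only [Pi.add_apply, Pi.smul_apply, smul_eq_mul]
        linear_combination h + y₂ a * h')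
    simp only [Pi.add_apply, Pi.smul_apply, smul_eq_mul] at this
    linarith
  have hform : ∀ c, κ c = 2 →
      galeForm y₁ y₂ c = Polynomial.C (y₂ c) * (Polynomial.X - Polynomial.C (x c)) := by
    intro c hc
    have := congrArg (Polynomial.C : ℝ → Polynomial ℝ) (hx c hc)
    simp only [Polynomial.C_add, Polynomial.C_mul, Polynomial.C_0] at this
    rw [galeForm]
    linear_combination this
  refine ⟨y₁, y₂, hy, fun a b ha hb => ?_, ?_, fun r s R hR => ?_⟩
  · have := hneg a b ha hb
    rw [mul_comm (y₁ b)]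
    exact this.ne
  · rw [colorForm, Finset.prod_ne_zero_iff]
    intro c hc
    have hc : κ c = 2 := by simpa using hc
    rw [hform c hc]
    exact mul_ne_zero (Polynomial.C_ne_zero.2 (h2c c hc).ne') (Polynomial.X_sub_C_ne_zero _)
  · obtain ⟨c₁, hc₁, c₂, hc₂, hne⟩ := Finset.one_lt_card.1 (show 1 < (Finset.univ.filter
      fun v => κ v = 2).card from h2)
    have hdvd : (Polynomial.X - Polynomial.C (x c₁)) * (Polynomial.X - Polynomial.C (x c₂)) ∣
        colorForm κ y₁ y₂ 2 := by
      rw [colorForm, ← Finset.mul_prod_erase _ _ hc₁,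
        ← Finset.mul_prod_erase _ _ (Finset.mem_erase.2 ⟨Ne.symm hne, hc₂⟩), ← mul_assoc]
      refine Dvd.dvd.mul_right (mul_dvd_mul ?_ ?_) _
      · rw [hform c₁ (by simpa using hc₁)]
        exact Dvd.intro_left _ rfl
      · rw [hform c₂ (by simpa using hc₂)]
        exact Dvd.intro_left _ rfl
    rw [Finset.mem_filter] at hc₁ hc₂
    let e := Finset.equivOfCardEq h01
    have hs0 : ∀ i : (Finset.univ.filter fun v => κ v = 0 : Finset V), κ i = 0 := fun i =>
      (Finset.mem_filter.1 i.2).2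
    have hs1 : ∀ i : (Finset.univ.filter fun v => κ v = 1 : Finset V), κ i = 1 := fun i =>
      (Finset.mem_filter.1 i.2).2
    have hf : colorForm κ y₁ y₂ 0 = ∏ i : (Finset.univ.filter fun v => κ v = 0 : Finset V),
        galeForm y₁ y₂ i := (Finset.prod_coe_sort _ _).symm
    have hg : colorForm κ y₁ y₂ 1 = ∏ i : (Finset.univ.filter fun v => κ v = 0 : Finset V),
        galeForm y₁ y₂ (e i) := by
      rw [Equiv.prod_comp e fun i => galeForm y₁ y₂ i]
      exact (Finset.prod_coe_sort _ _).symm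
    have : Nonempty (Finset.univ.filter fun v => κ v = 0 : Finset V) := ⟨⟨a₀, by simpa using ha₀⟩⟩
    refine eq_zero_of_dvd_combination (x₁ := x c₁) (x₂ := x c₂)
      (fun i => hneg _ _ (hs0 i) (hs1 (e i))) (fun i => hxa _ _ (hs0 i) hc₁.2)
      (fun i => hxa _ _ (hs0 i) hc₂.2) (fun i => hxb _ _ (hs1 (e i)) hc₁.2)
      (fun i => hxb _ _ (hs1 (e i)) hc₂.2) ?_
    have h3 : Polynomial.C r * colorForm κ y₁ y₂ 0 + Polynomial.C s * colorForm κ y₁ y₂ 1 =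
        R * colorForm κ y₁ y₂ 2 := hR
    rw [hf, hg] at h3
    simp only [galeForm] at h3
    rw [h3]
    exact Dvd.dvd.mul_left hdvd R

end Natural

/-! ### Generic embeddings -/

section Bracket

variable {V : Type*} [Fintype V] [DecidableEq V] {d : ℕ} {k : Type*} [CommRing k]

/-- The square matrix whose rows are the coordinate functions of the configuration `q`, the constant
function `1`, and the functions `f` and `g`. -/
def bracketMatrix (e : V ≃ Fin d ⊕ Fin 3) (q : V → Fin d → k) (f g : V → k) : Matrix V V k :=
  Matrix.of fun r x => Sum.elim (fun j => q x j) (fun i => ![1, f x, g x] i) (e r)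

/-- The determinant of the coordinate functions of `q`, the constant function `1` and the indicators
of `v` and `w`. As a function of `v` it is an affine dependency of `q`. -/
def bracket (e : V ≃ Fin d ⊕ Fin 3) (q : V → Fin d → k) (v w : V) : k :=
  (bracketMatrix e q (Pi.single v 1) (Pi.single w 1)).det

theorem map_bracket {k' : Type*} [CommRing k'] (φ : k →+* k') (e : V ≃ Fin d ⊕ Fin 3)
    (q : V → Fin d → k) (v w : V) :
    φ (bracket e q v w) = bracket e (fun x j => φ (q x j)) v w := by
  rw [bracket, bracket, RingHom.map_det]
  congr 1
  ext r x
  simp only [bracketMatrix, RingHom.mapMatrix_apply, Matrix.map_apply, Matrix.of_apply]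
  rcases e r with j | i
  · rfl
  · fin_cases i <;> simp [Pi.single_apply, apply_ite φ]

theorem sum_mul_bracket (e : V ≃ Fin d ⊕ Fin 3) (q : V → Fin d → k) (f : V → k) (w : V) :
    ∑ v, f v * bracket e q v w = (bracketMatrix e q f (Pi.single w 1)).det := by
  set r := e.symm (Sum.inr 1) with hr
  let L : (V → k) →ₗ[k] k :=
    { toFun := fun f => ((bracketMatrix e q 0 (Pi.single w 1)).updateRow r f).det
      map_add' := fun f g => Matrix.det_updateRow_add _ _ _ _
      map_smul' := fun a f => Matrix.det_updateRow_smul _ _ _ _ }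
  have hL : ∀ f, (bracketMatrix e q f (Pi.single w 1)).det = L f := by
    intro f
    change _ = ((bracketMatrix e q 0 (Pi.single w 1)).updateRow r f).det
    congr 1
    ext x y
    by_cases hx : x = r
    · subst hx
      rw [Matrix.updateRow_self]
      simp [bracketMatrix, hr]
    · rw [Matrix.updateRow_ne hx]
      simp only [bracketMatrix, Matrix.of_apply]
      have hne : e x ≠ Sum.inr 1 := fun h => hx (by rw [hr, ← h, Equiv.symm_apply_apply])
      revert hne
      rcases e x with j | i
      · intro _
        rfl
      · fin_cases i <;> simp
  rw [hL f]
  conv_rhs => rw [pi_eq_sum_univ' f]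
  rw [map_sum]
  refine Finset.sum_congr rfl fun v _ => ?_
  rw [map_smul, smul_eq_mul, ← hL]
  rfl

theorem bracket_self (e : V ≃ Fin d ⊕ Fin 3) (q : V → Fin d → k) (v : V) :
    bracket e q v v = 0 := by
  refine Matrix.det_zero_of_row_eq (i := e.symm (Sum.inr 1)) (j := e.symm (Sum.inr 2)) (by simp) ?_
  funext x
  simp [bracketMatrix]

theorem isAffineDependency_bracket (e : V ≃ Fin d ⊕ Fin 3) (p : V → Fin d → ℝ) (w : V) :
    IsAffineDependency p fun v => bracket e p v w := by
  constructor
  · funext j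
    have := sum_mul_bracket e p (fun v => p v j) w
    rw [Matrix.det_zero_of_row_eq (i := e.symm (Sum.inl j)) (j := e.symm (Sum.inr 1)) (by simp)
      (by funext x; simp [bracketMatrix])] at this
    rw [Finset.sum_apply, Pi.zero_apply, ← this]
    exact Finset.sum_congr rfl fun v _ => mul_comm _ _
  · have := sum_mul_bracket e p (fun _ => 1) w
    rw [Matrix.det_zero_of_row_eq (i := e.symm (Sum.inr 0)) (j := e.symm (Sum.inr 1)) (by simp)
      (by funext x; simp [bracketMatrix])] at this
    simpa using this

theorem bracket_ne_zero_iff (e : V ≃ Fin d ⊕ Fin 3) (p : V → Fin d → ℝ) (v w : V) :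
    bracket e p v w ≠ 0 ↔ ∀ y, IsAffineDependency p y → y v = 0 → y w = 0 → y = 0 := by
  have hker : ∀ y : V → ℝ, (bracketMatrix e p (Pi.single v 1) (Pi.single w 1)).mulVec y = 0 ↔
      IsAffineDependency p y ∧ y v = 0 ∧ y w = 0 := by
    intro y
    have h1 : (bracketMatrix e p (Pi.single v 1) (Pi.single w 1)).mulVec y = 0 ↔
        ∀ r, ∑ x, bracketMatrix e p (Pi.single v 1) (Pi.single w 1) (e.symm r) x * y x = 0 := by
      rw [funext_iff, ← e.symm.forall_congr_right]
      rfl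
    rw [h1, Sum.forall, Fin.forall_fin_succ, Fin.forall_fin_succ, Fin.forall_fin_succ]
    simp only [bracketMatrix, Matrix.of_apply, Equiv.apply_symm_apply, Sum.elim_inl, Sum.elim_inr]
    simp only [IsAffineDependency, funext_iff, Finset.sum_apply]
    simp [Pi.single_apply, mul_comm, and_assoc]
  rw [bracket, Ne, ← Matrix.exists_mulVec_eq_zero_iff]
  push Not
  constructor
  · intro h y hy h1 h2
    by_contra hne
    exact h y hne ((hker y).2 ⟨hy, h1, h2⟩)
  · intro h y hne hy
    obtain ⟨h1, h2, h3⟩ := (hker y).1 hy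
    exact hne (h y h1 h2 h3)

theorem isGalePair_bracket (e : V ≃ Fin d ⊕ Fin 3) (p : V → Fin d → ℝ) {v w : V}
    (h : bracket e p v w ≠ 0) :
    IsGalePair p (fun x => bracket e p x v) (fun x => bracket e p x w) := by
  have hinj := (bracket_ne_zero_iff e p v w).1 h
  have h' : bracket e p w v ≠ 0 :=
    (bracket_ne_zero_iff e p w v).2 fun y hy h1 h2 => hinj y hy h2 h1
  refine ⟨isAffineDependency_bracket e p v, isAffineDependency_bracket e p w, fun y hy => ?_,
    fun s t hst => ?_⟩
  · refine ⟨y w / bracket e p w v, y v / bracket e p v w, ?_⟩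
    rw [← sub_eq_zero]
    apply hinj
    · rw [← mem_ker_dependencyMap] at hy ⊢
      exact sub_mem hy (add_mem
        (Submodule.smul_mem _ _ (mem_ker_dependencyMap.2 (isAffineDependency_bracket e p v)))
        (Submodule.smul_mem _ _ (mem_ker_dependencyMap.2 (isAffineDependency_bracket e p w))))
    · simp [bracket_self, h]
    · simp [bracket_self, h']
  · have h1 := congrFun hst v
    have h2 := congrFun hst w
    simp [bracket_self, h] at h1
    simp [bracket_self, h'] at h2
    exact ⟨h2, h1⟩

end Bracket

section Generic

variable {V : Type*} [Fintype V] [DecidableEq V] {d : ℕ}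

/-- With Gale vectors given by the brackets with `w₁` and `w₂`, the value of the form of colour `i`
at the root of the linear form of `c`, up to a power of a coordinate of the Gale vector of `c`. -/
def colorValue {k : Type*} [CommRing k] (κ : V → Fin 3) (e : V ≃ Fin d ⊕ Fin 3) (w₁ w₂ : V)
    (q : V → Fin d → k) (i : Fin 3) (c : V) : k :=
  ∏ a with κ a = i, (bracket e q a w₁ * bracket e q c w₂ - bracket e q a w₂ * bracket e q c w₁)

/-- The determinant expressing that the forms of colours `0` and `1` have a nontrivial combination
vanishing at the roots of the linear forms of `c₁` and `c₂`. -/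
def colorDet {k : Type*} [CommRing k] (κ : V → Fin 3) (e : V ≃ Fin d ⊕ Fin 3) (w₁ w₂ c₁ c₂ : V)
    (q : V → Fin d → k) : k :=
  colorValue κ e w₁ w₂ q 0 c₁ * colorValue κ e w₁ w₂ q 1 c₂ -
    colorValue κ e w₁ w₂ q 0 c₂ * colorValue κ e w₁ w₂ q 1 c₁

theorem map_colorDet {k k' : Type*} [CommRing k] [CommRing k'] (φ : k →+* k') (κ : V → Fin 3)
    (e : V ≃ Fin d ⊕ Fin 3) (w₁ w₂ c₁ c₂ : V) (q : V → Fin d → k) :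
    φ (colorDet κ e w₁ w₂ c₁ c₂ q) = colorDet κ e w₁ w₂ c₁ c₂ fun x j => φ (q x j) := by
  simp only [colorDet, colorValue, map_sub, map_mul, map_prod, map_bracket]

/-- A polynomial in the coordinates that does not vanish at one configuration does not vanish at any
generic one. -/
theorem IsGenericEmbedding.aeval_ne_zero {V : Type*} {d : ℕ} {p : V → Fin d → ℝ}
    (hp : IsGenericEmbedding p) {t : MvPolynomial (V × Fin d) ℚ} {p₀ : V → Fin d → ℝ}
    (h : MvPolynomial.aeval (fun vj : V × Fin d => p₀ vj.1 vj.2) t ≠ 0) :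
    MvPolynomial.aeval (fun vj : V × Fin d => p vj.1 vj.2) t ≠ 0 := by
  intro h0
  refine h ?_
  have : t = 0 := (injective_iff_map_eq_zero _).1 hp t h0
  rw [this, map_zero]

/-- The generic configuration, with indeterminate coordinates. -/
noncomputable def genericConfig (V : Type*) (d : ℕ) : V → Fin d → MvPolynomial (V × Fin d) ℚ :=
  fun v j => MvPolynomial.X (v, j)

theorem IsGenericEmbedding.bracket_ne_zero {p : V → Fin d → ℝ} (hp : IsGenericEmbedding p)
    (e : V ≃ Fin d ⊕ Fin 3) {v w : V} {p₀ : V → Fin d → ℝ} (h : bracket e p₀ v w ≠ 0) :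
    bracket e p v w ≠ 0 := by
  have hT : ∀ q : V → Fin d → ℝ, MvPolynomial.aeval (fun vj : V × Fin d => q vj.1 vj.2)
      (bracket e (genericConfig V d) v w) = bracket e q v w := by
    intro q
    have := map_bracket (MvPolynomial.aeval (R := ℚ)
      fun vj : V × Fin d => q vj.1 vj.2).toRingHom e (genericConfig V d) v w
    simpa [genericConfig] using this
  rw [← hT] at h ⊢
  exact hp.aeval_ne_zero h

theorem IsGenericEmbedding.colorDet_ne_zero {p : V → Fin d → ℝ} (hp : IsGenericEmbedding p)
    {κ : V → Fin 3} (e : V ≃ Fin d ⊕ Fin 3) {w₁ w₂ c₁ c₂ : V} {p₀ : V → Fin d → ℝ}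
    (h : colorDet κ e w₁ w₂ c₁ c₂ p₀ ≠ 0) : colorDet κ e w₁ w₂ c₁ c₂ p ≠ 0 := by
  have hT : ∀ q : V → Fin d → ℝ, MvPolynomial.aeval (fun vj : V × Fin d => q vj.1 vj.2)
      (colorDet κ e w₁ w₂ c₁ c₂ (genericConfig V d)) = colorDet κ e w₁ w₂ c₁ c₂ q := by
    intro q
    have := map_colorDet (MvPolynomial.aeval (R := ℚ)
      fun vj : V × Fin d => q vj.1 vj.2).toRingHom κ e w₁ w₂ c₁ c₂ (genericConfig V d)
    simpa [genericConfig] using this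
  rw [← hT] at h ⊢
  exact hp.aeval_ne_zero h

/-- An indicator function corrected at `c` so that its values sum to zero. -/
def balanced (b : V → ℝ) (c : V) : V → ℝ := b - Pi.single c (∑ v, b v)

theorem sum_balanced (b : V → ℝ) (c : V) : ∑ v, balanced b c v = 0 := by
  simp [balanced]

theorem balanced_of_ne (b : V → ℝ) {c v : V} (h : v ≠ c) : balanced b c v = b v := by
  simp [balanced, h]

/-- A configuration for which the Gale vectors of colour `0` and of `c₁` are parallel, those of
colour `1` and of `c₂` are parallel, and these two directions differ from each other and from that
of the other vertices. -/
theorem exists_special_config {κ : V → Fin 3} (hd : Fintype.card V = d + 3) {a₀ b₀ c₁ c₂ c₃ : V}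
    (ha₀ : κ a₀ = 0) (hb₀ : κ b₀ = 1) (hc₁ : κ c₁ = 2) (hc₂ : κ c₂ = 2) (hc₃ : κ c₃ = 2)
    (h12 : c₁ ≠ c₂) (h13 : c₁ ≠ c₃) (h23 : c₂ ≠ c₃) :
    ∃ (p : V → Fin d → ℝ) (Y₁ Y₂ : V → ℝ),
      (∀ y, IsAffineDependency p y → ∃ s t : ℝ, y = s • Y₁ + t • Y₂) ∧
      (∀ a, κ a = 0 → Y₁ a = 1 ∧ Y₂ a = 0) ∧ (∀ b, κ b = 1 → Y₁ b = 0 ∧ Y₂ b = 1) ∧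
      (Y₁ c₁ ≠ 0 ∧ Y₂ c₁ = 0) ∧ (Y₁ c₂ = 0 ∧ Y₂ c₂ ≠ 0) ∧
      ∀ c, κ c = 2 → c ≠ c₁ → c ≠ c₂ → Y₁ c = 1 ∧ Y₂ c = 1 := by
  let b₁ : V → ℝ := fun v => if κ v = 0 ∨ (κ v = 2 ∧ v ≠ c₁ ∧ v ≠ c₂) then 1 else 0
  let b₂ : V → ℝ := fun v => if κ v = 1 ∨ (κ v = 2 ∧ v ≠ c₁ ∧ v ≠ c₂) then 1 else 0
  have hb₁ : 0 < ∑ v, b₁ v := by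
    refine Finset.sum_pos' (fun v _ => ?_) ⟨a₀, Finset.mem_univ _, ?_⟩
    · simp only [b₁]; split_ifs <;> norm_num
    · simp [b₁, ha₀]
  have hb₂ : 0 < ∑ v, b₂ v := by
    refine Finset.sum_pos' (fun v _ => ?_) ⟨b₀, Finset.mem_univ _, ?_⟩
    · simp only [b₂]; split_ifs <;> norm_num
    · simp [b₂, hb₀]
  set Y₁ := balanced b₁ c₁ with hY₁
  set Y₂ := balanced b₂ c₂ with hY₂
  have hA : ∀ a, κ a = 0 → Y₁ a = 1 ∧ Y₂ a = 0 := by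
    intro a ha
    have h1 : a ≠ c₁ := fun h => by simp [h, hc₁] at ha
    have h2 : a ≠ c₂ := fun h => by simp [h, hc₂] at ha
    rw [hY₁, hY₂, balanced_of_ne _ h1, balanced_of_ne _ h2]
    simp [b₁, b₂, ha]
  have hB : ∀ b, κ b = 1 → Y₁ b = 0 ∧ Y₂ b = 1 := by
    intro b hb
    have h1 : b ≠ c₁ := fun h => by simp [h, hc₁] at hb
    have h2 : b ≠ c₂ := fun h => by simp [h, hc₂] at hb
    rw [hY₁, hY₂, balanced_of_ne _ h1, balanced_of_ne _ h2]
    simp [b₁, b₂, hb]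
  have hC1 : Y₁ c₁ ≠ 0 ∧ Y₂ c₁ = 0 := by
    rw [hY₁, hY₂, balanced_of_ne _ h12]
    refine ⟨?_, by simp [b₂, hc₁]⟩
    have : b₁ c₁ = 0 := by simp [b₁, hc₁]
    simp [balanced, this, hb₁.ne']
  have hC2 : Y₁ c₂ = 0 ∧ Y₂ c₂ ≠ 0 := by
    rw [hY₁, hY₂, balanced_of_ne _ h12.symm]
    refine ⟨by simp [b₁, hc₂], ?_⟩
    have : b₂ c₂ = 0 := by simp [b₂, hc₂]
    simp [balanced, this, hb₂.ne']
  have hC : ∀ c, κ c = 2 → c ≠ c₁ → c ≠ c₂ → Y₁ c = 1 ∧ Y₂ c = 1 := by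
    intro c hc h1 h2
    rw [hY₁, hY₂, balanced_of_ne _ h1, balanced_of_ne _ h2]
    simp [b₁, b₂, hc, h1, h2]
  -- adding a point mass places `a₀` at the origin, so that affine dependencies can be read off
  -- from linear ones
  let Φ : ℝ × ℝ × ℝ →ₗ[ℝ] (V → ℝ) :=
    { toFun := fun x => x.1 • Y₁ + x.2.1 • Y₂ + Pi.single a₀ x.2.2
      map_add' := fun x y => by
        simp only [Prod.fst_add, Prod.snd_add, add_smul, Pi.single_add]
        abel
      map_smul' := fun r x => by
        simp only [Prod.smul_fst, Prod.smul_snd, smul_add, mul_smul, smul_eq_mul,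
          RingHom.id_apply, ← Pi.single_smul] }
  have hΦ : Function.Injective Φ := by
    rw [← LinearMap.ker_eq_bot, LinearMap.ker_eq_bot']
    rintro ⟨s, t, r⟩ h
    have hval : ∀ v, s * Y₁ v + t * Y₂ v + (Pi.single a₀ r : V → ℝ) v = 0 := fun v => congrFun h v
    have hba : b₀ ≠ a₀ := fun h => by simp [h, ha₀] at hb₀
    have hca : c₃ ≠ a₀ := fun h => by simp [h, ha₀] at hc₃
    have e1 := hval b₀
    have e2 := hval c₃
    have e3 := hval a₀
    rw [(hB b₀ hb₀).1, (hB b₀ hb₀).2, Pi.single_eq_of_ne hba] at e1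
    rw [(hC c₃ hc₃ h13.symm h23.symm).1, (hC c₃ hc₃ h13.symm h23.symm).2,
      Pi.single_eq_of_ne hca] at e2
    rw [(hA a₀ ha₀).1, (hA a₀ ha₀).2, Pi.single_eq_same] at e3
    have ht : t = 0 := by linarith
    have hs : s = 0 := by linarith
    have hr : r = 0 := by linarith
    rw [hs, ht, hr]
    rfl
  obtain ⟨p, hp, -, -⟩ := exists_config (d := d) (LinearMap.range Φ) (by
    rw [LinearMap.finrank_range_of_inj hΦ, hd, Module.finrank_prod, Module.finrank_prod,
      Module.finrank_self]
    omega)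
  refine ⟨p, Y₁, Y₂, fun y hy => ?_, hA, hB, hC1, hC2, hC⟩
  obtain ⟨⟨s, t, r⟩, rfl⟩ := (hp y).1 hy.1
  have hsum : ∑ v, (s * Y₁ v + t * Y₂ v + (Pi.single a₀ r : V → ℝ) v) = 0 := hy.2
  rw [Finset.sum_add_distrib, Finset.sum_add_distrib, ← Finset.mul_sum, ← Finset.mul_sum, hY₁, hY₂,
    sum_balanced, sum_balanced, Finset.sum_pi_single'] at hsum
  have hr : r = 0 := by simpa using hsum
  refine ⟨s, t, ?_⟩
  change s • Y₁ + t • Y₂ + Pi.single a₀ r = _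
  rw [hr, Pi.single_zero, add_zero]

theorem IsGalePair.bracket_ne_zero {V : Type*} [Fintype V] {d : ℕ} {p : V → Fin d → ℝ}
    {y₁ y₂ : V → ℝ} (hy : IsGalePair p y₁ y₂) {a b : V}
    (hab : ∀ y, IsAffineDependency p y → y a = 0 → y b = 0 → y = 0) :
    y₁ a * y₂ b - y₁ b * y₂ a ≠ 0 := by
  intro h
  have hdep : ∀ r s : ℝ, IsAffineDependency p (r • y₁ + s • y₂) := by
    intro r s
    rw [← mem_ker_dependencyMap]
    exact add_mem (Submodule.smul_mem _ _ (mem_ker_dependencyMap.2 hy.left))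
      (Submodule.smul_mem _ _ (mem_ker_dependencyMap.2 hy.right))
  have h1 := hy.indep _ _ (hab _ (hdep (y₂ a) (-y₁ a)) (by simp; ring) (by
    simp only [Pi.add_apply, Pi.smul_apply, smul_eq_mul]; linarith))
  have h2 := hy.indep _ _ (hab _ (hdep (y₂ b) (-y₁ b)) (by
    simp only [Pi.add_apply, Pi.smul_apply, smul_eq_mul]; linarith) (by simp; ring))
  have h3 := hy.indep 1 0 (by
    rw [one_smul, zero_smul, add_zero]
    exact hab _ hy.left (by linarith [h1.2]) (by linarith [h2.2]))
  exact one_ne_zero h3.1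

theorem colorForm_eval_root {V : Type*} [Fintype V] {κ : V → Fin 3} {y₁ y₂ : V → ℝ} {c : V}
    (hc : y₂ c ≠ 0) (i : Fin 3) :
    y₂ c ^ colorCard κ i * (colorForm κ y₁ y₂ i).eval (-y₁ c / y₂ c) =
      ∏ a with κ a = i, (y₁ a * y₂ c - y₂ a * y₁ c) := by
  rw [colorForm, Polynomial.eval_prod, colorCard, ← Finset.prod_const, ← Finset.prod_mul_distrib]
  refine Finset.prod_congr rfl fun a _ => ?_
  simp only [galeForm, Polynomial.eval_add, Polynomial.eval_mul, Polynomial.eval_C,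
    Polynomial.eval_X]
  field_simp
  ring

/-- The Gale transform of a generic embedding has the properties needed for the failure of
levelness: by genericity, the finitely many polynomial inequations that are required only have to be
checked at one special configuration. -/
theorem IsGenericEmbedding.exists_galePair {κ : V → Fin 3} {p : V → Fin d → ℝ}
    (hp : IsGenericEmbedding p) (hd : Fintype.card V = d + 3)
    (h01 : colorCard κ 0 = colorCard κ 1) (h0 : 1 ≤ colorCard κ 0) (h2 : 3 ≤ colorCard κ 2) :
    ∃ y₁ y₂, IsGalePair p y₁ y₂ ∧ (∀ a b, κ a = 0 → κ b = 1 → y₁ a * y₂ b - y₁ b * y₂ a ≠ 0) ∧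
      colorForm κ y₁ y₂ 2 ≠ 0 ∧ ∀ (r s : ℝ) (R : Polynomial ℝ),
        Polynomial.C r * colorForm κ y₁ y₂ 0 + Polynomial.C s * colorForm κ y₁ y₂ 1 =
          R * colorForm κ y₁ y₂ 2 → r = 0 ∧ s = 0 := by
  obtain ⟨a₀, ha₀⟩ := Finset.card_pos.1 h0
  obtain ⟨b₀, hb₀⟩ := Finset.card_pos.1 (h01 ▸ h0)
  obtain ⟨c₁, c₂, c₃, hc₁, hc₂, hc₃, h12, h13, h23⟩ := Finset.two_lt_card_iff.1 h2
  simp only [Finset.mem_filter, Finset.mem_univ, true_and] at ha₀ hb₀ hc₁ hc₂ hc₃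
  obtain ⟨p₀, Y₁, Y₂, hK, hA, hB, hC1, hC2, hC⟩ :=
    exists_special_config hd ha₀ hb₀ hc₁ hc₂ hc₃ h12 h13 h23
  have hY3 := hC c₃ hc₃ h13.symm h23.symm
  let e : V ≃ Fin d ⊕ Fin 3 := Fintype.equivOfCardEq (by simp [hd])
  have hbr : ∀ v w, (∀ s t : ℝ, s * Y₁ v + t * Y₂ v = 0 → s * Y₁ w + t * Y₂ w = 0 →
      s = 0 ∧ t = 0) → bracket e p₀ v w ≠ 0 := by
    intro v w h
    rw [bracket_ne_zero_iff]
    intro y hy hv hw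
    obtain ⟨s, t, rfl⟩ := hK y hy
    obtain ⟨rfl, rfl⟩ := h s t hv hw
    simp
  have hab₀ : ∀ a b, κ a = 0 → κ b = 1 → bracket e p₀ a b ≠ 0 := by
    intro a b ha hb
    refine hbr a b fun s t h1 h2 => ?_
    rw [(hA a ha).1, (hA a ha).2] at h1
    rw [(hB b hb).1, (hB b hb).2] at h2
    exact ⟨by linarith, by linarith⟩
  have hac₀ : bracket e p₀ a₀ c₃ ≠ 0 := by
    refine hbr _ _ fun s t h1 h2 => ?_
    rw [(hA a₀ ha₀).1, (hA a₀ ha₀).2] at h1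
    rw [hY3.1, hY3.2] at h2
    exact ⟨by linarith, by linarith⟩
  have hca₀ : ∀ c, κ c = 2 → c ≠ c₁ → bracket e p₀ c a₀ ≠ 0 := by
    intro c hc hne
    refine hbr _ _ fun s t h1 h2 => ?_
    rw [(hA a₀ ha₀).1, (hA a₀ ha₀).2] at h2
    have hs : s = 0 := by linarith
    rw [hs, zero_mul, zero_add] at h1
    refine ⟨hs, (mul_eq_zero.1 h1).resolve_right ?_⟩
    by_cases hc2 : c = c₂
    · rw [hc2]
      exact hC2.2
    · rw [(hC c hc hne hc2).2]
      exact one_ne_zero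
  have hc1₀ : bracket e p₀ c₁ c₃ ≠ 0 := by
    refine hbr _ _ fun s t h1 h2 => ?_
    rw [hC1.2, mul_zero, add_zero] at h1
    rw [hY3.1, hY3.2] at h2
    have hs := (mul_eq_zero.1 h1).resolve_right hC1.1
    exact ⟨hs, by linarith⟩
  have hc2₀ : bracket e p₀ c₂ c₃ ≠ 0 := by
    refine hbr _ _ fun s t h1 h2 => ?_
    rw [hC2.1, mul_zero, zero_add] at h1
    rw [hY3.1, hY3.2] at h2
    have ht := (mul_eq_zero.1 h1).resolve_right hC2.2
    exact ⟨by linarith, ht⟩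
  -- at the special configuration the form of colour `0` vanishes at the root of `c₁` but not at
  -- that of `c₂`, and the form of colour `1` does not vanish at the root of `c₁`
  have hdet₀ : colorDet κ e a₀ c₃ c₁ c₂ p₀ ≠ 0 := by
    obtain ⟨s₁, t₁, h1⟩ := hK _ (isAffineDependency_bracket e p₀ a₀)
    obtain ⟨s₂, t₂, h2⟩ := hK _ (isAffineDependency_bracket e p₀ c₃)
    have e1 : ∀ v, bracket e p₀ v a₀ = s₁ * Y₁ v + t₁ * Y₂ v := fun v => congrFun h1 v
    have e2 : ∀ v, bracket e p₀ v c₃ = s₂ * Y₁ v + t₂ * Y₂ v := fun v => congrFun h2 v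
    have hs₁ : s₁ = 0 := by
      have := e1 a₀
      rw [bracket_self, (hA a₀ ha₀).1, (hA a₀ ha₀).2] at this
      linarith
    have ht₁ : t₁ ≠ 0 := by
      have := hca₀ c₃ hc₃ h13.symm
      rw [e1, hs₁, hY3.2, zero_mul, zero_add, mul_one] at this
      exact this
    have ht₂ : t₂ = -s₂ := by
      have := e2 c₃
      rw [bracket_self, hY3.1, hY3.2] at this
      linarith
    have hs₂ : s₂ ≠ 0 := by
      have := hac₀
      rw [e2, (hA a₀ ha₀).1, (hA a₀ ha₀).2, mul_one, mul_zero, add_zero] at this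
      exact this
    have hF1 : colorValue κ e a₀ c₃ p₀ 0 c₁ = 0 := by
      refine Finset.prod_eq_zero (i := a₀) (by simpa using ha₀) ?_
      rw [bracket_self, e1 c₁, hs₁, hC1.2]
      ring
    have hF2 : colorValue κ e a₀ c₃ p₀ 0 c₂ ≠ 0 := by
      refine Finset.prod_ne_zero_iff.2 fun a ha => ?_
      have ha : κ a = 0 := by simpa using ha
      rw [e1, e1, e2, e2, hs₁, (hA a ha).1, (hA a ha).2, hC2.1]
      have : (0 * 1 + t₁ * 0) * (s₂ * 0 + t₂ * Y₂ c₂) - (s₂ * 1 + t₂ * 0) * (0 * 0 + t₁ * Y₂ c₂) =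
          -(s₂ * (t₁ * Y₂ c₂)) := by ring
      rw [this]
      exact neg_ne_zero.2 (mul_ne_zero hs₂ (mul_ne_zero ht₁ hC2.2))
    have hG1 : colorValue κ e a₀ c₃ p₀ 1 c₁ ≠ 0 := by
      refine Finset.prod_ne_zero_iff.2 fun b hb => ?_
      have hb : κ b = 1 := by simpa using hb
      rw [e1, e1, e2, e2, hs₁, (hB b hb).1, (hB b hb).2, hC1.2]
      have : (0 * 0 + t₁ * 1) * (s₂ * Y₁ c₁ + t₂ * 0) - (s₂ * 0 + t₂ * 1) * (0 * Y₁ c₁ + t₁ * 0) =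
          t₁ * (s₂ * Y₁ c₁) := by ring
      rw [this]
      exact mul_ne_zero ht₁ (mul_ne_zero hs₂ hC1.1)
    rw [colorDet, hF1, zero_mul, zero_sub]
    exact neg_ne_zero.2 (mul_ne_zero hF2 hG1)
  have hac := hp.bracket_ne_zero e hac₀
  have hy := isGalePair_bracket e p hac
  have hy2c1 := hp.bracket_ne_zero e hc1₀
  have hy2c2 := hp.bracket_ne_zero e hc2₀
  refine ⟨_, _, hy, fun a b ha hb => ?_, ?_, fun r s R hR => ?_⟩
  · exact hy.bracket_ne_zero
      ((bracket_ne_zero_iff e p a b).1 (hp.bracket_ne_zero e (hab₀ a b ha hb)))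
  · rw [colorForm, Finset.prod_ne_zero_iff]
    intro c hc h0
    have hc : κ c = 2 := by simpa using hc
    have g0 := congrArg (fun q => Polynomial.coeff q 0) h0
    have g1 := congrArg (fun q => Polynomial.coeff q 1) h0
    simp [galeForm] at g0 g1
    by_cases hne : c = c₁
    · rw [hne] at g1
      exact hy2c1 g1
    · exact hp.bracket_ne_zero e (hca₀ c hc hne) g0
  · have heq : ∀ c, κ c = 2 → bracket e p c c₃ ≠ 0 →
        r * colorValue κ e a₀ c₃ p 0 c + s * colorValue κ e a₀ c₃ p 1 c = 0 := by
      intro c hc hne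
      have h3 := congrArg (Polynomial.eval (-bracket e p c a₀ / bracket e p c c₃)) hR
      have hz : (colorForm κ (fun x => bracket e p x a₀) (fun x => bracket e p x c₃) 2).eval
          (-bracket e p c a₀ / bracket e p c c₃) = 0 := by
        rw [colorForm, Polynomial.eval_prod]
        refine Finset.prod_eq_zero (i := c) (by simpa using hc) ?_
        simp only [galeForm, Polynomial.eval_add, Polynomial.eval_mul, Polynomial.eval_C,
          Polynomial.eval_X]
        field_simp
        ring
      rw [Polynomial.eval_mul, hz, mul_zero, Polynomial.eval_add, Polynomial.eval_mul,
        Polynomial.eval_mul, Polynomial.eval_C, Polynomial.eval_C] at h3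
      have f0 := colorForm_eval_root (κ := κ) (y₁ := fun x => bracket e p x a₀)
        (y₂ := fun x => bracket e p x c₃) hne 0
      have f1 := colorForm_eval_root (κ := κ) (y₁ := fun x => bracket e p x a₀)
        (y₂ := fun x => bracket e p x c₃) hne 1
      rw [← h01] at f1
      rw [colorValue, colorValue, ← f0, ← f1]
      linear_combination bracket e p c c₃ ^ colorCard κ 0 * h3
    exact eq_zero_of_two_equations (heq c₁ hc₁ hy2c1) (heq c₂ hc₂ hy2c2)
      (hp.colorDet_ne_zero e hdet₀)

end Generic

/-! ### Joins of boundaries of three simplices -/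

theorem mem_allFaces_boundarySimplex {n : ℕ} (hn : 1 ≤ n) {s : Finset (Fin (n + 1))} :
    s ∈ AllFaces (boundarySimplex n hn).toPreAbstractSimplicialComplex ↔ ∃ v, v ∉ s := by
  rcases s.eq_empty_or_nonempty with rfl | hs
  · exact iff_of_true (Or.inl rfl) ⟨0, Finset.notMem_empty 0⟩
  · rw [← mem_faces_iff_mem_allFaces _ hs]
    simp [boundarySimplex, hs, Finset.eq_univ_iff_forall]

theorem mem_allFaces_join {α β : Type*} {Δ : AbstractSimplicialComplex α}
    {Γ : AbstractSimplicialComplex β} {s : Finset (α ⊕ β)} :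
    s ∈ AllFaces (join Δ Γ).toPreAbstractSimplicialComplex ↔
      s.toLeft ∈ AllFaces Δ.toPreAbstractSimplicialComplex ∧
        s.toRight ∈ AllFaces Γ.toPreAbstractSimplicialComplex := by
  rcases s.eq_empty_or_nonempty with rfl | hs
  · exact iff_of_true (Or.inl rfl) ⟨Or.inl (by ext; simp), Or.inl (by ext; simp)⟩
  · rw [← mem_faces_iff_mem_allFaces _ hs]
    simp [join, hs]

/-- The colouring of the vertices of a join of three complexes by the factor they belong to. -/
def tripleColor (α β γ : Type*) : α ⊕ β ⊕ γ → Fin 3 :=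
  Sum.elim (fun _ => 0) (Sum.elim (fun _ => 1) fun _ => 2)

theorem isColorComplex_tripleJoin {u k : ℕ} (hk : 1 ≤ k) (hu : 3 * k ≤ u) :
    IsColorComplex (tripleColor (Fin (u - k + 1)) (Fin (u - k + 1)) (Fin (2 * k + 1)))
      (tripleJoin u k hk hu) := by
  intro s
  rw [tripleJoin, mem_allFaces_join, mem_allFaces_join, mem_allFaces_boundarySimplex,
    mem_allFaces_boundarySimplex, mem_allFaces_boundarySimplex]
  simp [Fin.forall_fin_succ, tripleColor]

section TripleColor

variable {α β γ : Type*} [Fintype α] [Fintype β] [Fintype γ]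

theorem colorCard_tripleColor_zero : colorCard (tripleColor α β γ) 0 = Fintype.card α := by
  rw [colorCard, Finset.card_filter, Fintype.sum_sum_type, Fintype.sum_sum_type]
  simp [tripleColor]

theorem colorCard_tripleColor_one : colorCard (tripleColor α β γ) 1 = Fintype.card β := by
  rw [colorCard, Finset.card_filter, Fintype.sum_sum_type, Fintype.sum_sum_type]
  simp [tripleColor]

theorem colorCard_tripleColor_two : colorCard (tripleColor α β γ) 2 = Fintype.card γ := by
  rw [colorCard, Finset.card_filter, Fintype.sum_sum_type, Fintype.sum_sum_type]
  simp [tripleColor]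

end TripleColor

theorem isPolytopal_tripleJoin {u k : ℕ} (hk : 1 ≤ k) (hu : 3 * k ≤ u) :
    IsPolytopal (2 * u) (tripleJoin u k hk hu) :=
  (isColorComplex_tripleJoin hk hu).isPolytopal (by simp; omega)

theorem sphereClass_tripleJoin {u k : ℕ} (hk : 1 ≤ k) (hu : 3 * k ≤ u) :
    SphereClass u (2 * u) (tripleJoin u k hk hu) := by
  have hΔ := isColorComplex_tripleJoin hk hu
  refine ⟨hΔ.isHomologySphere (by simp; omega), fun τ hτ => ?_⟩
  obtain ⟨i, rfl⟩ := hΔ.isMissingFace_iff.1 hτ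
  change colorCard _ i ≤ u + 1
  fin_cases i
  · exact colorCard_tripleColor_zero.trans_le (by simp)
  · exact colorCard_tripleColor_one.trans_le (by simp)
  · exact colorCard_tripleColor_two.trans_le (by simp; omega)

theorem tripleJoin_not_level {u k : ℕ} (hk : 1 ≤ k) (hu : 3 * k ≤ u)
    {p : Fin (u - k + 1) ⊕ Fin (u - k + 1) ⊕ Fin (2 * k + 1) → Fin (2 * u) → ℝ}
    (hp : IsGenericEmbedding p ∨ IsNaturalEmbedding (tripleJoin u k hk hu) p) :
    Module.Finite ℝ (ringA (tripleJoin u k hk hu) p) ∧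
      ¬ IsLevel (artinianIdeal (tripleJoin u k hk hu) p) ∧
      ¬ StressReconstruction (tripleJoin u k hk hu) p u := by
  have hΔ := isColorComplex_tripleJoin hk hu
  set κ := tripleColor (Fin (u - k + 1)) (Fin (u - k + 1)) (Fin (2 * k + 1))
  have h0 : colorCard κ 0 = u - k + 1 := colorCard_tripleColor_zero.trans (Fintype.card_fin _)
  have h1 : colorCard κ 1 = u - k + 1 := colorCard_tripleColor_one.trans (Fintype.card_fin _)
  have h2 : colorCard κ 2 = 2 * k + 1 := colorCard_tripleColor_two.trans (Fintype.card_fin _)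
  have hd : Fintype.card (Fin (u - k + 1) ⊕ Fin (u - k + 1) ⊕ Fin (2 * k + 1)) = 2 * u + 3 := by
    simp
    omega
  have hgale : ∃ y₁ y₂, IsGalePair p y₁ y₂ ∧
      (∀ a b, κ a = 0 → κ b = 1 → y₁ a * y₂ b - y₁ b * y₂ a ≠ 0) ∧
      colorForm κ y₁ y₂ 2 ≠ 0 ∧ ∀ (r s : ℝ) (R : Polynomial ℝ),
        Polynomial.C r * colorForm κ y₁ y₂ 0 + Polynomial.C s * colorForm κ y₁ y₂ 1 =
          R * colorForm κ y₁ y₂ 2 → r = 0 ∧ s = 0 := by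
    rcases hp with hp | hp
    · exact hp.exists_galePair hd (h0.trans h1.symm) (by omega) (by omega)
    · exact hp.exists_galePair hΔ hd (by omega) (h0.trans h1.symm) (by omega)
  obtain ⟨y₁, y₂, hy, hab, hne, hrel⟩ := hgale
  exact hΔ.not_level hy h0 h1 h2 (by omega) (by omega) (by omega) (by omega) hab hne hrel

theorem not_reconstructionConjecture {u : ℕ} (hu : 3 ≤ u) :
    ¬ ReconstructionConjecture (2 * u) u := by
  intro h
  obtain ⟨p, hp⟩ := isPolytopal_tripleJoin le_rfl (show 3 * 1 ≤ u from hu)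
  refine (tripleJoin_not_level le_rfl hu (Or.inr hp)).2.2 (h _ _ ?_ p (Or.inr hp))
  rw [show 2 * u - u = u by omega]
  exact sphereClass_tripleJoin le_rfl hu

end SphereStress

theorem mainTheorem6 :
    (∀ u : ℕ, 3 ≤ u →
      ∃ (V : Type) (_ : Fintype V) (_ : DecidableEq V) (Δ : AbstractSimplicialComplex V),
        SphereStress.IsPolytopal (2 * u) Δ ∧ SphereStress.SphereClass u (2 * u) Δ ∧
        ∀ p : V → Fin (2 * u) → ℝ,
          SphereStress.IsGenericEmbedding p ∨ SphereStress.IsNaturalEmbedding Δ p →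
            Module.Finite ℝ (SphereStress.ringA Δ p) ∧
            ¬ SphereStress.IsLevel (SphereStress.artinianIdeal Δ p)) ∧
    (∀ u : ℕ, 3 ≤ u → ¬ SphereStress.ReconstructionConjecture (2 * u) u) ∧
    (∀ (u k : ℕ) (hk : 1 ≤ k) (hu : 3 * k ≤ u),
      SphereStress.IsPolytopal (2 * u) (SphereStress.tripleJoin u k hk hu) ∧
      SphereStress.SphereClass u (2 * u) (SphereStress.tripleJoin u k hk hu) ∧
      ∀ p : Fin (u - k + 1) ⊕ Fin (u - k + 1) ⊕ Fin (2 * k + 1) → Fin (2 * u) → ℝ,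
        SphereStress.IsGenericEmbedding p ∨
            SphereStress.IsNaturalEmbedding (SphereStress.tripleJoin u k hk hu) p →
          Module.Finite ℝ (SphereStress.ringA (SphereStress.tripleJoin u k hk hu) p) ∧
          ¬ SphereStress.IsLevel
            (SphereStress.artinianIdeal (SphereStress.tripleJoin u k hk hu) p) ∧
          ¬ SphereStress.StressReconstruction (SphereStress.tripleJoin u k hk hu) p u) := by
  refine ⟨fun u hu => ?_, fun u hu => SphereStress.not_reconstructionConjecture hu,
    fun u k hk hu => ⟨SphereStress.isPolytopal_tripleJoin hk hu,
      SphereStress.sphereClass_tripleJoin hk hu,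
      fun p hp => SphereStress.tripleJoin_not_level hk hu hp⟩⟩
  refine ⟨_, inferInstance, inferInstance, SphereStress.tripleJoin u 1 le_rfl hu,
    SphereStress.isPolytopal_tripleJoin le_rfl hu, SphereStress.sphereClass_tripleJoin le_rfl hu,
    fun p hp => ?_⟩
  have h := SphereStress.tripleJoin_not_level le_rfl hu hp
  exact ⟨h.1, h.2.1⟩
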